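/- Let $m,n$ be non-negative integers. The Yangian $\mathrm{Y}(\mathfrak{gl}_n)$ is the complex unital associative algebra with generators $T_{ij}^{(1)},T_{ij}^{(2)},\dots$ ($1\le i,j\le n$) and the relations $$(u-v)\,[T_{ij}(u),T_{kl}(v)]=T_{kj}(u)T_{il}(v)-T_{kj}(v)T_{il}(u),\qquad T_{ij}(u)=\delta_{ij}+T^{(1)}_{ij}u^{-1}+T^{(2)}_{ij}u^{-2}+\cdots .$$ For $z\in\mathbb C$ let $\tau_z$ be its automorphism $T_{ij}(u)\mapsto T_{ij}(u-z)$; let $\pi_n:\mathrm{Y}(\mathfrak{gl}_n)\to\mathrm{U}(\mathfrak{gl}_n)$ be the homomorphism $T^{(1)}_{ij}\mapsto E_{ij}$, $T^{(s)}_{ij}\mapsto 0$ for $s\ge2$; tensor products of $\mathrm{Y}(\mathfrak{gl}_n)$-modules are formed with the comultiplication $T_{ij}(u)\mapsto\sum_k T_{ik}(u)\otimes T_{kj}(u)$. Let $x_{ai}$ be the standard basis vectors of $\mathbb C^m\otimes\mathbb C^n$, acting on $\Lambda(\mathbb C^m\otimes\mathbb C^n)$ by left multiplication, and let $\partial_{ai}$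 be the corresponding left derivations. For a $\mathfrak{gl}_m$-module $V$ let $\mathcal E_m(V)=V\otimes\Lambda(\mathbb C^m\otimes\mathbb C^n)$ be the bimodule over $\mathfrak{gl}_m$ and $\mathrm{Y}(\mathfrak{gl}_n)$ on which $E_{ab}\in\mathfrak{gl}_m$ acts as $E_{ab}\otimes1+\sum_k 1\otimes x_{ak}\partial_{bk}$ and $T_{ij}^{(s+1)}$, $s\ge 0$, acts as $$\sum_{c_0,\dots,c_s=1}^m E_{c_1c_0}E_{c_2c_1}\cdots E_{c_sc_{s-1}}\otimes x_{c_0i}\,\partial_{c_sj};$$ these two actions commute. Let $\mathcal E_m^z(V)$ be the same $\mathfrak{gl}_m$-module with the action of $\mathrm{Y}(\mathfrak{gl}_n)$ pulled back through $\tau_{-z}$. Let $\mathfrak h\subset\mathfrak{gl}_m$ be spanned by $E_{11},\dots,E_{mm}$ and $\mathfrak n$ by the $E_{ba}$ with $a<b$. For $\mu=(\mu_1,\dots,\mu_m)\in\mathbb C^m$ let $M_\mu$ be the Verma module, the quotient of $\mathrm U(\mathfrak{gl}_m)$ by the left ideal generated by the $E_{ab}$ with $a<b$ and the $E_{aa}-\mu_a$.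 The space of coinvariants $\mathcal E_m(M_\mu)_{\mathfrak n}=\mathcal E_m(M_\mu)/\mathfrak n\cdot\mathcal E_m(M_\mu)$ is a bimodule over $\mathfrak h$ and $\mathrm Y(\mathfrak{gl}_n)$. Identify $\mathfrak h$ with $\mathfrak{gl}_1\oplus\cdots\oplus\mathfrak{gl}_1$ ($m$ summands) through $E_{11},\dots,E_{mm}$. **Corollary 2.4.** (a) The bimodule $\mathcal E_m(M_\mu)_{\mathfrak n}$ over $\mathfrak h$ and $\mathrm Y(\mathfrak{gl}_n)$ is isomorphic to $$\mathcal E_1(M_{\mu_1})\otimes\mathcal E_1^{1}(M_{\mu_2})\otimes\cdots\otimes\mathcal E_1^{m-1}(M_{\mu_m}).$$ (b) For $w\in\mathbb C$ let $\Lambda(\mathbb C^n)_w$ be the $\mathrm Y(\mathfrak{gl}_n)$-module obtained from the $\mathfrak{gl}_n$-module $\Lambda(\mathbb C^n)$ by pulling back through $\pi_n$ and then through $\tau_w$; every exterior power $\Lambda^N(\mathbb C^n)$ is a submodule of it. For all $t,z\in\mathbb C$ the bimodule $\mathcal E_1^z(M_t)$ over $\mathfrak{gl}_1$ and $\mathrm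 Y(\mathfrak{gl}_n)$ is isomorphic to $\Lambda(\mathbb C^n)_{t-z}$, where $E_{11}$ acts as $t+\sum_k x_k\partial_k$, that is, as $t+N$ on $\Lambda^N(\mathbb C^n)$. (c) Consequently $\mathcal E_m(M_\mu)_{\mathfrak n}$ is isomorphic, as a bimodule over $\mathfrak h$ and $\mathrm Y(\mathfrak{gl}_n)$, to $$\Lambda(\mathbb C^n)_{\mu_1}\otimes\Lambda(\mathbb C^n)_{\mu_2-1}\otimes\cdots\otimes\Lambda(\mathbb C^n)_{\mu_m-m+1},$$ where $E_{aa}\in\mathfrak h$ acts on the $a$-th tensor factor as $\mu_a+\sum_k x_k\partial_k$. -/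

import Mathlib

open scoped TensorProduct

attribute [local instance] LieRing.ofAssociativeRing

namespace KN

/-! ### The Yangian of `gl_n` -/

section Yangian

/-- A family `t s i j` (`s = 0, 1, 2, …`) in a ring satisfies the defining relations of the Yangian
of `gl_n`: with `t_ij(u) = ∑_s t s i j u^{-s}` one has `t 0 i j = δ_ij` and
`(u - v) [t_ij(u), t_kl(v)] = t_kj(u) t_il(v) - t_kj(v) t_il(u)`.
The second condition compares the coefficients at `u^{-r} v^{-s}`. -/
structure IsRTT {n : ℕ} {A : Type*} [Ring A] (t : ℕ → Fin n → Fin n → A) : Prop where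
  zero : ∀ i j, t 0 i j = if i = j then 1 else 0
  rel : ∀ r s i j k l,
    (t (r + 1) i j * t s k l - t s k l * t (r + 1) i j)
      - (t r i j * t (s + 1) k l - t (s + 1) k l * t r i j)
      = t r k j * t s i l - t s k j * t r i l

/-- The free generators `T_ij^{(s)}`, `s ≥ 1`, together with `T_ij^{(0)} = δ_ij`. The letter
`(s, i, j)` of the free algebra stands for `T_ij^{(s+1)}`. -/
noncomputable def freeT (n : ℕ) : ℕ → Fin n → Fin n → FreeAlgebra ℂ (ℕ × Fin n × Fin n)
  | 0, i, j => if i = j then 1 else 0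
  | s + 1, i, j => FreeAlgebra.ι ℂ (s, i, j)

/-- The defining relations of the Yangian. -/
inductive YangianRel (n : ℕ) :
    FreeAlgebra ℂ (ℕ × Fin n × Fin n) → FreeAlgebra ℂ (ℕ × Fin n × Fin n) → Prop
  | rtt (r s : ℕ) (i j k l : Fin n) : YangianRel n
      ((freeT n (r + 1) i j * freeT n s k l - freeT n s k l * freeT n (r + 1) i j)
        - (freeT n r i j * freeT n (s + 1) k l - freeT n (s + 1) k l * freeT n r i j))
      (freeT n r k j * freeT n s i l - freeT n s k j * freeT n r i l)

/-- The Yangian `Y(gl_n)` as an associative unital complex algebra. -/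
abbrev Yangian (n : ℕ) : Type := RingQuot (YangianRel n)

/-- The elements `T_ij^{(s)}` of the Yangian. -/
noncomputable def T (n : ℕ) (s : ℕ) (i j : Fin n) : Yangian n :=
  RingQuot.mkAlgHom ℂ (YangianRel n) (freeT n s i j)

theorem T_isRTT (n : ℕ) : IsRTT (T n) where
  zero i j := by
    show RingQuot.mkAlgHom ℂ (YangianRel n) (freeT n 0 i j) = if i = j then 1 else 0
    simp only [freeT]
    split_ifs
    · exact map_one _
    · exact map_zero _
  rel r s i j k l := by
    have h := RingQuot.mkAlgHom_rel ℂ (YangianRel.rtt r s i j k l)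
    simp only [map_sub, map_mul] at h
    exact h

/-- The universal property of the Yangian. -/
noncomputable def Yangian.lift {n : ℕ} {A : Type*} [Ring A] [Algebra ℂ A]
    (t : ℕ → Fin n → Fin n → A) (ht : IsRTT t) : Yangian n →ₐ[ℂ] A :=
  RingQuot.liftAlgHom ℂ ⟨FreeAlgebra.lift ℂ fun p => t (p.1 + 1) p.2.1 p.2.2, by
    have key : ∀ s i j, FreeAlgebra.lift ℂ (fun p : ℕ × Fin n × Fin n => t (p.1 + 1) p.2.1 p.2.2)
        (freeT n s i j) = t s i j := by
      intro s i j
      cases s with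
      | zero => rw [ht.zero]; simp only [freeT]; split_ifs <;> simp
      | succ s => simp [freeT]
    rintro _ _ ⟨r, s, i, j, k, l⟩
    simp only [map_sub, map_mul, key]
    exact ht.rel r s i j k l⟩

theorem Yangian.lift_T {n : ℕ} {A : Type*} [Ring A] [Algebra ℂ A]
    (t : ℕ → Fin n → Fin n → A) (ht : IsRTT t) (s : ℕ) (i j : Fin n) :
    Yangian.lift t ht (T n s i j) = t s i j := by
  unfold Yangian.lift T
  rw [RingQuot.liftAlgHom_mkAlgHom_apply]
  cases s with
  | zero => rw [ht.zero]; simp only [freeT]; split_ifs <;> simp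
  | succ s => simp [freeT]

/-- A property of elements of the Yangian that is stable under the algebra operations and holds for
all generators `T_ij^{(s)}` holds for all elements. -/
theorem Yangian.induction {n : ℕ} {P : Yangian n → Prop}
    (scalar : ∀ c : ℂ, P (algebraMap ℂ _ c)) (gen : ∀ s i j, P (T n (s + 1) i j))
    (add : ∀ x y, P x → P y → P (x + y)) (mul : ∀ x y, P x → P y → P (x * y))
    (y : Yangian n) : P y := by
  obtain ⟨w, rfl⟩ := RingQuot.mkAlgHom_surjective ℂ (YangianRel n) y
  induction w using FreeAlgebra.induction with
  | grade0 c => rw [AlgHom.commutes]; exact scalar c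
  | grade1 p => exact gen p.1 p.2.1 p.2.2
  | add a b ha hb => rw [map_add]; exact add _ _ ha hb
  | mul a b ha hb => rw [map_mul]; exact mul _ _ ha hb

/-- The coefficient at `u^{-s}` of the re-expansion of `(u - z)^{-k}` in powers of `u^{-1}`. -/
def shiftCoeff (z : ℂ) : ℕ → ℕ → ℂ
  | 0, 0 => 1
  | 0, _ + 1 => 0
  | _ + 1, 0 => 0
  | s + 1, k + 1 => (s.choose k : ℂ) * z ^ (s - k)

theorem shiftCoeff_of_lt (z : ℂ) {s k : ℕ} (h : s < k) : shiftCoeff z s k = 0 := by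
  match s, k with
  | 0, k + 1 => rfl
  | s + 1, k + 1 => simp [shiftCoeff, Nat.choose_eq_zero_of_lt (Nat.lt_of_succ_lt_succ h)]

theorem shiftCoeff_succ_succ (z : ℂ) (s k : ℕ) :
    shiftCoeff z (s + 1) (k + 1) = z * shiftCoeff z s (k + 1) + shiftCoeff z s k := by
  match s, k with
  | 0, 0 => simp [shiftCoeff]
  | 0, k + 1 => simp [shiftCoeff]
  | s + 1, 0 => simp [shiftCoeff, pow_succ']
  | s + 1, k + 1 =>
    simp only [shiftCoeff, Nat.choose_succ_succ, Nat.cast_add, Nat.add_sub_add_right]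
    rcases Nat.lt_or_ge s (k + 1) with h | h
    · rw [Nat.choose_eq_zero_of_lt h]; simp
    · have : s - k = (s - (k + 1)) + 1 := by omega
      rw [this, pow_succ']; ring

/-- The family `t_ij(u - z)`, re-expanded in powers of `u^{-1}`. -/
noncomputable def shiftT {n : ℕ} {A : Type*} [Ring A] [Algebra ℂ A] (z : ℂ)
    (t : ℕ → Fin n → Fin n → A) : ℕ → Fin n → Fin n → A :=
  fun s i j => ∑ k ∈ Finset.range (s + 1), shiftCoeff z s k • t k i j

theorem IsRTT.shift {n : ℕ} {A : Type*} [Ring A] [Algebra ℂ A] (z : ℂ)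
    {t : ℕ → Fin n → Fin n → A} (ht : IsRTT t) : IsRTT (shiftT z t) := by
  have h0 : ∀ i j, shiftT z t 0 i j = if i = j then 1 else 0 := by
    intro i j; simp [shiftT, shiftCoeff, ht.zero]
  have hs : ∀ s i j, ∃ c : ℂ, shiftT z t (s + 1) i j = z • shiftT z t s i j
      + (∑ k ∈ Finset.range (s + 1), shiftCoeff z s k • t (k + 1) i j) + algebraMap ℂ A c := by
    intro s i j
    have e1 : shiftT z t (s + 1) i j = shiftCoeff z (s + 1) 0 • t 0 i j
        + ∑ k ∈ Finset.range (s + 1), shiftCoeff z (s + 1) (k + 1) • t (k + 1) i j := by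
      rw [shiftT, Finset.sum_range_succ' _ (s + 1), add_comm]
    have e2 : shiftT z t s i j = shiftCoeff z s 0 • t 0 i j
        + ∑ k ∈ Finset.range (s + 1), shiftCoeff z s (k + 1) • t (k + 1) i j := by
      rw [add_comm, ← Finset.sum_range_succ' (fun k => shiftCoeff z s k • t k i j),
        Finset.sum_range_succ _ (s + 1), shiftCoeff_of_lt z (Nat.lt_succ_self s)]
      simp [shiftT]
    refine ⟨if i = j then shiftCoeff z (s + 1) 0 - z * shiftCoeff z s 0 else 0, ?_⟩
    rw [e1, e2, ht.zero]
    simp only [shiftCoeff_succ_succ, add_smul, mul_smul, Finset.sum_add_distrib, smul_add,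
      Finset.smul_sum]
    split_ifs
    · rw [Algebra.algebraMap_eq_smul_one, sub_smul, mul_smul]; abel
    · simp
  have hb : ∀ (r s : ℕ) (f g : ℕ → A),
      (∑ p ∈ Finset.range (r + 1), shiftCoeff z r p • f p)
        * (∑ q ∈ Finset.range (s + 1), shiftCoeff z s q • g q)
      = ∑ p ∈ Finset.range (r + 1), ∑ q ∈ Finset.range (s + 1),
          (shiftCoeff z r p * shiftCoeff z s q) • (f p * g q) := by
    intro r s f g
    rw [Finset.sum_mul_sum]
    refine Finset.sum_congr rfl fun p _ => Finset.sum_congr rfl fun q _ => ?_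
    rw [smul_mul_smul_comm]
  have hb' : ∀ (r s : ℕ) (f g : ℕ → A),
      (∑ q ∈ Finset.range (s + 1), shiftCoeff z s q • g q)
        * (∑ p ∈ Finset.range (r + 1), shiftCoeff z r p • f p)
      = ∑ p ∈ Finset.range (r + 1), ∑ q ∈ Finset.range (s + 1),
          (shiftCoeff z r p * shiftCoeff z s q) • (g q * f p) := by
    intro r s f g
    rw [Finset.sum_mul_sum, Finset.sum_comm]
    refine Finset.sum_congr rfl fun p _ => Finset.sum_congr rfl fun q _ => ?_
    rw [smul_mul_smul_comm, mul_comm]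
  refine ⟨h0, fun r s i j k l => ?_⟩
  obtain ⟨c, hc⟩ := hs r i j
  obtain ⟨d, hd⟩ := hs s k l
  rw [hc, hd]
  have e : ∀ (a b a' b' : A),
      ((z • a + a' + algebraMap ℂ A c) * b - b * (z • a + a' + algebraMap ℂ A c))
        - (a * (z • b + b' + algebraMap ℂ A d) - (z • b + b' + algebraMap ℂ A d) * a)
      = (a' * b - b * a') - (a * b' - b' * a) := by
    intro a b a' b'
    have h1 := Algebra.commutes c b
    have h2 := Algebra.commutes d a
    simp only [add_mul, mul_add, h1, h2, smul_mul_assoc, mul_smul_comm]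
    abel
  rw [e]
  simp only [shiftT]
  rw [hb, hb', hb, hb', hb, hb']
  simp only [← Finset.sum_sub_distrib, ← smul_sub]
  refine Finset.sum_congr rfl fun p _ => Finset.sum_congr rfl fun q _ => ?_
  rw [ht.rel]

/-- The endomorphism `τ_z` of the Yangian, `T_ij(u) ↦ T_ij(u - z)` (an automorphism with inverse
`τ_{-z}`). -/
noncomputable def tau {n : ℕ} (z : ℂ) : Yangian n →ₐ[ℂ] Yangian n :=
  Yangian.lift (shiftT z (T n)) ((T_isRTT n).shift z)

end Yangian

/-! ### `gl_m` and the evaluation homomorphism -/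

/-- The Lie algebra `gl_m` over the complex numbers, with the commutator bracket. -/
abbrev gl (m : ℕ) : Type := Matrix (Fin m) (Fin m) ℂ

/-- The matrix unit `E_ab`. -/
abbrev E {m : ℕ} (a b : Fin m) : gl m := Matrix.single a b 1

theorem E_lie {m : ℕ} (a b c d : Fin m) :
    ⁅E a b, E c d⁆ = (if b = c then E a d else 0) - (if d = a then E c b else 0) := by
  rw [Ring.lie_def]
  congr 1
  · split_ifs with h
    · subst h; simp
    · simp [h]
  · split_ifs with h
    · subst h; simp
    · simp [h]

/-- The universal enveloping algebra `U(gl_m)`. -/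
abbrev Ugl (m : ℕ) : Type := UniversalEnvelopingAlgebra ℂ (gl m)

/-- The image of `E_ab` in `U(gl_m)`. -/
noncomputable abbrev UE {m : ℕ} (a b : Fin m) : Ugl m := UniversalEnvelopingAlgebra.ι ℂ (E a b)

/-- The images of the `T_ij^{(s)}` under `π_n`. -/
noncomputable def evalT (n : ℕ) : ℕ → Fin n → Fin n → Ugl n
  | 0, i, j => if i = j then 1 else 0
  | 1, i, j => UE i j
  | _ + 2, _, _ => 0

theorem UE_comm {m : ℕ} (a b c d : Fin m) :
    UE a b * UE c d - UE c d * UE a b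
      = (if b = c then UE a d else 0) - (if d = a then UE c b else 0) := by
  have h := LieHom.map_lie (UniversalEnvelopingAlgebra.ι ℂ (L := gl m)) (E a b) (E c d)
  rw [E_lie, Ring.lie_def, map_sub] at h
  rw [← h]
  congr 1 <;> split_ifs <;> simp

theorem evalT_isRTT (n : ℕ) : IsRTT (evalT n) where
  zero i j := rfl
  rel r s i j k l := by
    match r, s with
    | 0, 0 => simp only [evalT]; split_ifs <;> simp_all
    | 0, 1 =>
      simp only [evalT, UE_comm]
      by_cases h1 : j = k <;> by_cases h2 : i = l <;> simp [h1, h2, eq_comm]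
    | 1, 0 =>
      simp only [evalT, zero_mul, mul_zero, sub_zero, zero_sub, UE_comm]
      by_cases h1 : j = k <;> by_cases h2 : i = l <;> simp [h1, h2, eq_comm]
    | 1, 1 => simp [evalT]
    | 0, s + 2 => simp [evalT]
    | 1, s + 2 => simp [evalT]
    | r + 2, 0 => simp [evalT]
    | r + 2, 1 => simp [evalT]
    | r + 2, s + 2 => simp [evalT]

/-- The evaluation homomorphism `π_n : Y(gl_n) → U(gl_n)`, `T_ij^{(1)} ↦ E_ij` and
`T_ij^{(s)} ↦ 0` for `s ≥ 2`. -/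
noncomputable def evalHom (n : ℕ) : Yangian n →ₐ[ℂ] Ugl n :=
  Yangian.lift (evalT n) (evalT_isRTT n)

/-! ### Grassmann algebras -/

section Grassmann

/-- The Grassmann algebra on anticommuting variables `x_p`, `p ∈ ι`, that is, the exterior algebra
of `ℂ^ι`. For `ι = Fin m × Fin n` this is the exterior algebra of `ℂ^m ⊗ ℂ^n`. -/
abbrev Gr (ι : Type) : Type := ExteriorAlgebra ℂ (ι → ℂ)

/-- Left multiplication by the variable `x_p`. -/
noncomputable def mulX {ι : Type} [DecidableEq ι] (p : ι) : Module.End ℂ (Gr ι) :=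
  LinearMap.mulLeft ℂ (ExteriorAlgebra.ι ℂ (Pi.single p (1 : ℂ)))

/-- The left derivation (inner multiplication) `∂_p` corresponding to the variable `x_p`. -/
noncomputable def del {ι : Type} (p : ι) : Module.End ℂ (Gr ι) :=
  CliffordAlgebra.contractLeft (Q := (0 : QuadraticForm ℂ (ι → ℂ))) (LinearMap.proj p)

theorem mulX_mulX {ι : Type} [DecidableEq ι] (p q : ι) :
    mulX p * mulX q = -(mulX q * mulX p) := by
  refine LinearMap.ext fun v => ?_
  simp only [mulX, Module.End.mul_apply, LinearMap.neg_apply, LinearMap.mulLeft_apply, ← mul_assoc,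
    ← neg_mul]
  rw [eq_neg_of_add_eq_zero_left (ExteriorAlgebra.ι_add_mul_swap (R := ℂ) _ _)]
  simp only [neg_mul]

theorem del_del {ι : Type} (p q : ι) : del p * del q = -(del q * del p) := by
  refine LinearMap.ext fun v => ?_
  exact CliffordAlgebra.contractLeft_comm (Q := (0 : QuadraticForm ℂ (ι → ℂ))) _ _ _

theorem del_mulX {ι : Type} [DecidableEq ι] (p q : ι) :
    del p * mulX q = (if p = q then 1 else 0) - mulX q * del p := by
  refine LinearMap.ext fun v => ?_
  have h := CliffordAlgebra.contractLeft_ι_mul (Q := (0 : QuadraticForm ℂ (ι → ℂ)))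
    (LinearMap.proj p) (Pi.single q (1 : ℂ)) v
  refine h.trans ?_
  rw [LinearMap.sub_apply]
  congr 1
  simp only [LinearMap.proj_apply, Pi.single_apply]
  split_ifs <;> simp

theorem mulX_del_comm {ι : Type} [DecidableEq ι] (p q r s : ι) :
    (mulX p * del q) * (mulX r * del s) - (mulX r * del s) * (mulX p * del q)
      = (if q = r then mulX p * del s else 0) - (if s = p then mulX r * del q else 0) := by
  have h1 : (mulX p * del q) * (mulX r * del s)
      = (if q = r then mulX p * del s else 0) - mulX p * mulX r * (del q * del s) := by
    rw [mul_assoc, ← mul_assoc (del q), del_mulX]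
    split_ifs <;> simp only [sub_mul, mul_sub, one_mul, zero_mul, mul_zero, mul_assoc]
  have h2 : (mulX r * del s) * (mulX p * del q)
      = (if s = p then mulX r * del q else 0) - mulX p * mulX r * (del q * del s) := by
    rw [mul_assoc, ← mul_assoc (del s), del_mulX, mulX_mulX p r, del_del q s]
    split_ifs <;> simp only [sub_mul, mul_sub, one_mul, zero_mul, mul_zero, mul_assoc, neg_mul_neg]
  rw [h1, h2]; abel

/-- The linear map `E_pq ↦ x_p ∂_q`. -/
noncomputable def fockLin (ι : Type) [Fintype ι] [DecidableEq ι] :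
    Matrix ι ι ℂ →ₗ[ℂ] Module.End ℂ (Gr ι) where
  toFun X := ∑ p, ∑ q, X p q • (mulX p * del q)
  map_add' X Y := by simp [add_smul, Finset.sum_add_distrib]
  map_smul' c X := by simp [mul_smul, Finset.smul_sum]

theorem fockLin_single {ι : Type} [Fintype ι] [DecidableEq ι] (p q : ι) (c : ℂ) :
    fockLin ι (Matrix.single p q c) = c • (mulX p * del q) := by
  simp only [fockLin, LinearMap.coe_mk, AddHom.coe_mk, Matrix.single_apply]
  rw [Finset.sum_eq_single p, Finset.sum_eq_single q]
  · simp
  · intro s _ hs; simp [hs.symm]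
  · simp
  · intro r _ hr; simp [hr.symm]
  · simp

theorem fockLin_lie {ι : Type} [Fintype ι] [DecidableEq ι] (X Y : Matrix ι ι ℂ) :
    fockLin ι (X * Y - Y * X) = fockLin ι X * fockLin ι Y - fockLin ι Y * fockLin ι X := by
  induction X using Matrix.induction_on' with
  | h_zero => simp
  | h_add X X' h h' =>
    rw [show (X + X') * Y - Y * (X + X') = (X * Y - Y * X) + (X' * Y - Y * X') by noncomm_ring,
      map_add, h, h', map_add]
    noncomm_ring
  | h_std_basis p q c =>
    induction Y using Matrix.induction_on' with
    | h_zero => simp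
    | h_add Y Y' h h' =>
      rw [show ∀ Z : Matrix ι ι ℂ, Z * (Y + Y') - (Y + Y') * Z
        = (Z * Y - Y * Z) + (Z * Y' - Y' * Z) from fun Z => by noncomm_ring,
        map_add, h, h', map_add]
      noncomm_ring
    | h_std_basis r s d =>
      simp only [fockLin_single, smul_mul_smul_comm]
      rw [mul_comm d c, ← smul_sub, mulX_del_comm, map_sub, smul_sub]
      congr 1
      · by_cases h : q = r
        · subst h; simp [fockLin_single]
        · simp [h]
      · by_cases h : s = p
        · subst h; simp [fockLin_single, mul_comm d c]
        · simp [h]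

/-- The action of `gl(ℂ^ι)` on the Grassmann algebra, `E_pq ↦ x_p ∂_q`. -/
noncomputable def fock (ι : Type) [Fintype ι] [DecidableEq ι] :
    Matrix ι ι ℂ →ₗ⁅ℂ⁆ Module.End ℂ (Gr ι) :=
  { fockLin ι with
    map_lie' := fun {X Y} => fockLin_lie X Y }

end Grassmann

/-! ### The bimodule `E_m(V)` -/

section MatrixPowers

/-- The commutation relations of the entries `M a b = E_ba` of the transposed matrix of generators
of `gl_m`. -/
def IsGL {m : ℕ} {A : Type*} [Ring A] (M : Matrix (Fin m) (Fin m) A) : Prop :=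
  ∀ a b c d, M a b * M c d - M c d * M a b
    = (if d = a then M c b else 0) - (if b = c then M a d else 0)

theorem IsGL.pow_comm {m : ℕ} {A : Type*} [Ring A] {M : Matrix (Fin m) (Fin m) A} (hM : IsGL M)
    (s : ℕ) (a b c d : Fin m) : M a b * (M ^ s) c d - (M ^ s) c d * M a b
      = (if d = a then (M ^ s) c b else 0) - (if b = c then (M ^ s) a d else 0) := by
  induction s generalizing c d with
  | zero =>
    simp only [pow_zero, Matrix.one_apply]
    by_cases h1 : d = a <;> by_cases h2 : b = c <;> by_cases h3 : c = d <;> simp_all [eq_comm]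
  | succ s ih =>
    have e : M a b * (M ^ (s + 1)) c d - (M ^ (s + 1)) c d * M a b
        = ∑ e, ((M a b * (M ^ s) c e - (M ^ s) c e * M a b) * M e d
          + (M ^ s) c e * (M a b * M e d - M e d * M a b)) := by
      simp only [pow_succ, Matrix.mul_apply, Finset.mul_sum, Finset.sum_mul,
        ← Finset.sum_sub_distrib]
      refine Finset.sum_congr rfl fun e _ => ?_
      noncomm_ring
    rw [e]
    simp only [ih, hM a b _ d, Finset.sum_add_distrib, sub_mul, mul_sub, Finset.sum_sub_distrib,
      ite_mul, mul_ite, zero_mul, mul_zero, Finset.sum_ite_eq, Finset.sum_ite_eq', Finset.mem_univ,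
      if_true]
    by_cases h1 : d = a <;> by_cases h2 : b = c <;>
      (simp [h1, h2, pow_succ, Matrix.mul_apply]; try abel)

theorem IsGL.pow_rel {m : ℕ} {A : Type*} [Ring A] {M : Matrix (Fin m) (Fin m) A} (hM : IsGL M)
    (r s : ℕ) (a b c d : Fin m) :
    ((M ^ (r + 1)) a b * (M ^ s) c d - (M ^ s) c d * (M ^ (r + 1)) a b)
      - ((M ^ r) a b * (M ^ (s + 1)) c d - (M ^ (s + 1)) c d * (M ^ r) a b)
      = (M ^ s) c b * (M ^ r) a d - (M ^ r) c b * (M ^ s) a d := by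
  induction r generalizing s a b c d with
  | zero =>
    have := hM.pow_comm s a b c d
    simp only [zero_add, pow_one, pow_zero, this, Matrix.one_apply]
    by_cases h1 : d = a <;> by_cases h2 : b = c <;> by_cases h3 : a = b <;> simp_all [eq_comm]
  | succ r ih =>
    have key : ∀ r s a b c d, (M ^ (r + 1)) a b * (M ^ s) c d - (M ^ s) c d * (M ^ (r + 1)) a b
        = (∑ e, M a e * ((M ^ r) e b * (M ^ s) c d - (M ^ s) c d * (M ^ r) e b))
          + (if d = a then (M ^ (s + r)) c b else 0) - (M ^ s) a d * (M ^ r) c b := by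
      intro r s a b c d
      have e : (M ^ (r + 1)) a b * (M ^ s) c d - (M ^ s) c d * (M ^ (r + 1)) a b
          = (∑ e, M a e * ((M ^ r) e b * (M ^ s) c d - (M ^ s) c d * (M ^ r) e b))
            + ∑ e, (M a e * (M ^ s) c d - (M ^ s) c d * M a e) * (M ^ r) e b := by
        simp only [pow_succ', Matrix.mul_apply, Finset.mul_sum, Finset.sum_mul,
          ← Finset.sum_sub_distrib, ← Finset.sum_add_distrib]
        refine Finset.sum_congr rfl fun e _ => ?_
        noncomm_ring
      rw [e, add_sub_assoc]
      congr 1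
      simp only [hM.pow_comm, sub_mul, Finset.sum_sub_distrib, ite_mul, zero_mul,
        Finset.sum_ite_eq', Finset.mem_univ, if_true]
      congr 1
      by_cases h : d = a <;> simp [h, pow_add, Matrix.mul_apply]
    have key2 : ∀ (p q : ℕ) c b a d, ∑ e, M a e * ((M ^ p) c b * (M ^ q) e d)
        = (M ^ p) c b * (M ^ (q + 1)) a d + (if b = a then (M ^ (p + q)) c d else 0)
          - (M ^ p) a b * (M ^ q) c d := by
      intro p q c b a d
      have e : ∑ e, M a e * ((M ^ p) c b * (M ^ q) e d)
          = (M ^ p) c b * (M ^ (q + 1)) a d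
            + ∑ e, (M a e * (M ^ p) c b - (M ^ p) c b * M a e) * (M ^ q) e d := by
        simp only [pow_succ', Matrix.mul_apply, Finset.mul_sum, ← Finset.sum_add_distrib]
        refine Finset.sum_congr rfl fun e _ => ?_
        noncomm_ring
      rw [e, add_sub_assoc]
      congr 1
      simp only [hM.pow_comm, sub_mul, Finset.sum_sub_distrib, ite_mul, zero_mul,
        Finset.sum_ite_eq', Finset.mem_univ, if_true]
      congr 1
      by_cases h : b = a <;> simp [h, pow_add, Matrix.mul_apply]
    have h1 : ((M ^ (r + 1 + 1)) a b * (M ^ s) c d - (M ^ s) c d * (M ^ (r + 1 + 1)) a b)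
        - ((M ^ (r + 1)) a b * (M ^ (s + 1)) c d - (M ^ (s + 1)) c d * (M ^ (r + 1)) a b)
        = (∑ e, M a e * ((M ^ s) c b * (M ^ r) e d - (M ^ r) c b * (M ^ s) e d))
          - (M ^ s) a d * (M ^ (r + 1)) c b + (M ^ (s + 1)) a d * (M ^ r) c b := by
      rw [key (r + 1) s, key r (s + 1), show s + (r + 1) = s + 1 + r by ring]
      simp only [← ih s _ b c d, mul_sub, Finset.sum_sub_distrib]
      abel
    have h2 := ih s c b a d
    rw [h1]
    simp only [mul_sub, Finset.sum_sub_distrib, key2, add_comm r s]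
    rw [← sub_eq_zero] at h2 ⊢
    rw [← h2]
    abel

end MatrixPowers

section Howe

/-- The family with `t 0 i j = δ_ij` and
`t (s+1) i j = ∑_{a,b} (M^s)_{ab} x_{ai} ∂_{bj}`. -/
def howeT {m n : ℕ} {A : Type*} [Ring A] (M : Matrix (Fin m) (Fin m) A)
    (x d : Fin m × Fin n → A) : ℕ → Fin n → Fin n → A
  | 0, i, j => if i = j then 1 else 0
  | s + 1, i, j => ∑ a, ∑ b, (M ^ s) a b * (x (a, i) * d (b, j))

theorem commute_pow_entry {m : ℕ} {A : Type*} [Ring A] {M : Matrix (Fin m) (Fin m) A} {y : A}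
    (h : ∀ a b, Commute (M a b) y) (s : ℕ) (a b : Fin m) : Commute ((M ^ s) a b) y := by
  induction s generalizing b with
  | zero =>
    rw [pow_zero, Matrix.one_apply]
    split_ifs
    · exact Commute.one_left y
    · exact Commute.zero_left y
  | succ s ih =>
    rw [pow_succ, Matrix.mul_apply]
    exact Commute.sum_left _ _ _ fun e _ => (ih e).mul_left (h e b)

theorem howeT_mul {m n : ℕ} {A : Type*} [Ring A] {M : Matrix (Fin m) (Fin m) A}
    {x d : Fin m × Fin n → A} (hx : ∀ a b p, Commute (M a b) (x p))
    (hd : ∀ a b p, Commute (M a b) (d p))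
    (hdx : ∀ p q, d p * x q = (if p = q then 1 else 0) - x q * d p)
    (r s : ℕ) (i j k l : Fin n) :
    howeT M x d (r + 1) i j * howeT M x d (s + 1) k l
      = (if j = k then howeT M x d (r + s + 1) i l else 0)
        - ∑ a, ∑ b, ∑ c, ∑ e, (M ^ r) a b * (M ^ s) c e
            * (x (a, i) * x (c, k) * (d (b, j) * d (e, l))) := by
  have h1 : howeT M x d (r + 1) i j * howeT M x d (s + 1) k l
      = ∑ a, ∑ b, ∑ c, ∑ e, (M ^ r) a b * (M ^ s) c e
          * ((x (a, i) * d (b, j)) * (x (c, k) * d (e, l))) := by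
    simp only [howeT, Finset.sum_mul]
    simp only [Finset.mul_sum]
    refine Finset.sum_congr rfl fun a _ => Finset.sum_congr rfl fun b _ =>
      Finset.sum_congr rfl fun c _ => Finset.sum_congr rfl fun e _ => ?_
    have hc : Commute ((M ^ s) c e) (x (a, i) * d (b, j)) :=
      (commute_pow_entry (fun _ _ => hx _ _ _) s c e).mul_right
        (commute_pow_entry (fun _ _ => hd _ _ _) s c e)
    rw [mul_assoc, ← mul_assoc _ ((M ^ s) c e), ← hc.eq]
    simp only [mul_assoc]
  have h2 : ∀ a b c e, (M ^ r) a b * (M ^ s) c e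
      * ((x (a, i) * d (b, j)) * (x (c, k) * d (e, l)))
      = (if b = c then if j = k then (M ^ r) a b * (M ^ s) c e * (x (a, i) * d (e, l)) else 0
          else 0)
        - (M ^ r) a b * (M ^ s) c e * (x (a, i) * x (c, k) * (d (b, j) * d (e, l))) := by
    intro a b c e
    rw [mul_assoc (x (a, i)), ← mul_assoc (d (b, j)), hdx]
    by_cases hb : b = c <;> by_cases hj : j = k <;>
      simp [hb, hj, sub_mul, mul_sub, mul_assoc]
  rw [h1]
  simp only [h2, Finset.sum_sub_distrib]
  congr 1
  by_cases hj : j = k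
  · simp only [hj, if_true, howeT]
    refine Finset.sum_congr rfl fun a _ => ?_
    have : ∀ b, ∑ c, ∑ e, (if b = c then (M ^ r) a b * (M ^ s) c e * (x (a, i) * d (e, l)) else 0)
        = ∑ e, (M ^ r) a b * (M ^ s) b e * (x (a, i) * d (e, l)) := by
      intro b
      rw [Finset.sum_comm]
      simp
    simp only [this]
    rw [Finset.sum_comm]
    refine Finset.sum_congr rfl fun e _ => ?_
    rw [← Finset.sum_mul, pow_add, Matrix.mul_apply]
  · simp [hj]

theorem howeT_isRTT {m n : ℕ} {A : Type*} [Ring A] {M : Matrix (Fin m) (Fin m) A}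
    {x d : Fin m × Fin n → A} (hM : IsGL M) (hx : ∀ a b p, Commute (M a b) (x p))
    (hd : ∀ a b p, Commute (M a b) (d p))
    (hdx : ∀ p q, d p * x q = (if p = q then 1 else 0) - x q * d p)
    (hxx : ∀ p q, x p * x q = -(x q * x p)) (hdd : ∀ p q, d p * d q = -(d q * d p)) :
    IsRTT (howeT M x d) := by
  -- the quadratic part of a product, in the two possible orders
  set W : (Fin m → Fin m → Fin m → Fin m → A) → Fin n → Fin n → Fin n → Fin n → A :=
    fun f i j k l => ∑ a, ∑ b, ∑ c, ∑ e, f a b c e * (x (a, i) * x (c, k) * (d (b, j) * d (e, l)))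
    with hW
  have mulA : ∀ r s i j k l, howeT M x d (r + 1) i j * howeT M x d (s + 1) k l
      = (if j = k then howeT M x d (r + s + 1) i l else 0)
        - W (fun a b c e => (M ^ r) a b * (M ^ s) c e) i j k l :=
    fun r s i j k l => howeT_mul hx hd hdx r s i j k l
  have swap : ∀ (f : Fin m → Fin m → Fin m → Fin m → A) i j k l,
      W f k l i j = W (fun a b c e => f c e a b) i j k l := by
    intro f i j k l
    have e1 : ∀ a b c e, f a b c e * (x (a, k) * x (c, i) * (d (b, l) * d (e, j)))
        = f a b c e * (x (c, i) * x (a, k) * (d (e, j) * d (b, l))) := by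
      intro a b c e
      rw [hxx (a, k), hdd (b, l), neg_mul_neg]
    simp only [hW, e1]
    calc _ = ∑ a, ∑ c, ∑ b, ∑ e, f a b c e * (x (c, i) * x (a, k) * (d (e, j) * d (b, l))) :=
          Finset.sum_congr rfl fun a _ => Finset.sum_comm
      _ = ∑ c, ∑ a, ∑ b, ∑ e, f a b c e * (x (c, i) * x (a, k) * (d (e, j) * d (b, l))) :=
          Finset.sum_comm
      _ = ∑ c, ∑ a, ∑ e, ∑ b, f a b c e * (x (c, i) * x (a, k) * (d (e, j) * d (b, l))) :=
          Finset.sum_congr rfl fun c _ => Finset.sum_congr rfl fun a _ => Finset.sum_comm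
      _ = ∑ c, ∑ e, ∑ a, ∑ b, f a b c e * (x (c, i) * x (a, k) * (d (e, j) * d (b, l))) :=
          Finset.sum_congr rfl fun c _ => Finset.sum_comm
  have swap2 : ∀ (f : Fin m → Fin m → Fin m → Fin m → A) i j k l,
      W f k j i l = -W (fun a b c e => f c b a e) i j k l := by
    intro f i j k l
    have e1 : ∀ a b c e, f a b c e * (x (a, k) * x (c, i) * (d (b, j) * d (e, l)))
        = -(f a b c e * (x (c, i) * x (a, k) * (d (b, j) * d (e, l)))) := by
      intro a b c e
      rw [hxx (a, k)]
      simp only [neg_mul, mul_neg]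
    simp only [hW, e1, Finset.sum_neg_distrib, neg_inj]
    calc _ = ∑ a, ∑ c, ∑ b, ∑ e, f a b c e * (x (c, i) * x (a, k) * (d (b, j) * d (e, l))) :=
          Finset.sum_congr rfl fun a _ => Finset.sum_comm
      _ = ∑ c, ∑ a, ∑ b, ∑ e, f a b c e * (x (c, i) * x (a, k) * (d (b, j) * d (e, l))) :=
          Finset.sum_comm
      _ = ∑ c, ∑ b, ∑ a, ∑ e, f a b c e * (x (c, i) * x (a, k) * (d (b, j) * d (e, l))) :=
          Finset.sum_congr rfl fun c _ => Finset.sum_comm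
  have Wsub : ∀ f g i j k l, W f i j k l - W g i j k l
      = W (fun a b c e => f a b c e - g a b c e) i j k l := by
    intro f g i j k l
    simp only [hW, sub_mul, Finset.sum_sub_distrib]
  have comm : ∀ r s i j k l, howeT M x d (r + 1) i j * howeT M x d (s + 1) k l
      - howeT M x d (s + 1) k l * howeT M x d (r + 1) i j
      = (if j = k then howeT M x d (r + s + 1) i l else 0)
        - (if l = i then howeT M x d (r + s + 1) k j else 0)
        - W (fun a b c e => (M ^ r) a b * (M ^ s) c e - (M ^ s) c e * (M ^ r) a b) i j k l := by
    intro r s i j k l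
    rw [mulA r s, mulA s r, swap _ i j k l, ← Wsub, add_comm s r]
    abel
  have W0 : ∀ (s : ℕ) i j k l,
      W (fun a b c e => (M ^ 0) a b * (M ^ s) c e - (M ^ s) c e * (M ^ 0) a b) i j k l = 0 := by
    intro s i j k l
    have : ∀ a b c e, (M ^ 0) a b * (M ^ s) c e - (M ^ s) c e * (M ^ 0) a b = 0 := by
      intro a b c e
      rw [pow_zero, Matrix.one_apply]
      split_ifs <;> simp
    simp only [hW, this, zero_mul, Finset.sum_const_zero]
  have W0' : ∀ (s : ℕ) i j k l,
      W (fun a b c e => (M ^ s) a b * (M ^ 0) c e - (M ^ 0) c e * (M ^ s) a b) i j k l = 0 := by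
    intro s i j k l
    have : ∀ a b c e, (M ^ s) a b * (M ^ 0) c e - (M ^ 0) c e * (M ^ s) a b = 0 := by
      intro a b c e
      rw [pow_zero, Matrix.one_apply]
      split_ifs <;> simp
    simp only [hW, this, zero_mul, Finset.sum_const_zero]
  have z : ∀ i j, howeT M x d 0 i j = if i = j then 1 else 0 := fun i j => rfl
  refine ⟨z, fun r s i j k l => ?_⟩
  have zl : ∀ i j (y : A), howeT M x d 0 i j * y = if i = j then y else 0 := by
    intro i j y; rw [z, ite_mul, one_mul, zero_mul]
  have zr : ∀ i j (y : A), y * howeT M x d 0 i j = if i = j then y else 0 := by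
    intro i j y; rw [z, mul_ite, mul_one, mul_zero]
  match r, s with
  | 0, 0 =>
    rw [zl, zr, zl, zr, sub_self, sub_self, sub_self]
    simp only [z]
    by_cases h1 : k = j <;> by_cases h2 : i = l <;> simp [h1, h2]
  | 0, s + 1 =>
    rw [comm 0 s, W0, zl, zr, zl, zr, sub_self, sub_zero, sub_zero, zero_add]
    congr 1 <;> exact if_congr eq_comm rfl rfl
  | r + 1, 0 =>
    rw [comm r 0, W0', zl, zr, zl, zr, sub_self, sub_zero, zero_sub, neg_sub, add_zero]
    congr 1 <;> exact if_congr eq_comm rfl rfl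
  | r + 1, s + 1 =>
    rw [comm (r + 1) s, comm r (s + 1), mulA r s, mulA s r, show r + 1 + s = r + (s + 1) by ring,
      add_comm s r,
      swap2 (fun a b c e => (M ^ r) a b * (M ^ s) c e),
      swap2 (fun a b c e => (M ^ s) a b * (M ^ r) c e)]
    have : ∀ a b c e, ((M ^ (r + 1)) a b * (M ^ s) c e - (M ^ s) c e * (M ^ (r + 1)) a b)
        - ((M ^ r) a b * (M ^ (s + 1)) c e - (M ^ (s + 1)) c e * (M ^ r) a b)
        = (M ^ s) c b * (M ^ r) a e - (M ^ r) c b * (M ^ s) a e := hM.pow_rel r s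
    have e2 := Wsub (fun a b c e => (M ^ (r + 1)) a b * (M ^ s) c e - (M ^ s) c e * (M ^ (r + 1)) a b)
      (fun a b c e => (M ^ r) a b * (M ^ (s + 1)) c e - (M ^ (s + 1)) c e * (M ^ r) a b) i j k l
    simp only [this] at e2
    rw [← Wsub (fun a b c e => (M ^ s) c b * (M ^ r) a e)] at e2
    rw [sub_eq_iff_eq_add] at e2
    rw [e2]
    abel

theorem howeT_comm {m n : ℕ} {A : Type*} [Ring A] {M : Matrix (Fin m) (Fin m) A}
    {x d : Fin m × Fin n → A} (hM : IsGL M) (hx : ∀ a b p, Commute (M a b) (x p))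
    (hd : ∀ a b p, Commute (M a b) (d p))
    (hdx : ∀ p q, d p * x q = (if p = q then 1 else 0) - x q * d p)
    (hxx : ∀ p q, x p * x q = -(x q * x p)) (hdd : ∀ p q, d p * d q = -(d q * d p))
    (g h : Fin m) (s : ℕ) (i j : Fin n) :
    Commute (M h g + ∑ k, x (g, k) * d (h, k)) (howeT M x d s i j) := by
  cases s with
  | zero =>
    simp only [howeT]
    split_ifs
    · exact Commute.one_right _
    · exact Commute.zero_right _
  | succ s =>
    have hxc : ∀ a b p, Commute ((M ^ s) a b) (x p) := fun a b p =>
      commute_pow_entry (fun _ _ => hx _ _ _) s a b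
    have hdc : ∀ a b p, Commute ((M ^ s) a b) (d p) := fun a b p =>
      commute_pow_entry (fun _ _ => hd _ _ _) s a b
    have hq : ∀ p q r t, (x p * d q) * (x r * d t) - (x r * d t) * (x p * d q)
        = (if q = r then x p * d t else 0) - (if t = p then x r * d q else 0) := by
      intro p q r t
      have h1 : (x p * d q) * (x r * d t)
          = (if q = r then x p * d t else 0) - x p * x r * (d q * d t) := by
        rw [mul_assoc, ← mul_assoc (d q), hdx]
        split_ifs <;> simp only [sub_mul, mul_sub, one_mul, zero_mul, mul_zero, mul_assoc]
      have h2 : (x r * d t) * (x p * d q)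
          = (if t = p then x r * d q else 0) - x p * x r * (d q * d t) := by
        rw [mul_assoc, ← mul_assoc (d t), hdx, hxx p r, hdd q t]
        split_ifs <;>
          simp only [sub_mul, mul_sub, one_mul, zero_mul, mul_zero, mul_assoc, neg_mul_neg]
      rw [h1, h2]; abel
    have e : ∀ a b, (M h g * ((M ^ s) a b * (x (a, i) * d (b, j)))
          + ∑ k, x (g, k) * d (h, k) * ((M ^ s) a b * (x (a, i) * d (b, j))))
        - ((M ^ s) a b * (x (a, i) * d (b, j)) * M h g
          + ∑ k, (M ^ s) a b * (x (a, i) * d (b, j)) * (x (g, k) * d (h, k)))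
        = ((if b = h then (M ^ s) a g * (x (a, i) * d (b, j)) else 0)
            - (if g = a then (M ^ s) h b * (x (a, i) * d (b, j)) else 0))
          + ((if h = a then (M ^ s) a b * (x (g, i) * d (b, j)) else 0)
            - (if b = g then (M ^ s) a b * (x (a, i) * d (h, j)) else 0)) := by
      intro a b
      have c1 : (x (a, i) * d (b, j)) * M h g = M h g * (x (a, i) * d (b, j)) :=
        ((hx h g _).mul_right (hd h g _)).eq.symm
      have c2 : ∀ k, x (g, k) * d (h, k) * (M ^ s) a b = (M ^ s) a b * (x (g, k) * d (h, k)) :=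
        fun k => ((hxc a b _).mul_right (hdc a b _)).eq.symm
      have p1 : M h g * ((M ^ s) a b * (x (a, i) * d (b, j)))
          - (M ^ s) a b * (x (a, i) * d (b, j)) * M h g
          = (if b = h then (M ^ s) a g * (x (a, i) * d (b, j)) else 0)
            - (if g = a then (M ^ s) h b * (x (a, i) * d (b, j)) else 0) := by
        rw [mul_assoc ((M ^ s) a b), c1, ← mul_assoc, ← mul_assoc ((M ^ s) a b), ← sub_mul, hM.pow_comm, sub_mul, ite_mul,
          ite_mul, zero_mul]
      have p2 : (∑ k, x (g, k) * d (h, k) * ((M ^ s) a b * (x (a, i) * d (b, j))))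
          - ∑ k, (M ^ s) a b * (x (a, i) * d (b, j)) * (x (g, k) * d (h, k))
          = (if h = a then (M ^ s) a b * (x (g, i) * d (b, j)) else 0)
            - (if b = g then (M ^ s) a b * (x (a, i) * d (h, j)) else 0) := by
        have : ∀ k, x (g, k) * d (h, k) * ((M ^ s) a b * (x (a, i) * d (b, j)))
            - (M ^ s) a b * (x (a, i) * d (b, j)) * (x (g, k) * d (h, k))
            = (M ^ s) a b * ((if (h, k) = (a, i) then x (g, k) * d (b, j) else 0)
              - (if (b, j) = (g, k) then x (a, i) * d (h, k) else 0)) := by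
          intro k
          rw [← mul_assoc (x (g, k) * d (h, k)), c2, mul_assoc, mul_assoc ((M ^ s) a b), ← mul_sub,
            hq]
        rw [← Finset.sum_sub_distrib, Finset.sum_congr rfl fun k _ => this k]
        simp only [Prod.mk.injEq, ite_and, mul_sub, Finset.sum_sub_distrib, mul_ite, mul_zero]
        by_cases h1 : h = a <;> by_cases h2 : b = g <;> simp [h1, h2]
      rw [← p1, ← p2]; abel
    have e' : ∀ a b, (M h g + ∑ k, x (g, k) * d (h, k)) * ((M ^ s) a b * (x (a, i) * d (b, j)))
        - (M ^ s) a b * (x (a, i) * d (b, j)) * (M h g + ∑ k, x (g, k) * d (h, k))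
        = ((if b = h then (M ^ s) a g * (x (a, i) * d (b, j)) else 0)
            - (if g = a then (M ^ s) h b * (x (a, i) * d (b, j)) else 0))
          + ((if h = a then (M ^ s) a b * (x (g, i) * d (b, j)) else 0)
            - (if b = g then (M ^ s) a b * (x (a, i) * d (h, j)) else 0)) := by
      intro a b
      rw [← e a b, add_mul, mul_add, Finset.sum_mul, Finset.mul_sum]
    rw [Commute, SemiconjBy, ← sub_eq_zero]
    generalize M h g + ∑ k, x (g, k) * d (h, k) = N at e' ⊢
    simp only [howeT, Finset.mul_sum, Finset.sum_mul]
    simp only [← Finset.sum_sub_distrib, e']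
    simp only [Finset.sum_add_distrib, Finset.sum_sub_distrib, Finset.sum_ite_eq',
      Finset.mem_univ, if_true]
    rw [Finset.sum_comm (f := fun a b => if g = a then _ else _),
      Finset.sum_comm (f := fun a b => if h = a then _ else _)]
    simp only [Finset.sum_ite_eq, Finset.mem_univ, if_true]
    abel

end Howe
section Bimodule

/-- The vector space `V ⊗ Λ(ℂ^m ⊗ ℂ^n)` of the bimodule `E_m(V)`. -/
abbrev EMod (m n : ℕ) (V : Type*) [AddCommGroup V] [Module ℂ V] : Type _ :=
  V ⊗[ℂ] Gr (Fin m × Fin n)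

/-- The matrix with `ab`-entry the operator `E_ba ⊗ 1` on `E_m(V)`. -/
noncomputable def Emat (m n : ℕ) (V : Type*) [AddCommGroup V] [Module ℂ V]
    [LieRingModule (gl m) V] [LieModule ℂ (gl m) V] :
    Matrix (Fin m) (Fin m) (Module.End ℂ (EMod m n V)) :=
  Matrix.of fun a b => LinearMap.rTensor _ (LieModule.toEnd ℂ (gl m) V (E b a))

/-- The operator `1 ⊗ x_p` on `E_m(V)`. -/
noncomputable def xOp {m n : ℕ} (V : Type*) [AddCommGroup V] [Module ℂ V] (p : Fin m × Fin n) :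
    Module.End ℂ (EMod m n V) := LinearMap.lTensor V (mulX p)

/-- The operator `1 ⊗ ∂_p` on `E_m(V)`. -/
noncomputable def dOp {m n : ℕ} (V : Type*) [AddCommGroup V] [Module ℂ V] (p : Fin m × Fin n) :
    Module.End ℂ (EMod m n V) := LinearMap.lTensor V (del p)

theorem Emat_isGL (m n : ℕ) (V : Type*) [AddCommGroup V] [Module ℂ V]
    [LieRingModule (gl m) V] [LieModule ℂ (gl m) V] : IsGL (Emat m n V) := by
  intro a b c d
  have h := LieHom.map_lie (LieModule.toEnd ℂ (gl m) V) (E b a) (E d c)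
  rw [E_lie, Ring.lie_def, map_sub] at h
  simp only [Emat, Matrix.of_apply, ← LinearMap.rTensor_mul, ← LinearMap.rTensor_sub]
  rw [← h, LinearMap.rTensor_sub]
  congr 1
  · rw [if_congr (eq_comm (a := d)) rfl rfl]
    split_ifs <;> simp
  · rw [if_congr (eq_comm (a := b)) rfl rfl]
    split_ifs <;> simp

theorem commute_rTensor_lTensor {V W : Type*} [AddCommGroup V] [Module ℂ V] [AddCommGroup W]
    [Module ℂ W] (f : Module.End ℂ V) (g : Module.End ℂ W) :
    Commute (LinearMap.rTensor W f) (LinearMap.lTensor V g) := by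
  rw [Commute, SemiconjBy, Module.End.mul_eq_comp, Module.End.mul_eq_comp,
    LinearMap.rTensor_comp_lTensor, LinearMap.lTensor_comp_rTensor]

theorem xOp_xOp {m n : ℕ} (V : Type*) [AddCommGroup V] [Module ℂ V] (p q : Fin m × Fin n) :
    xOp V p * xOp V q = -(xOp V q * xOp V p) := by
  simp only [xOp, ← LinearMap.lTensor_mul]
  rw [mulX_mulX, LinearMap.lTensor_neg]

theorem dOp_dOp {m n : ℕ} (V : Type*) [AddCommGroup V] [Module ℂ V] (p q : Fin m × Fin n) :
    dOp V p * dOp V q = -(dOp V q * dOp V p) := by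
  simp only [dOp, ← LinearMap.lTensor_mul]
  rw [del_del, LinearMap.lTensor_neg]

theorem dOp_xOp {m n : ℕ} (V : Type*) [AddCommGroup V] [Module ℂ V] (p q : Fin m × Fin n) :
    dOp V p * xOp V q = (if p = q then 1 else 0) - xOp V q * dOp V p := by
  simp only [dOp, xOp, ← LinearMap.lTensor_mul]
  rw [del_mulX, LinearMap.lTensor_sub]
  congr 1
  split_ifs
  · exact LinearMap.lTensor_id _ _
  · exact LinearMap.lTensor_zero _

/-- The action of the Yangian on `E_m(V)`: the generator `T_ij^{(s+1)}` acts as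
`∑_{c_0, …, c_s} E_{c_1 c_0} E_{c_2 c_1} ⋯ E_{c_s c_{s-1}} ⊗ x_{c_0 i} ∂_{c_s j}`, the sum over
`c_1, …, c_{s-1}` being the `c_0 c_s`-entry of the `s`-th power of the matrix `Emat`. -/
noncomputable def yAct (m n : ℕ) (V : Type*) [AddCommGroup V] [Module ℂ V]
    [LieRingModule (gl m) V] [LieModule ℂ (gl m) V] :
    Yangian n →ₐ[ℂ] Module.End ℂ (EMod m n V) :=
  Yangian.lift (howeT (Emat m n V) (xOp V) (dOp V)) <|
    howeT_isRTT (Emat_isGL m n V) (fun _ _ _ => commute_rTensor_lTensor _ _)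
      (fun _ _ _ => commute_rTensor_lTensor _ _) (dOp_xOp V) (xOp_xOp V) (dOp_dOp V)

/-- The Yangian action on `E_m^z(V)`, the pull-back of `E_m(V)` through `τ_{-z}`. -/
noncomputable def yActShift (m n : ℕ) (V : Type*) [AddCommGroup V] [Module ℂ V]
    [LieRingModule (gl m) V] [LieModule ℂ (gl m) V] (z : ℂ) :
    Yangian n →ₐ[ℂ] Module.End ℂ (EMod m n V) :=
  (yAct m n V).comp (tau (-z))

/-- The diagonal action of `gl_m` on `E_m(V)`, where `gl_m` acts on `Λ(ℂ^m ⊗ ℂ^n)` through its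
natural action on `ℂ^m`: `E_ab` acts as `E_ab ⊗ 1 + ∑_k 1 ⊗ x_ak ∂_bk`. -/
noncomputable def glAct (m n : ℕ) (V : Type*) [AddCommGroup V] [Module ℂ V]
    [LieRingModule (gl m) V] [LieModule ℂ (gl m) V] :
    gl m →ₗ⁅ℂ⁆ Module.End ℂ (EMod m n V) where
  toFun X := LinearMap.rTensor _ (LieModule.toEnd ℂ (gl m) V X)
    + LinearMap.lTensor V (fock (Fin m × Fin n) (Matrix.kronecker X (1 : gl n)))
  map_add' X Y := by
    simp only [map_add, Matrix.kronecker, Matrix.kroneckerMap_add_left _ add_mul,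
      LinearMap.rTensor_add, LinearMap.lTensor_add]
    abel
  map_smul' c X := by
    simp only [map_smul, Matrix.kronecker, RingHom.id_apply, LinearMap.rTensor_smul,
      Matrix.kroneckerMap_smul_left _ c fun a b => smul_mul_assoc c a b,
      LinearMap.lTensor_smul, smul_add]
  map_lie' {X Y} := by
    have h : Matrix.kronecker ⁅X, Y⁆ (1 : gl n)
        = ⁅Matrix.kronecker X (1 : gl n), Matrix.kronecker Y (1 : gl n)⁆ := by
      have h1 : ∀ A B : gl m, Matrix.kronecker (A * B) (1 : gl n)
          = Matrix.kronecker A 1 * Matrix.kronecker B 1 := by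
        intro A B
        have := Matrix.mul_kronecker_mul A B (1 : gl n) (1 : gl n)
        rwa [one_mul] at this
      rw [Ring.lie_def, Ring.lie_def, ← h1, ← h1]
      ext p q
      simp [Matrix.kronecker, sub_mul]
    have c1 := commute_rTensor_lTensor (LieModule.toEnd ℂ (gl m) V X)
      (fock (Fin m × Fin n) (Matrix.kronecker Y (1 : gl n)))
    have c2 := commute_rTensor_lTensor (LieModule.toEnd ℂ (gl m) V Y)
      (fock (Fin m × Fin n) (Matrix.kronecker X (1 : gl n)))
    rw [h, LieHom.map_lie, LieHom.map_lie, Ring.lie_def, Ring.lie_def, Ring.lie_def,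
      LinearMap.rTensor_sub, LinearMap.lTensor_sub, LinearMap.rTensor_mul, LinearMap.rTensor_mul,
      LinearMap.lTensor_mul, LinearMap.lTensor_mul]
    simp only [mul_add, add_mul, c1.eq, c2.eq]
    abel

theorem glAct_E {m n : ℕ} (V : Type*) [AddCommGroup V] [Module ℂ V]
    [LieRingModule (gl m) V] [LieModule ℂ (gl m) V] (a b : Fin m) :
    glAct m n V (E a b) = Emat m n V b a + ∑ k, xOp V (a, k) * dOp V (b, k) := by
  have h : Matrix.kronecker (E a b) (1 : gl n) = ∑ k, Matrix.single (a, k) (b, k) (1 : ℂ) := by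
    ext ⟨c, i⟩ ⟨e, j⟩
    simp only [Matrix.kronecker, Matrix.kroneckerMap_apply, Matrix.sum_apply, Matrix.single_apply,
      Prod.mk.injEq, Matrix.one_apply]
    have h0 : ∀ k, (((a = c ∧ k = i) ∧ b = e ∧ k = j) ↔ (k = i ∧ a = c ∧ b = e ∧ i = j)) := by
      intro k
      constructor
      · rintro ⟨⟨h1, rfl⟩, h2, rfl⟩; exact ⟨rfl, h1, h2, rfl⟩
      · rintro ⟨rfl, h1, h2, rfl⟩; exact ⟨⟨h1, rfl⟩, h2, rfl⟩
    simp only [h0, ite_and, Finset.sum_ite_eq', Finset.mem_univ, if_true]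
    split_ifs <;> simp
  have h' : fock (Fin m × Fin n) (Matrix.kronecker (E a b) (1 : gl n))
      = ∑ k, mulX (a, k) * del (b, k) := by
    rw [h, map_sum]
    refine Finset.sum_congr rfl fun k _ => ?_
    have := fockLin_single (a, k) (b, k) (1 : ℂ)
    rwa [one_smul] at this
  show LinearMap.rTensor _ (LieModule.toEnd ℂ (gl m) V (E a b))
    + LinearMap.lTensor V (fock (Fin m × Fin n) (Matrix.kronecker (E a b) (1 : gl n))) = _
  rw [h']
  congr 1
  rw [← LinearMap.coe_lTensorHom, map_sum]
  refine Finset.sum_congr rfl fun k _ => ?_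
  exact LinearMap.lTensor_mul _ _ _

theorem yAct_T_comm_glAct {m n : ℕ} (V : Type*) [AddCommGroup V] [Module ℂ V]
    [LieRingModule (gl m) V] [LieModule ℂ (gl m) V] (X : gl m) (s : ℕ) (i j : Fin n) :
    Commute (glAct m n V X) (yAct m n V (T n s i j)) := by
  rw [yAct, Yangian.lift_T]
  induction X using Matrix.induction_on' with
  | h_zero => rw [map_zero]; exact Commute.zero_left _
  | h_add X Y hX hY => rw [map_add]; exact hX.add_left hY
  | h_std_basis a b c =>
    rw [show Matrix.single a b c = c • E a b by simp, map_smul, glAct_E]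
    exact (howeT_comm (Emat_isGL m n V) (fun _ _ _ => commute_rTensor_lTensor _ _)
      (fun _ _ _ => commute_rTensor_lTensor _ _) (dOp_xOp V) (xOp_xOp V) (dOp_dOp V)
      a b s i j).smul_left c

/-- The actions of the Yangian and of `gl_m` on `E_m(V)` commute. -/
theorem yAct_comm_glAct {m n : ℕ} (V : Type*) [AddCommGroup V] [Module ℂ V]
    [LieRingModule (gl m) V] [LieModule ℂ (gl m) V] (X : gl m) (y : Yangian n) :
    Commute (glAct m n V X) (yAct m n V y) := by
  induction y using Yangian.induction with
  | scalar c =>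
    rw [AlgHom.commutes]
    exact (Algebra.commutes c _).symm
  | gen s i j => exact yAct_T_comm_glAct V X (s + 1) i j
  | add x y hx hy => rw [map_add]; exact hx.add_right hy
  | mul x y hx hy => rw [map_mul]; exact hx.mul_right hy

end Bimodule

/-! ### Coinvariants -/

section Coinvariants

/-- The subspace `𝔫 · E_m(V)`, where `𝔫` is spanned by the `E_ba` with `a < b`. -/
noncomputable def nSub (m n : ℕ) (V : Type*) [AddCommGroup V] [Module ℂ V]
    [LieRingModule (gl m) V] [LieModule ℂ (gl m) V] : Submodule ℂ (EMod m n V) :=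
  Submodule.span ℂ {w | ∃ a b : Fin m, a < b ∧ ∃ v, w = glAct m n V (E b a) v}

/-- The space `E_m(V)_𝔫 = E_m(V) / 𝔫 · E_m(V)` of `𝔫`-coinvariants. -/
abbrev Coinv (m n : ℕ) (V : Type*) [AddCommGroup V] [Module ℂ V]
    [LieRingModule (gl m) V] [LieModule ℂ (gl m) V] : Type _ :=
  EMod m n V ⧸ nSub m n V

theorem nSub_le_yAct {m n : ℕ} (V : Type*) [AddCommGroup V] [Module ℂ V]
    [LieRingModule (gl m) V] [LieModule ℂ (gl m) V] (y : Yangian n) :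
    nSub m n V ≤ (nSub m n V).comap (yAct m n V y) := by
  rw [nSub, Submodule.span_le]
  rintro _ ⟨a, b, hab, v, rfl⟩
  refine Submodule.subset_span ⟨a, b, hab, yAct m n V y v, ?_⟩
  exact (LinearMap.congr_fun (yAct_comm_glAct V (E b a) y).eq v).symm

theorem diagonal_E_lie {m : ℕ} (d : Fin m → ℂ) (a b : Fin m) :
    ⁅Matrix.diagonal d, E b a⁆ = (d b - d a) • E b a := by
  rw [Ring.lie_def]
  ext p q
  simp only [Matrix.sub_apply, Matrix.diagonal_mul, Matrix.mul_diagonal, Matrix.smul_apply,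
    Matrix.single_apply, smul_eq_mul]
  split_ifs with hpq
  · rw [← hpq.1, ← hpq.2]; ring
  · ring

theorem lieHom_apply_apply {L M : Type*} [LieRing L] [LieAlgebra ℂ L] [AddCommGroup M] [Module ℂ M]
    (f : L →ₗ⁅ℂ⁆ Module.End ℂ M) {X Y : L} {c : ℂ} (h : ⁅X, Y⁆ = c • Y) (v : M) :
    f X (f Y v) = c • f Y v + f Y (f X v) := by
  have h1 := LieHom.map_lie f X Y
  rw [h, map_smul, Ring.lie_def, eq_sub_iff_add_eq] at h1
  exact (LinearMap.congr_fun h1 v).symm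

theorem nSub_le_diag {m n : ℕ} (V : Type*) [AddCommGroup V] [Module ℂ V]
    [LieRingModule (gl m) V] [LieModule ℂ (gl m) V] (d : Fin m → ℂ) :
    nSub m n V ≤ (nSub m n V).comap (glAct m n V (Matrix.diagonal d)) := by
  have hE : ∀ a b : Fin m, a < b → ∀ v, glAct m n V (E b a) v ∈ nSub m n V :=
    fun a b hab v => Submodule.subset_span ⟨a, b, hab, v, rfl⟩
  refine Submodule.span_le.2 ?_
  rintro _ ⟨a, b, hab, v, rfl⟩
  rw [SetLike.mem_coe, Submodule.mem_comap, lieHom_apply_apply _ (diagonal_E_lie d a b)]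
  exact add_mem (Submodule.smul_mem _ _ (hE a b hab v)) (hE a b hab _)

/-- The action of the Yangian on `E_m(V)_𝔫`. -/
noncomputable def coinvY (m n : ℕ) (V : Type*) [AddCommGroup V] [Module ℂ V]
    [LieRingModule (gl m) V] [LieModule ℂ (gl m) V] :
    Yangian n →ₐ[ℂ] Module.End ℂ (Coinv m n V) where
  toFun y := (nSub m n V).mapQ (nSub m n V) (yAct m n V y) (nSub_le_yAct V y)
  map_one' := by
    refine Submodule.linearMap_qext _ (LinearMap.ext fun v => ?_)
    simp
  map_mul' x y := by
    refine Submodule.linearMap_qext _ (LinearMap.ext fun v => ?_)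
    simp
  map_zero' := by
    refine Submodule.linearMap_qext _ (LinearMap.ext fun v => ?_)
    simp
  map_add' x y := by
    refine Submodule.linearMap_qext _ (LinearMap.ext fun v => ?_)
    simp
  commutes' c := by
    refine Submodule.linearMap_qext _ (LinearMap.ext fun v => ?_)
    simp [Module.algebraMap_end_apply]

/-- The action of the Cartan subalgebra `𝔥` of diagonal matrices, identified with `ℂ^m` through the
basis `E_11, …, E_mm`, on `E_m(V)_𝔫`. -/
noncomputable def coinvH (m n : ℕ) (V : Type*) [AddCommGroup V] [Module ℂ V]
    [LieRingModule (gl m) V] [LieModule ℂ (gl m) V] :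
    (Fin m → ℂ) →ₗ[ℂ] Module.End ℂ (Coinv m n V) where
  toFun d := (nSub m n V).mapQ (nSub m n V) (glAct m n V (Matrix.diagonal d)) (nSub_le_diag V d)
  map_add' d e := by
    refine Submodule.linearMap_qext _ (LinearMap.ext fun v => ?_)
    have : Matrix.diagonal (d + e) = Matrix.diagonal d + Matrix.diagonal e :=
      (Matrix.diagonal_add d e).symm
    rw [LinearMap.comp_apply, LinearMap.comp_apply, LinearMap.add_apply]
    simp only [Submodule.mkQ_apply, Submodule.mapQ_apply, this, map_add, LinearMap.add_apply,
      Submodule.Quotient.mk_add]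
  map_smul' c d := by
    refine Submodule.linearMap_qext _ (LinearMap.ext fun v => ?_)
    have : Matrix.diagonal (c • d) = c • Matrix.diagonal d := Matrix.diagonal_smul c d
    simp [this]

end Coinvariants
/-! ### Tensor products of modules over the Yangian -/

section Tensor

/-- The two-variable form of the defining relations for a matrix of power series in `x = u⁻¹`: with
`y = v⁻¹`, `(y - x) [T_ij(u), T_kl(v)] = x y (T_kj(u) T_il(v) - T_kj(v) T_il(u))`. Here `x` is the
inner and `y` is the outer variable. -/
def IsRTTSeries {n : ℕ} {A : Type*} [Ring A] (M : Matrix (Fin n) (Fin n) (PowerSeries A)) : Prop :=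
  ∀ i j k l,
    ((PowerSeries.X : PowerSeries (PowerSeries A)) - PowerSeries.C PowerSeries.X)
      * (PowerSeries.C (M i j) * PowerSeries.map PowerSeries.C (M k l)
        - PowerSeries.map PowerSeries.C (M k l) * PowerSeries.C (M i j))
      = PowerSeries.C PowerSeries.X * PowerSeries.X
        * (PowerSeries.C (M k j) * PowerSeries.map PowerSeries.C (M i l)
          - PowerSeries.map PowerSeries.C (M k j) * PowerSeries.C (M i l))

theorem coeff_coeff_mul {A : Type*} [Ring A] (f g : PowerSeries A) (r s : ℕ) :
    PowerSeries.coeff r (PowerSeries.coeff s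
      (PowerSeries.C f * PowerSeries.map PowerSeries.C g))
      = PowerSeries.coeff r f * PowerSeries.coeff s g := by
  rw [PowerSeries.coeff_C_mul, PowerSeries.coeff_map, PowerSeries.coeff_mul_C]

theorem coeff_coeff_mul' {A : Type*} [Ring A] (f g : PowerSeries A) (r s : ℕ) :
    PowerSeries.coeff r (PowerSeries.coeff s
      (PowerSeries.map PowerSeries.C g * PowerSeries.C f))
      = PowerSeries.coeff s g * PowerSeries.coeff r f := by
  rw [PowerSeries.coeff_mul_C, PowerSeries.coeff_map, PowerSeries.coeff_C_mul]

theorem coeff_X_mul_zero {A : Type*} [Ring A] (F : PowerSeries (PowerSeries A)) :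
    PowerSeries.coeff 0 (PowerSeries.X * F) = 0 := PowerSeries.coeff_zero_X_mul F

theorem isRTTSeries_iff {n : ℕ} {A : Type*} [Ring A] (M : Matrix (Fin n) (Fin n) (PowerSeries A))
    (h0 : ∀ i j, PowerSeries.coeff 0 (M i j) = if i = j then 1 else 0) :
    IsRTTSeries M ↔ IsRTT (fun s i j => PowerSeries.coeff s (M i j)) := by
  have hc : ∀ i j (y : A), PowerSeries.coeff 0 (M i j) * y = y * PowerSeries.coeff 0 (M i j) := by
    intro i j y; rw [h0]; split_ifs <;> simp
  have e1 : ∀ r s (F : PowerSeries (PowerSeries A)),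
      PowerSeries.coeff (r + 1) (PowerSeries.coeff (s + 1)
        ((PowerSeries.X - PowerSeries.C PowerSeries.X) * F))
      = PowerSeries.coeff (r + 1) (PowerSeries.coeff s F)
        - PowerSeries.coeff r (PowerSeries.coeff (s + 1) F) := by
    intro r s F
    rw [sub_mul, map_sub, map_sub, PowerSeries.coeff_succ_X_mul, PowerSeries.coeff_C_mul,
      PowerSeries.coeff_succ_X_mul]
  have e2 : ∀ r s (F : PowerSeries (PowerSeries A)),
      PowerSeries.coeff (r + 1) (PowerSeries.coeff (s + 1)
        (PowerSeries.C PowerSeries.X * PowerSeries.X * F))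
      = PowerSeries.coeff r (PowerSeries.coeff s F) := by
    intro r s F
    rw [mul_assoc, PowerSeries.coeff_C_mul, PowerSeries.coeff_succ_X_mul,
      PowerSeries.coeff_succ_X_mul]
  constructor
  · intro h
    refine ⟨h0, fun r s i j k l => ?_⟩
    have := congrArg (fun F => PowerSeries.coeff (r + 1) (PowerSeries.coeff (s + 1) F)) (h i j k l)
    simp only [e1, e2, map_sub, coeff_coeff_mul, coeff_coeff_mul'] at this
    exact this
  · intro h i j k l
    refine PowerSeries.ext fun s => PowerSeries.ext fun r => ?_
    match r, s with
    | 0, 0 =>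
      simp [sub_mul, mul_assoc, PowerSeries.coeff_C_mul]
    | r + 1, 0 =>
      rw [sub_mul, map_sub, map_sub, PowerSeries.coeff_zero_X_mul, PowerSeries.coeff_C_mul,
        PowerSeries.coeff_succ_X_mul, mul_assoc, PowerSeries.coeff_C_mul,
        PowerSeries.coeff_zero_X_mul]
      simp only [map_sub, coeff_coeff_mul, coeff_coeff_mul', hc, sub_self, map_zero, mul_zero]
    | 0, s + 1 =>
      rw [sub_mul, map_sub, map_sub, PowerSeries.coeff_succ_X_mul, PowerSeries.coeff_C_mul,
        PowerSeries.coeff_zero_X_mul, mul_assoc, PowerSeries.coeff_C_mul,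
        PowerSeries.coeff_zero_X_mul]
      simp only [map_sub, coeff_coeff_mul, coeff_coeff_mul', hc, sub_self]
    | r + 1, s + 1 =>
      rw [e1, e2]
      simp only [map_sub, coeff_coeff_mul, coeff_coeff_mul']
      exact h.rel r s i j k l

/-- All coefficients of the entries of `M` commute with all coefficients of the entries of `N`. -/
def CommuteSeries {n : ℕ} {A : Type*} [Ring A] (M N : Matrix (Fin n) (Fin n) (PowerSeries A)) :
    Prop :=
  ∀ r s i j k l, Commute (PowerSeries.coeff r (M i j)) (PowerSeries.coeff s (N k l))

theorem CommuteSeries.mul_right {n : ℕ} {A : Type*} [Ring A]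
    {M N N' : Matrix (Fin n) (Fin n) (PowerSeries A)} (h : CommuteSeries M N)
    (h' : CommuteSeries M N') : CommuteSeries M (N * N') := by
  intro r s i j k l
  rw [Matrix.mul_apply, map_sum]
  refine Commute.sum_right _ _ _ fun q _ => ?_
  rw [PowerSeries.coeff_mul]
  exact Commute.sum_right _ _ _ fun p _ => (h _ _ _ _ _ _).mul_right (h' _ _ _ _ _ _)

theorem CommuteSeries.list_prod_right {n : ℕ} {A : Type*} [Ring A]
    {M : Matrix (Fin n) (Fin n) (PowerSeries A)} {L : List (Matrix (Fin n) (Fin n) (PowerSeries A))}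
    (h : ∀ N ∈ L, CommuteSeries M N) : CommuteSeries M L.prod := by
  induction L with
  | nil =>
    intro r s i j k l
    rw [List.prod_nil, Matrix.one_apply]
    split_ifs
    · rw [PowerSeries.coeff_one]
      split_ifs
      · exact Commute.one_right _
      · exact Commute.zero_right _
    · rw [map_zero]; exact Commute.zero_right _
  | cons N L ih =>
    rw [List.prod_cons]
    exact (h N (by simp)).mul_right (ih fun N' hN' => h N' (by simp [hN']))

theorem rtt_mul_aux {n : ℕ} {B : Type*} [Ring B] (w c : B) (hw : ∀ y, w * y = y * w)
    (a b a' b' : Matrix (Fin n) (Fin n) B)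
    (h : ∀ i j k l, w * (a i j * b k l - b k l * a i j) = c * (a k j * b i l - b k j * a i l))
    (h' : ∀ i j k l, w * (a' i j * b' k l - b' k l * a' i j)
      = c * (a' k j * b' i l - b' k j * a' i l))
    (hc : ∀ y, c * y = y * c)
    (hab : ∀ i j k l, Commute (b i j) (a' k l)) (hba : ∀ i j k l, Commute (a i j) (b' k l))
    (i j k l : Fin n) :
    w * ((a * a') i j * (b * b') k l - (b * b') k l * (a * a') i j)
      = c * ((a * a') k j * (b * b') i l - (b * b') k j * (a * a') i l) := by
  have p1 : ∀ i j k l, (a * a') i j * (b * b') k l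
      = ∑ p, ∑ q, a i p * b k q * (a' p j * b' q l) := by
    intro i j k l
    rw [Matrix.mul_apply, Matrix.mul_apply, Finset.sum_mul_sum]
    refine Finset.sum_congr rfl fun p _ => Finset.sum_congr rfl fun q _ => ?_
    rw [mul_assoc, ← mul_assoc (a' p j), ← (hab k q p j).eq]
    simp only [mul_assoc]
  have p2 : ∀ i j k l, (b * b') k l * (a * a') i j
      = ∑ p, ∑ q, b k q * a i p * (b' q l * a' p j) := by
    intro i j k l
    rw [Matrix.mul_apply, Matrix.mul_apply, Finset.sum_mul_sum, Finset.sum_comm]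
    refine Finset.sum_congr rfl fun p _ => Finset.sum_congr rfl fun q _ => ?_
    rw [mul_assoc, ← mul_assoc (b' q l), ← (hba i p q l).eq]
    simp only [mul_assoc]
  have key : ∀ p q, w * (a i p * b k q * (a' p j * b' q l) - b k q * a i p * (b' q l * a' p j))
      = c * (a k p * b i q * (a' p j * b' q l)) - c * (b k p * a i q * (a' p j * b' q l))
        + (c * (b k q * a i p * (a' q j * b' p l)) - c * (b k q * a i p * (b' q j * a' p l))) := by
    intro p q
    have t1 : w * (a i p * b k q * (a' p j * b' q l) - b k q * a i p * (b' q l * a' p j))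
        = (w * (a i p * b k q - b k q * a i p)) * (a' p j * b' q l)
          + (b k q * a i p) * (w * (a' p j * b' q l - b' q l * a' p j)) := by
      rw [← mul_assoc (b k q * a i p) w, ← hw (b k q * a i p)]
      noncomm_ring
    rw [t1, h, h', ← mul_assoc (b k q * a i p) c, ← hc (b k q * a i p)]
    noncomm_ring
  rw [p1, p2, p1, p2]
  simp only [← Finset.sum_sub_distrib, Finset.mul_sum, key]
  have s1 : ∑ p, ∑ q, c * (b k p * a i q * (a' p j * b' q l))
      = ∑ p, ∑ q, c * (b k q * a i p * (a' q j * b' p l)) := Finset.sum_comm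
  simp only [Finset.sum_add_distrib, Finset.sum_sub_distrib, mul_sub, s1]
  abel

theorem IsRTTSeries.mul {n : ℕ} {A : Type*} [Ring A]
    {M N : Matrix (Fin n) (Fin n) (PowerSeries A)} (hM : IsRTTSeries M) (hN : IsRTTSeries N)
    (h : CommuteSeries M N) : IsRTTSeries (M * N) := by
  have hX : ∀ F : PowerSeries (PowerSeries A), PowerSeries.X * F = F * PowerSeries.X :=
    fun F => (PowerSeries.commute_X F).eq.symm
  have hCX : ∀ F : PowerSeries (PowerSeries A),
      PowerSeries.C PowerSeries.X * F = F * PowerSeries.C PowerSeries.X := by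
    intro F
    refine PowerSeries.ext fun s => ?_
    rw [PowerSeries.coeff_C_mul, PowerSeries.coeff_mul_C]
    exact (PowerSeries.commute_X _).eq.symm
  intro i j k l
  have e1 : ∀ i j, PowerSeries.C ((M * N) i j)
      = ((M.map PowerSeries.C) * (N.map PowerSeries.C)) i j := by
    intro i j; rw [Matrix.mul_apply, Matrix.mul_apply, map_sum]; simp
  have e2 : ∀ i j, PowerSeries.map (PowerSeries.C (R := A)) ((M * N) i j)
      = ((M.map (PowerSeries.map (PowerSeries.C (R := A))))
        * (N.map (PowerSeries.map (PowerSeries.C (R := A))))) i j := by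
    intro i j; rw [Matrix.mul_apply, Matrix.mul_apply, map_sum]; simp
  have hcomm : ∀ f g : PowerSeries A,
      (∀ r s, Commute (PowerSeries.coeff r f) (PowerSeries.coeff s g)) →
      Commute (PowerSeries.map PowerSeries.C f) (PowerSeries.C g) := by
    intro f g hfg
    refine PowerSeries.ext fun s => PowerSeries.ext fun r => ?_
    rw [coeff_coeff_mul, coeff_coeff_mul']
    exact (hfg s r).eq
  have hcomm' : ∀ f g : PowerSeries A,
      (∀ r s, Commute (PowerSeries.coeff r f) (PowerSeries.coeff s g)) →
      Commute (PowerSeries.C f) (PowerSeries.map PowerSeries.C g) :=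
    fun f g hfg => (hcomm g f fun r s => (hfg s r).symm).symm
  rw [e1, e1, e1, e2, e2, e2]
  refine rtt_mul_aux _ _ (fun y => ?_) _ _ _ _ hM hN (fun y => ?_) (fun _ _ _ _ => ?_)
    (fun _ _ _ _ => ?_) i j k l
  · rw [sub_mul, mul_sub, hX, hCX]
  · rw [mul_assoc, hX, ← mul_assoc, hCX, mul_assoc]
  · exact hcomm _ _ fun r s => h _ _ _ _ _ _
  · exact hcomm' _ _ fun r s => h _ _ _ _ _ _

theorem list_prod_rtt {n : ℕ} {A : Type*} [Ring A]
    (L : List (Matrix (Fin n) (Fin n) (PowerSeries A))) (hc : L.Pairwise CommuteSeries)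
    (h : ∀ M ∈ L, IsRTT (fun s i j => PowerSeries.coeff s (M i j))) :
    IsRTT (fun s i j => PowerSeries.coeff s (L.prod i j)) := by
  have key : IsRTTSeries L.prod ∧
      ∀ i j, PowerSeries.coeff 0 (L.prod i j) = if i = j then 1 else 0 := by
    induction L with
    | nil =>
      have h0 : ∀ i j : Fin n, PowerSeries.coeff 0
          ((1 : Matrix (Fin n) (Fin n) (PowerSeries A)) i j) = if i = j then 1 else 0 := by
        intro i j; rw [Matrix.one_apply]; split_ifs <;> simp
      refine ⟨?_, h0⟩
      intro i j k l
      simp only [List.prod_nil, Matrix.one_apply]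
      split_ifs <;> simp
    | cons M L ih =>
      rw [List.pairwise_cons] at hc
      obtain ⟨h1, h2⟩ := ih hc.2 fun N hN => h N (by simp [hN])
      have hM := h M (by simp)
      refine ⟨?_, ?_⟩
      · rw [List.prod_cons]
        exact ((isRTTSeries_iff M hM.zero).2 hM).mul h1 (CommuteSeries.list_prod_right hc.1)
      · intro i j
        have hz : ∀ i j, PowerSeries.coeff 0 (M i j) = if i = j then 1 else 0 := hM.zero
        have hm : ∀ f g : PowerSeries A, PowerSeries.coeff 0 (f * g)
            = PowerSeries.coeff 0 f * PowerSeries.coeff 0 g := by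
          intro f g; simp [PowerSeries.coeff_zero_eq_constantCoeff]
        rw [List.prod_cons, Matrix.mul_apply, map_sum]
        simp only [hm, hz, h2]
        simp
  exact (isRTTSeries_iff _ key.2).1 key.1

/-- The operator on `X_1 ⊗ ⋯ ⊗ X_m` acting as `f` on the `a`-th tensor factor. -/
noncomputable def slot {m : ℕ} {X : Fin m → Type*} [∀ a, AddCommGroup (X a)]
    [∀ a, Module ℂ (X a)] (a : Fin m) (f : Module.End ℂ (X a)) :
    Module.End ℂ (⨂[ℂ] a, X a) :=
  PiTensorProduct.map (Function.update (fun _ => LinearMap.id) a f)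

theorem slot_mul {m : ℕ} {X : Fin m → Type*} [∀ a, AddCommGroup (X a)]
    [∀ a, Module ℂ (X a)] (a : Fin m) (f g : Module.End ℂ (X a)) :
    slot a (f * g) = slot a f * slot a g := by
  rw [slot, slot, slot, ← PiTensorProduct.map_mul]
  congr 1
  funext b
  by_cases h : b = a
  · subst h; simp
  · simp only [Function.update_of_ne h]; rfl

theorem slot_one {m : ℕ} {X : Fin m → Type*} [∀ a, AddCommGroup (X a)]
    [∀ a, Module ℂ (X a)] (a : Fin m) : slot a (1 : Module.End ℂ (X a)) = 1 := by
  rw [slot, show (1 : Module.End ℂ (X a)) = (fun b => (LinearMap.id : X b →ₗ[ℂ] X b)) a from rfl,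
    Function.update_eq_self]
  exact PiTensorProduct.map_id

/-- `slot` as a homomorphism of algebras. -/
noncomputable def slotHom {m : ℕ} {X : Fin m → Type*} [∀ a, AddCommGroup (X a)]
    [∀ a, Module ℂ (X a)] (a : Fin m) :
    Module.End ℂ (X a) →ₐ[ℂ] Module.End ℂ (⨂[ℂ] a, X a) :=
  AlgHom.ofLinearMap
    { toFun := slot a
      map_add' := fun _ _ => PiTensorProduct.map_update_add _ _ _ _
      map_smul' := fun _ _ => PiTensorProduct.map_update_smul _ _ _ _ }
    (slot_one a) (slot_mul a)

theorem slot_commute {m : ℕ} {X : Fin m → Type*} [∀ a, AddCommGroup (X a)]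
    [∀ a, Module ℂ (X a)] {a b : Fin m} (hab : a ≠ b) (f : Module.End ℂ (X a))
    (g : Module.End ℂ (X b)) : Commute (slot a f) (slot b g) := by
  rw [Commute, SemiconjBy, slot, slot, ← PiTensorProduct.map_mul, ← PiTensorProduct.map_mul]
  congr 1
  funext c
  by_cases h : c = a
  · subst h
    rw [Function.update_of_ne hab]
    rfl
  · rw [Function.update_of_ne h]
    rfl

/-- The matrix `T(u)` acting on the `a`-th factor of `X_1 ⊗ ⋯ ⊗ X_m`, a matrix of power series in
`u⁻¹` with operator coefficients. -/
noncomputable def slotSeries {m n : ℕ} {X : Fin m → Type*} [∀ a, AddCommGroup (X a)]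
    [∀ a, Module ℂ (X a)] (ρ : ∀ a, Yangian n →ₐ[ℂ] Module.End ℂ (X a)) (a : Fin m) :
    Matrix (Fin n) (Fin n) (PowerSeries (Module.End ℂ (⨂[ℂ] a, X a))) :=
  Matrix.of fun i j => PowerSeries.mk fun s => slot a (ρ a (T n s i j))

/-- The matrix `T^{[1]}(u) T^{[2]}(u) ⋯ T^{[m]}(u)`, where `T^{[a]}(u)` acts on the `a`-th factor.-/
noncomputable def tensorSeries {m n : ℕ} {X : Fin m → Type*} [∀ a, AddCommGroup (X a)]
    [∀ a, Module ℂ (X a)] (ρ : ∀ a, Yangian n →ₐ[ℂ] Module.End ℂ (X a)) :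
    Matrix (Fin n) (Fin n) (PowerSeries (Module.End ℂ (⨂[ℂ] a, X a))) :=
  (List.ofFn (slotSeries ρ)).prod

theorem tensorSeries_isRTT {m n : ℕ} {X : Fin m → Type*} [∀ a, AddCommGroup (X a)]
    [∀ a, Module ℂ (X a)] (ρ : ∀ a, Yangian n →ₐ[ℂ] Module.End ℂ (X a)) :
    IsRTT (fun s i j => PowerSeries.coeff s (tensorSeries ρ i j)) := by
  refine list_prod_rtt _ ?_ ?_
  · rw [List.pairwise_ofFn]
    intro a b hab r s i j k l
    simp only [slotSeries, Matrix.of_apply, PowerSeries.coeff_mk]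
    exact slot_commute hab.ne _ _
  · intro M hM
    obtain ⟨a, rfl⟩ := List.mem_ofFn.1 hM
    have ht := T_isRTT n
    have e : ∀ s i j, PowerSeries.coeff s (slotSeries ρ a i j)
        = ((slotHom a).comp (ρ a)) (T n s i j) := by
      intro s i j
      simp only [slotSeries, Matrix.of_apply, PowerSeries.coeff_mk]
      rfl
    simp only [e]
    refine ⟨fun i j => ?_, fun r s i j k l => ?_⟩
    · rw [ht.zero]; split_ifs
      · exact map_one _
      · exact map_zero _
    · simp only [← map_mul, ← map_sub]
      rw [ht.rel]

/-- The action of the Yangian on `X_1 ⊗ ⋯ ⊗ X_m` through the iterated comultiplication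
`T_ij(u) ↦ ∑_{k_1, …, k_{m-1}} T_{i k_1}(u) ⊗ T_{k_1 k_2}(u) ⊗ ⋯ ⊗ T_{k_{m-1} j}(u)`. -/
noncomputable def yTensor {m n : ℕ} {X : Fin m → Type*} [∀ a, AddCommGroup (X a)]
    [∀ a, Module ℂ (X a)] (ρ : ∀ a, Yangian n →ₐ[ℂ] Module.End ℂ (X a)) :
    Yangian n →ₐ[ℂ] Module.End ℂ (⨂[ℂ] a, X a) :=
  Yangian.lift (fun s i j => PowerSeries.coeff s (tensorSeries ρ i j)) (tensorSeries_isRTT ρ)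

/-- The action of `𝔥 = gl_1 ⊕ ⋯ ⊕ gl_1` on `X_1 ⊗ ⋯ ⊗ X_m`, where the generator `E_11` of the
`a`-th copy of `gl_1` acts on the factor `X_a` by the operator `e a`. -/
noncomputable def hTensor {m : ℕ} {X : Fin m → Type*} [∀ a, AddCommGroup (X a)]
    [∀ a, Module ℂ (X a)] (e : ∀ a, Module.End ℂ (X a)) :
    (Fin m → ℂ) →ₗ[ℂ] Module.End ℂ (⨂[ℂ] a, X a) :=
  Fintype.linearCombination ℂ fun a => slot a (e a)

end Tensor
/-! ### Verma modules and evaluation modules -/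

section Verma

/-- The left ideal of `U(gl_m)` generated by the `E_ab` with `a < b` and the `E_aa - μ_a`. -/
noncomputable def vermaIdeal (m : ℕ) (μ : Fin m → ℂ) : Submodule (Ugl m) (Ugl m) :=
  Submodule.span (Ugl m) ({x | ∃ a b : Fin m, a < b ∧ x = UE a b} ∪
    {x | ∃ a : Fin m, x = UE a a - algebraMap ℂ (Ugl m) (μ a)})

/-- The Verma module `M_μ` over `gl_m` with highest weight `μ = (μ_1, …, μ_m)`. -/
def Verma (m : ℕ) (μ : Fin m → ℂ) : Type := Ugl m ⧸ vermaIdeal m μ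

noncomputable instance (m : ℕ) (μ : Fin m → ℂ) : AddCommGroup (Verma m μ) :=
  inferInstanceAs (AddCommGroup (Ugl m ⧸ vermaIdeal m μ))

noncomputable instance (m : ℕ) (μ : Fin m → ℂ) : Module (Ugl m) (Verma m μ) :=
  inferInstanceAs (Module (Ugl m) (Ugl m ⧸ vermaIdeal m μ))

noncomputable instance (m : ℕ) (μ : Fin m → ℂ) : Module ℂ (Verma m μ) :=
  inferInstanceAs (Module ℂ (Ugl m ⧸ vermaIdeal m μ))

instance (m : ℕ) (μ : Fin m → ℂ) : IsScalarTower ℂ (Ugl m) (Verma m μ) :=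
  inferInstanceAs (IsScalarTower ℂ (Ugl m) (Ugl m ⧸ vermaIdeal m μ))

/-- The Lie algebra `gl_m` acts on `M_μ` via left multiplication. -/
noncomputable instance (m : ℕ) (μ : Fin m → ℂ) : LieRingModule (gl m) (Verma m μ) where
  bracket X v := UniversalEnvelopingAlgebra.ι ℂ X • v
  add_lie X Y v := by
    show UniversalEnvelopingAlgebra.ι ℂ (X + Y) • v = _
    rw [map_add, add_smul]
  lie_add X v w := smul_add _ v w
  leibniz_lie X Y v := by
    show UniversalEnvelopingAlgebra.ι ℂ X • UniversalEnvelopingAlgebra.ι ℂ Y • v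
      = UniversalEnvelopingAlgebra.ι ℂ ⁅X, Y⁆ • v
        + UniversalEnvelopingAlgebra.ι ℂ Y • UniversalEnvelopingAlgebra.ι ℂ X • v
    rw [LieHom.map_lie, Ring.lie_def, sub_smul, mul_smul, mul_smul, sub_add_cancel]

instance (m : ℕ) (μ : Fin m → ℂ) : LieModule ℂ (gl m) (Verma m μ) where
  smul_lie c X v := by
    show UniversalEnvelopingAlgebra.ι ℂ (c • X) • v = c • UniversalEnvelopingAlgebra.ι ℂ X • v
    rw [map_smul, smul_assoc]
  lie_smul c X v := by
    show UniversalEnvelopingAlgebra.ι ℂ X • c • v = c • UniversalEnvelopingAlgebra.ι ℂ X • v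
    rw [← algebraMap_smul (Ugl m) c v, ← algebraMap_smul (Ugl m) c, ← mul_smul, ← mul_smul,
      Algebra.commutes]

/-- The action of the Yangian on the exterior algebra `Λ(ℂ^n)` that is obtained from the action of
`gl_n`, `E_ij ↦ x_i ∂_j`, by pulling back through `π_n` and then through `τ_w`. -/
noncomputable def evalAct (n : ℕ) (w : ℂ) : Yangian n →ₐ[ℂ] Module.End ℂ (Gr (Fin n)) :=
  ((UniversalEnvelopingAlgebra.lift ℂ (fock (Fin n))).comp (evalHom n)).comp (tau w)

/-- The operator `∑_k x_k ∂_k` on `Λ(ℂ^n)`. -/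
noncomputable def euler (n : ℕ) : Module.End ℂ (Gr (Fin n)) := ∑ k, mulX k * del k

/-- Equivalence of bimodules: there is a linear isomorphism `M ≃ N` that intertwines the actions of
all elements of `H` and of the Yangian. -/
def Equivalent {n : ℕ} {H M N : Type*} [AddCommGroup M] [Module ℂ M] [AddCommGroup N] [Module ℂ N]
    (hM : H → Module.End ℂ M) (yM : Yangian n →ₐ[ℂ] Module.End ℂ M)
    (hN : H → Module.End ℂ N) (yN : Yangian n →ₐ[ℂ] Module.End ℂ N) : Prop :=
  ∃ Φ : M ≃ₗ[ℂ] N, (∀ h v, Φ (hM h v) = hN h (Φ v)) ∧ (∀ y v, Φ (yM y v) = yN y (Φ v))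

end Verma

end KN

/-!
The coinvariants of `E_m(M_μ)` are computed on the highest weight vector `1_μ` of the Verma module.

As a vector space, `E_m(M_μ)_𝔫` is `Λ(ℂ^m ⊗ ℂ^n)` through `f ↦ [1_μ ⊗ f]` (`vacCoinv_bijective`).
The map is surjective because `M_μ` is spanned by the vectors obtained from `1_μ` by lowering
operators (`lowerSpan`) and `[E_ba v ⊗ f] = -[v ⊗ E_ba f]` for `a < b`. It is injective because
`M_μ` is free over `U(𝔫)`. In place of the Poincaré–Birkhoff–Witt theorem there is an explicit
highest weight module over `gl_m` that is built by induction on `m` (`exists_verma_realization`):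
the module for `gl_{m+1}` consists of the polynomials in `y_1, …, y_m` with coefficients in the
module for `gl_m`, and the generators act as differential operators in the `y_a`
(`IsGL.extendGL`). A left inverse is the map that sends `E_ba v ⊗ f` to minus the image of
`v ⊗ E_ba f`.

The Yangian acts through the entries of powers of the matrix `M` with entries `M_ab = E_ba`.
Moving the last factor of `M^{s+1} = M^s M` to the left, where it either acts on `1_μ` by a scalar
or lies in `𝔫` and can be moved over to the Grassmann algebra, gives a recursion in `s`
(`powEntry_succ`). After multiplication by `x_ai ∂_bj` and summation over `a`, the trace terms in
it cancel, and with `L_b = (x_bi ∂_bj)` and `ρ_b = μ_b - b + 1` (`b = 1, …, m`) it becomes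
`Y_b^{s+1} = ρ_b Y_b^s + ∑_{c < b} Y_c^s L_b`, `Y_b^0 = L_b` (`powColumn_eq`). For the generating
functions this is `1 + ∑_{c ≤ b} Y_c(u) = (1 + ∑_{c < b} Y_c(u)) (1 + L_b / (u - ρ_b))`, so that
`T(u)` acts as the ordered product of the matrices `1 + L_b / (u - ρ_b)`
(`coeff_prod_eq_sum_fusion`).

That is the action on a tensor product of evaluation modules, once `Λ(ℂ^m ⊗ ℂ^n)` is identified with
the `m`-fold tensor power of `Λ(ℂ^n)` by multiplication of the factors (`tensorToGr_bijective`):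
the operator `x_ai ∂_aj` is a derivation, hence acts on the `a`-th factor only
(`tensorToGr_slot`). The modules `E_1^z(M_t)` are treated by the same map for `m = 1`
(`equivalent_evalAct`).
-/

namespace KN

/-! ### A free highest weight module over `gl_m` -/

section Realization

variable {m : ℕ} {A : Type*} [Ring A]

/-- Given operators `N` of `gl_m`, commuting variables `y_a` with derivations `d_a`, and a central
element `t`, the matrix whose `pq`-entry is the operator of `E_qp ∈ gl_{m+1}` on polynomials in the
`y_a` with coefficients in a `gl_m`-module: `E_{m+1,a}` is multiplication by `y_a`, and the others
are determined by their action on constants, where `E_ba` acts by `N a b`, `E_{m+1,m+1}` by `t`, and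
`E_{a,m+1}` by zero. -/
def extendGL (N : Matrix (Fin m) (Fin m) A) (y d : Fin m → A) (t : A) :
    Matrix (Fin (m + 1)) (Fin (m + 1)) A :=
  Matrix.of fun p q =>
    Fin.lastCases
      (Fin.lastCases (t + ∑ c, y c * d c)
        (fun a => (∑ c, N c a * d c) - t * d a - (∑ c, y c * d c) * d a) q)
      (fun a => Fin.lastCases (y a) (fun b => N a b - y a * d b) q) p

theorem extendGL_last_last (N : Matrix (Fin m) (Fin m) A) (y d : Fin m → A) (t : A) :
    extendGL N y d t (Fin.last m) (Fin.last m) = t + ∑ c, y c * d c := by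
  simp [extendGL]

theorem extendGL_last_castSucc (N : Matrix (Fin m) (Fin m) A) (y d : Fin m → A) (t : A)
    (a : Fin m) : extendGL N y d t (Fin.last m) a.castSucc
      = (∑ c, N c a * d c) - t * d a - (∑ c, y c * d c) * d a := by
  simp [extendGL]

theorem extendGL_castSucc_last (N : Matrix (Fin m) (Fin m) A) (y d : Fin m → A) (t : A)
    (a : Fin m) : extendGL N y d t a.castSucc (Fin.last m) = y a := by
  simp [extendGL]

theorem extendGL_castSucc_castSucc (N : Matrix (Fin m) (Fin m) A) (y d : Fin m → A) (t : A)
    (a b : Fin m) : extendGL N y d t a.castSucc b.castSucc = N a b - y a * d b := by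
  simp [extendGL]

theorem IsGL.extendGL {N : Matrix (Fin m) (Fin m) A} (hN : IsGL N) {y d : Fin m → A} {t : A}
    (hNy : ∀ a b c, N a b * y c = y c * N a b) (hNd : ∀ a b c, d c * N a b = N a b * d c)
    (hyy : ∀ a b, y a * y b = y b * y a) (hdd : ∀ a b, d a * d b = d b * d a)
    (hdy : ∀ a b, d a * y b = y b * d a + if a = b then 1 else 0)
    (ht : ∀ z, t * z = z * t) : IsGL (extendGL N y d t) := by
  set D : A := ∑ c, y c * d c with hD
  set K : Fin m → A := fun a => ∑ c, N c a * d c with hK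
  have hDy : ∀ a, D * y a = y a * D + y a := by
    intro a
    simp only [hD, Finset.sum_mul, Finset.mul_sum, mul_assoc, hdy, mul_add, mul_ite, mul_one,
      mul_zero, Finset.sum_add_distrib, Finset.sum_ite_eq', Finset.mem_univ, if_true]
    simp only [← mul_assoc, hyy a]
  have hdD : ∀ a, d a * D = D * d a + d a := by
    intro a
    simp only [hD, Finset.sum_mul, Finset.mul_sum, ← mul_assoc, hdy, add_mul, ite_mul, one_mul,
      zero_mul, Finset.sum_add_distrib, Finset.sum_ite_eq, Finset.mem_univ, if_true]
    simp only [mul_assoc, hdd a]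
  have hND : ∀ a b, N a b * D = D * N a b := by
    intro a b
    simp only [hD, Finset.sum_mul, Finset.mul_sum, mul_assoc, hNd]
    simp only [← mul_assoc, hNy]
  have hKy : ∀ a b, K a * y b = y b * K a + N b a := by
    intro a b
    simp only [hK, Finset.sum_mul, Finset.mul_sum, mul_assoc, hdy, mul_add, mul_ite, mul_one,
      mul_zero, Finset.sum_add_distrib, Finset.sum_ite_eq', Finset.mem_univ, if_true]
    simp only [← mul_assoc, hNy]
  have hKd : ∀ a b, d b * K a = K a * d b := by
    intro a b
    simp only [hK, Finset.sum_mul, Finset.mul_sum, ← mul_assoc, hNd]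
    simp only [mul_assoc, hdd b]
  have hKD : ∀ a, K a * D = D * K a + K a := by
    intro a
    simp only [hK, Finset.sum_mul, Finset.mul_sum, mul_assoc, hdD, mul_add,
      Finset.sum_add_distrib]
    simp only [← mul_assoc, hND]
  have hKN : ∀ a b c, N a b * K c - K c * N a b
      = (if c = a then K b else 0) - N a c * d b := by
    intro a b c
    have h : ∀ e, N a b * (N e c * d e) - N e c * d e * N a b
        = ((if c = a then N e b else 0) - (if b = e then N a c else 0)) * d e := by
      intro e
      rw [← hN, mul_assoc (N e c), hNd, ← mul_assoc, ← mul_assoc, sub_mul]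
    simp only [hK, Finset.sum_mul, Finset.mul_sum, ← Finset.sum_sub_distrib, h]
    simp only [sub_mul, ite_mul, zero_mul, Finset.sum_sub_distrib, Finset.sum_ite_eq,
      Finset.mem_univ, if_true]
    split_ifs <;> simp
  have hKK : ∀ a b, K a * K b - K b * K a = K a * d b - K b * d a := by
    intro a b
    have h : K a * K b - K b * K a = ∑ c, (N c a * K b - K b * N c a) * d c := by
      simp only [sub_mul, Finset.sum_sub_distrib, mul_assoc, ← hKd]
      simp only [← mul_assoc, hK, Finset.sum_mul, Finset.mul_sum]
      congr 1
      exact Finset.sum_comm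
    rw [h]
    simp only [hKN, sub_mul, ite_mul, zero_mul, Finset.sum_sub_distrib, Finset.sum_ite_eq,
      Finset.mem_univ, if_true]
    simp only [hK, Finset.sum_mul, mul_assoc, hdd a]
  have anti : ∀ x z w : A, x * z - z * x = w → z * x - x * z = -w := by
    intro x z w h; rw [← h, neg_sub]
  have hLL : KN.extendGL N y d t (Fin.last m) (Fin.last m) = t + D :=
    extendGL_last_last N y d t
  have hLa : ∀ a, KN.extendGL N y d t (Fin.last m) (Fin.castSucc a)
      = K a - t * d a - D * d a := extendGL_last_castSucc N y d t
  have haL := extendGL_castSucc_last N y d t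
  have hab := extendGL_castSucc_castSucc N y d t
  -- the commutators of the entries, one for each pair of blocks
  have c2 : ∀ a b c, (N a b - y a * d b) * y c - y c * (N a b - y a * d b)
      = -(if b = c then y a else 0) := by
    intro a b c
    have e : y a * (if b = c then 1 else 0) = if b = c then y a else 0 := by simp
    linear_combination (norm := noncomm_ring) hNy a b c - y a * hdy b c - hyy a c * d b - e
  have c3 : ∀ c, (t + D) * y c - y c * (t + D) = y c := by
    intro c
    linear_combination (norm := noncomm_ring) ht (y c) + hDy c
  have c4 : ∀ a b, (K a - t * d a - D * d a) * y b - y b * (K a - t * d a - D * d a)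
      = N b a - y b * d a - if a = b then t + D else 0 := by
    intro a b
    have e : (t + D) * (if a = b then 1 else 0) = if a = b then t + D else 0 := by simp
    linear_combination (norm := noncomm_ring) hKy a b - (t + D) * hdy a b - ht (y b) * d a
      - hDy b * d a - e
  have c5 : ∀ a b c e, (N a b - y a * d b) * (N c e - y c * d e)
        - (N c e - y c * d e) * (N a b - y a * d b)
      = (if e = a then N c b - y c * d b else 0) - (if b = c then N a e - y a * d e else 0) := by
    intro a b c e
    have e1 : y a * (if b = c then 1 else 0) * d e = if b = c then y a * d e else 0 := by simp
    have e2 : y c * (if e = a then 1 else 0) * d b = if e = a then y c * d b else 0 := by simp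
    have e3 : ∀ (P : Prop) [Decidable P] (u v : A), (if P then u - v else 0)
        = (if P then u else 0) - if P then v else 0 := by
      intro P _ u v; split_ifs <;> simp
    rw [e3, e3]
    linear_combination (norm := noncomm_ring) hN a b c e - hNy a b c * d e + y c * hNd a b e
      + hNy c e a * d b - y a * hNd c e b + y a * hdy b c * d e - y c * hdy e a * d b
      + hyy a c * d b * d e - y c * y a * hdd e b + e1 - e2
  have c6 : ∀ a b, (t + D) * (N a b - y a * d b) - (N a b - y a * d b) * (t + D) = 0 := by
    intro a b
    linear_combination (norm := noncomm_ring) ht (N a b - y a * d b) - hND a b - hDy a * d b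
      + y a * hdD b
  have c7 : ∀ a b c, (K c - t * d c - D * d c) * (N a b - y a * d b)
        - (N a b - y a * d b) * (K c - t * d c - D * d c)
      = -(if c = a then K b - t * d b - D * d b else 0) := by
    intro a b c
    have e1 : (t + D) * (if c = a then 1 else 0) * d b = if c = a then (t + D) * d b else 0 := by
      simp
    have e2 : (if c = a then K b - t * d b - D * d b else 0)
        = (if c = a then K b else 0) - if c = a then (t + D) * d b else 0 := by
      split_ifs
      · noncomm_ring
      · simp
    rw [e2]
    linear_combination (norm := noncomm_ring) -hKN a b c - hKy c a * d b + y a * hKd c b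
      - t * hNd a b c - ht (N a b) * d c + t * hdy c a * d b + ht (y a * d b) * d c
      + t * y a * hdd c b - D * hNd a b c + hND a b * d c + D * hdy c a * d b - y a * hdD b * d c
      + D * y a * hdd c b + hDy a * d b * d c + e1
  have c9 : ∀ a, (K a - t * d a - D * d a) * (t + D) - (t + D) * (K a - t * d a - D * d a)
      = K a - t * d a - D * d a := by
    intro a
    linear_combination (norm := noncomm_ring) hKD a - ht (K a) + t * ht (d a) - t * hdD a
      + D * ht (d a) - D * hdD a
  have c10 : ∀ a b, (K a - t * d a - D * d a) * (K b - t * d b - D * d b)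
      - (K b - t * d b - D * d b) * (K a - t * d a - D * d a) = 0 := by
    intro a b
    linear_combination (norm := noncomm_ring) hKK a b + ht (K a) * d b + t * hKd a b
      - ht (K b) * d a - t * hKd b a - t * ht (d a) * d b + t * ht (d b) * d a + t * t * hdd a b
      - hKD a * d b + D * hKd a b + hKD b * d a - D * hKd b a
      + t * hdD a * d b + D * ht (d b) * d a - t * hdD b * d a - D * ht (d a) * d b
      + t * D * hdd a b + D * t * hdd a b + t * hdd a b
      + D * hdD a * d b - D * hdD b * d a + D * D * hdd a b + D * hdd a b
  have hne : ∀ a : Fin m, Fin.castSucc a ≠ Fin.last m := fun a => (Fin.castSucc_lt_last a).ne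
  have hne' : ∀ a : Fin m, Fin.last m ≠ Fin.castSucc a := fun a => (Fin.castSucc_lt_last a).ne'
  have hinj : ∀ a b : Fin m, Fin.castSucc a = Fin.castSucc b ↔ a = b :=
    fun a b => Fin.castSucc_inj
  intro p q r s
  induction p using Fin.lastCases <;> induction q using Fin.lastCases <;>
    induction r using Fin.lastCases <;> induction s using Fin.lastCases <;>
    simp only [hLL, hLa, haL, hab, hne, hne', hinj, if_true, if_false, sub_zero, zero_sub, sub_self]
  case last.last.last.cast => exact anti _ _ _ (c9 _)
  case last.last.cast.last => exact c3 _
  case last.last.cast.cast => exact c6 _ _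
  case last.cast.last.last => exact c9 _
  case last.cast.last.cast => exact c10 _ _
  case last.cast.cast.last => exact c4 _ _
  case last.cast.cast.cast => exact c7 _ _ _
  case cast.last.last.last => exact anti _ _ _ (c3 _)
  case cast.last.last.cast => exact (anti _ _ _ (c4 _ _)).trans (neg_sub _ _)
  case cast.last.cast.last => exact sub_eq_zero.2 (hyy _ _)
  case cast.last.cast.cast => exact (anti _ _ _ (c2 _ _ _)).trans (neg_neg _)
  case cast.cast.last.last => exact (anti _ _ _ (c6 _ _)).trans neg_zero
  case cast.cast.last.cast => exact (anti _ _ _ (c7 _ _ _)).trans (neg_neg _)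
  case cast.cast.cast.last => exact c2 _ _ _
  case cast.cast.cast.cast => exact c5 _ _ _ _

/-- Polynomials can be evaluated at commuting elements of a noncommutative algebra. -/
theorem exists_aeval_of_commute {m : ℕ} {B : Type*} [Ring B] [Algebra ℂ B] (x : Fin m → B)
    (hx : ∀ a b, x a * x b = x b * x a) :
    ∃ θ : MvPolynomial (Fin m) ℂ →ₐ[ℂ] B, ∀ a, θ (MvPolynomial.X a) = x a := by
  have hc : ∀ u ∈ Set.range x, ∀ v ∈ Set.range x, u * v = v * u := by
    rintro _ ⟨a, rfl⟩ _ ⟨b, rfl⟩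
    exact hx a b
  have := Algebra.isMulCommutative_adjoin ℂ hc
  let _ : CommRing (Algebra.adjoin ℂ (Set.range x)) :=
    { (inferInstance : Ring (Algebra.adjoin ℂ (Set.range x))) with
      mul_comm := fun u v => mul_comm' u v }
  refine ⟨(Algebra.adjoin ℂ (Set.range x)).val.comp (MvPolynomial.aeval fun a =>
    (⟨x a, Algebra.subset_adjoin ⟨a, rfl⟩⟩ : Algebra.adjoin ℂ (Set.range x))), fun a => ?_⟩
  simp

/-- If the commutator with `z` acts on the images of the variables as minus the derivation
`X_a ∂/∂X_b`, then it does so on the images of all polynomials. -/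
theorem commutator_aeval {m : ℕ} {B : Type*} [Ring B] [Algebra ℂ B]
    (θ : MvPolynomial (Fin m) ℂ →ₐ[ℂ] B) (z : B) (a b : Fin m)
    (hz : ∀ c, z * θ (MvPolynomial.X c) - θ (MvPolynomial.X c) * z
      = -(if b = c then θ (MvPolynomial.X a) else 0))
    (P : MvPolynomial (Fin m) ℂ) :
    z * θ P - θ P * z = -θ (MvPolynomial.X a * MvPolynomial.pderiv b P) := by
  induction P using MvPolynomial.induction_on with
  | C c =>
    have : θ (MvPolynomial.C c) = algebraMap ℂ B c := θ.commutes c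
    rw [this, MvPolynomial.pderiv_C, mul_zero, map_zero, neg_zero, Algebra.commutes, sub_self]
  | add P Q hP hQ =>
    simp only [map_add, mul_add, neg_add, ← hP, ← hQ]
    noncomm_ring
  | mul_X P c hP =>
    have e : MvPolynomial.X a * MvPolynomial.pderiv b (P * MvPolynomial.X c)
        = MvPolynomial.X a * MvPolynomial.pderiv b P * MvPolynomial.X c
          + P * (if b = c then MvPolynomial.X a else 0) := by
      rw [Derivation.leibniz, MvPolynomial.pderiv_X, Pi.single_apply]
      rw [if_congr (eq_comm (a := c)) rfl rfl]
      split_ifs <;> simp <;> ring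
    have e2 : θ (if b = c then MvPolynomial.X a else 0)
        = if b = c then θ (MvPolynomial.X a) else 0 := by
      split_ifs <;> simp
    rw [e, map_add, map_mul θ P, map_mul θ P, e2, map_mul θ _ (MvPolynomial.X c)]
    linear_combination (norm := noncomm_ring) hP * θ (MvPolynomial.X c) + θ P * hz c

theorem pderiv_comm {m : ℕ} (a b : Fin m) (P : MvPolynomial (Fin m) ℂ) :
    MvPolynomial.pderiv a (MvPolynomial.pderiv b P)
      = MvPolynomial.pderiv b (MvPolynomial.pderiv a P) := by
  have h : ⁅(MvPolynomial.pderiv a : Derivation ℂ (MvPolynomial (Fin m) ℂ) _),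
      (MvPolynomial.pderiv b : Derivation ℂ (MvPolynomial (Fin m) ℂ) _)⁆ = 0 := by
    refine MvPolynomial.derivation_ext fun c => ?_
    rw [Derivation.commutator_apply, MvPolynomial.pderiv_X, MvPolynomial.pderiv_X]
    simp only [Pi.single_apply]
    split_ifs <;> simp
  have := congrArg (fun D => D P) h
  rwa [Derivation.commutator_apply, Derivation.zero_apply, sub_eq_zero] at this

/-- There is a `gl_m`-module `W` with a highest weight vector `w` of weight `μ` on which `𝔫` acts
freely, in the following sense: for every matrix `S` over an algebra `B` with the relations of
`gl_m`, there is a linear map `W → B` that sends `w` to `1` and intertwines the action of `𝔫` on `W`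
with right multiplication by `-S`. The entry `M a b` is the operator of `E_ba`, so that `𝔫`
corresponds to `a < b`. -/
theorem exists_verma_realization (m : ℕ) (μ : Fin m → ℂ) :
    ∃ (W : Type) (_ : AddCommGroup W) (_ : Module ℂ W)
      (M : Matrix (Fin m) (Fin m) (Module.End ℂ W)) (w : W), IsGL M ∧
      (∀ a b, b < a → M a b w = 0) ∧ (∀ a, M a a w = μ a • w) ∧
      ∀ (B : Type) [Ring B] [Algebra ℂ B] (S : Matrix (Fin m) (Fin m) B), IsGL S →
        ∃ ψ : W →ₗ[ℂ] B, ψ w = 1 ∧ ∀ a b, a < b → ∀ v, ψ (M a b v) = -(ψ v * S a b) := by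
  induction m with
  | zero =>
    refine ⟨ℂ, inferInstance, inferInstance, 0, 1, fun a => a.elim0, fun a => a.elim0,
      fun a => a.elim0, fun B _ _ S _ =>
        ⟨Algebra.linearMap ℂ B, map_one (algebraMap ℂ B), fun a => a.elim0⟩⟩
  | succ m ih =>
    obtain ⟨W, _, _, N, w, hN, hraise, hwt, huniv⟩ := ih fun a => μ a.castSucc
    let R := MvPolynomial (Fin m) ℂ
    let y : Fin m → Module.End ℂ (R ⊗[ℂ] W) := fun a =>
      LinearMap.rTensor W (LinearMap.mulLeft ℂ (MvPolynomial.X a))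
    let d : Fin m → Module.End ℂ (R ⊗[ℂ] W) := fun a =>
      LinearMap.rTensor W (MvPolynomial.pderiv a).toLinearMap
    let N' : Matrix (Fin m) (Fin m) (Module.End ℂ (R ⊗[ℂ] W)) :=
      Matrix.of fun a b => LinearMap.lTensor R (N a b)
    let t : Module.End ℂ (R ⊗[ℂ] W) := algebraMap ℂ _ (μ (Fin.last m))
    have hy : ∀ a P v, y a (P ⊗ₜ v) = (MvPolynomial.X a * P) ⊗ₜ v := fun a P v => rfl
    have hd : ∀ a P v, d a (P ⊗ₜ v) = MvPolynomial.pderiv a P ⊗ₜ v := fun a P v => rfl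
    have hn : ∀ a b P v, N' a b (P ⊗ₜ v) = P ⊗ₜ N a b v := fun a b P v => rfl
    have hd1 : ∀ a v, d a (1 ⊗ₜ v) = 0 := by
      intro a v; rw [hd]; simp
    have hN' : IsGL N' := by
      intro a b c e
      refine TensorProduct.ext' fun P v => ?_
      have := LinearMap.congr_fun (hN a b c e) v
      have h1 : ∀ (p : Prop) [Decidable p] (i j : Fin m),
          (if p then N' i j else 0) (P ⊗ₜ v) = P ⊗ₜ ((if p then N i j else 0) v) := by
        intro p _ i j; split_ifs <;> simp [hn]
      simp only [LinearMap.sub_apply, Module.End.mul_apply, hn, h1] at this ⊢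
      rw [← TensorProduct.tmul_sub, this, TensorProduct.tmul_sub]
    refine ⟨R ⊗[ℂ] W, inferInstance, inferInstance, extendGL N' y d t, 1 ⊗ₜ w,
      hN'.extendGL ?_ ?_ ?_ ?_ ?_ ?_, ?_, ?_, ?_⟩
    · intro a b c
      exact TensorProduct.ext' fun P v => by simp only [Module.End.mul_apply, hn, hy]
    · intro a b c
      exact TensorProduct.ext' fun P v => by simp only [Module.End.mul_apply, hn, hd]
    · intro a b
      exact TensorProduct.ext' fun P v => by simp only [Module.End.mul_apply, hy, mul_left_comm]
    · intro a b
      refine TensorProduct.ext' fun P v => ?_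
      simp only [Module.End.mul_apply, hd]
      rw [show (MvPolynomial.pderiv a) ((MvPolynomial.pderiv b) P)
        = (MvPolynomial.pderiv b) ((MvPolynomial.pderiv a) P) from pderiv_comm a b P]
    · intro a b
      refine TensorProduct.ext' fun P v => ?_
      rw [LinearMap.add_apply, Module.End.mul_apply, Module.End.mul_apply, hy, hd, hd, hy,
        Derivation.leibniz, MvPolynomial.pderiv_X, Pi.single_apply, TensorProduct.add_tmul,
        if_congr (eq_comm (a := b)) rfl rfl]
      split_ifs <;> simp
    · exact fun z => Algebra.commutes _ z
    · intro a b hab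
      induction a using Fin.lastCases with
      | last =>
        induction b using Fin.lastCases with
        | last => exact absurd hab (lt_irrefl _)
        | cast b =>
          rw [extendGL_last_castSucc]
          simp [hd1]
      | cast a =>
        induction b using Fin.lastCases with
        | last => exact absurd hab (not_lt.2 (Fin.le_last _))
        | cast b =>
          rw [extendGL_castSucc_castSucc]
          simp [hd1, hn, hraise a b (Fin.castSucc_lt_castSucc_iff.1 hab)]
    · intro a
      induction a using Fin.lastCases with
      | last =>
        rw [extendGL_last_last]
        simp [hd1, t, Module.algebraMap_end_apply]
      | cast a =>
        rw [extendGL_castSucc_castSucc]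
        simp [hd1, hn, hwt]
    · intro B _ _ S hS
      obtain ⟨ψ, hψ1, hψ⟩ := huniv B (S.submatrix Fin.castSucc Fin.castSucc) (by
        intro a b c e
        have := hS a.castSucc b.castSucc c.castSucc e.castSucc
        simp only [Fin.castSucc_inj] at this
        exact this)
      have hne : ∀ a : Fin m, Fin.castSucc a ≠ Fin.last m := fun a => (Fin.castSucc_lt_last a).ne
      have hne' : ∀ a : Fin m, Fin.last m ≠ Fin.castSucc a :=
        fun a => (Fin.castSucc_lt_last a).ne'
      obtain ⟨θ, hθ⟩ := exists_aeval_of_commute (fun a : Fin m => -S a.castSucc (Fin.last m)) (by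
        intro a b
        have := hS a.castSucc (Fin.last m) b.castSucc (Fin.last m)
        rw [if_neg (hne' _), if_neg (hne' _), sub_self, sub_eq_zero] at this
        simp only [neg_mul_neg, this])
      have hc : ∀ (a b : Fin m) (P : R),
          S a.castSucc b.castSucc * θ P - θ P * S a.castSucc b.castSucc
          = -θ (MvPolynomial.X a * MvPolynomial.pderiv b P) := by
        intro a b P
        refine commutator_aeval θ _ a b (fun c => ?_) P
        have := hS a.castSucc b.castSucc c.castSucc (Fin.last m)
        rw [if_neg (hne' _)] at this
        simp only [Fin.castSucc_inj] at this
        rw [hθ, hθ]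
        have e : (if b = c then -S a.castSucc (Fin.last m) else 0)
            = -(if b = c then S a.castSucc (Fin.last m) else 0) := by split_ifs <;> simp
        rw [e]
        linear_combination (norm := noncomm_ring) -this
      -- `y_a = E_{m+1,a}` lies in `𝔫`, so multiplication by `y_a` becomes right multiplication by
      -- `-E_{m+1,a}`
      let Ψ : R ⊗[ℂ] W →ₗ[ℂ] B :=
        TensorProduct.lift ((LinearMap.mul ℂ B).flip.compl₁₂ θ.toLinearMap ψ)
      have hΨ : ∀ P v, Ψ (P ⊗ₜ v) = ψ v * θ P := fun P v => rfl
      refine ⟨Ψ, by rw [hΨ, hψ1, map_one, one_mul], fun a b hab x => ?_⟩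
      induction x using TensorProduct.induction_on with
      | zero => simp
      | add x x' hx hx' => rw [map_add, map_add, hx, hx', map_add, add_mul, neg_add]
      | tmul P v =>
        induction a using Fin.lastCases with
        | last => exact absurd hab (not_lt.2 (Fin.le_last _))
        | cast a =>
          induction b using Fin.lastCases with
          | last =>
            rw [extendGL_castSucc_last, hy, hΨ, hΨ, mul_comm (MvPolynomial.X a), map_mul, hθ]
            noncomm_ring
          | cast b =>
            rw [extendGL_castSucc_castSucc, LinearMap.sub_apply, Module.End.mul_apply, hn, hd, hy,
              map_sub, hΨ, hΨ, hΨ, hψ a b (Fin.castSucc_lt_castSucc_iff.1 hab),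
              Matrix.submatrix_apply]
            linear_combination (norm := noncomm_ring) -(ψ v * hc a b P)

end Realization

/-! ### Maps from Verma modules -/

section VermaMaps

/-- A property that is stable under the algebra operations and holds on `gl_m` holds on `U(gl_m)`. -/
theorem Ugl_induction {m : ℕ} {P : Ugl m → Prop}
    (scalar : ∀ c : ℂ, P (algebraMap ℂ _ c))
    (gen : ∀ X : gl m, P (UniversalEnvelopingAlgebra.ι ℂ X))
    (add : ∀ x y, P x → P y → P (x + y)) (mul : ∀ x y, P x → P y → P (x * y)) (u : Ugl m) :
    P u := by
  let S : Subalgebra ℂ (Ugl m) :=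
    { carrier := {x | P x}
      mul_mem' := fun {x y} hx hy => mul x y hx hy
      add_mem' := fun {x y} hx hy => add x y hx hy
      algebraMap_mem' := scalar }
  let f : gl m →ₗ⁅ℂ⁆ S :=
    { toFun := fun X => ⟨UniversalEnvelopingAlgebra.ι ℂ X, gen X⟩
      map_add' := fun X Y => Subtype.ext (map_add _ X Y)
      map_smul' := fun c X => Subtype.ext (map_smul _ c X)
      map_lie' := fun {X Y} => Subtype.ext (LieHom.map_lie _ X Y) }
  have h : S.val.comp (UniversalEnvelopingAlgebra.lift ℂ f) = AlgHom.id ℂ (Ugl m) := by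
    refine UniversalEnvelopingAlgebra.hom_ext ℂ (LieHom.ext fun X => ?_)
    show ((UniversalEnvelopingAlgebra.lift ℂ f (UniversalEnvelopingAlgebra.ι ℂ X) : S) : Ugl m)
      = UniversalEnvelopingAlgebra.ι ℂ X
    rw [UniversalEnvelopingAlgebra.lift_ι_apply]
    rfl
  have hu := congrArg (fun g => g u) h
  simp only [AlgHom.comp_apply, AlgHom.id_apply] at hu
  rw [← hu]
  exact (UniversalEnvelopingAlgebra.lift ℂ f u).2

/-- The linear map `E_ab ↦ M b a`. -/
noncomputable def repLin {m : ℕ} {A : Type*} [Ring A] [Algebra ℂ A]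
    (M : Matrix (Fin m) (Fin m) A) : gl m →ₗ[ℂ] A where
  toFun X := ∑ a, ∑ b, X a b • M b a
  map_add' X Y := by simp [add_smul, Finset.sum_add_distrib]
  map_smul' c X := by simp [mul_smul, Finset.smul_sum]

theorem repLin_single {m : ℕ} {A : Type*} [Ring A] [Algebra ℂ A]
    (M : Matrix (Fin m) (Fin m) A) (a b : Fin m) (c : ℂ) :
    repLin M (Matrix.single a b c) = c • M b a := by
  simp only [repLin, LinearMap.coe_mk, AddHom.coe_mk, Matrix.single_apply]
  rw [Finset.sum_eq_single a, Finset.sum_eq_single b]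
  · simp
  · intro d _ hd; simp [hd.symm]
  · simp
  · intro d _ hd; simp [hd.symm]
  · simp

theorem IsGL.repLin_lie {m : ℕ} {A : Type*} [Ring A] [Algebra ℂ A]
    {M : Matrix (Fin m) (Fin m) A} (hM : IsGL M) (X Y : gl m) :
    repLin M (X * Y - Y * X) = repLin M X * repLin M Y - repLin M Y * repLin M X := by
  induction X using Matrix.induction_on' with
  | h_zero => simp
  | h_add X X' h h' =>
    rw [show (X + X') * Y - Y * (X + X') = (X * Y - Y * X) + (X' * Y - Y * X') by noncomm_ring,
      map_add, h, h', map_add]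
    noncomm_ring
  | h_std_basis a b c =>
    induction Y using Matrix.induction_on' with
    | h_zero => simp
    | h_add Y Y' h h' =>
      rw [show ∀ Z : gl m, Z * (Y + Y') - (Y + Y') * Z
        = (Z * Y - Y * Z) + (Z * Y' - Y' * Z) from fun Z => by noncomm_ring,
        map_add, h, h', map_add]
      noncomm_ring
    | h_std_basis p q d =>
      simp only [repLin_single, smul_mul_smul_comm]
      rw [mul_comm d c, ← smul_sub, hM, map_sub, smul_sub]
      congr 1
      · by_cases h : b = p
        · subst h; simp [repLin_single]
        · simp [h, Ne.symm h]
      · by_cases h : a = q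
        · subst h; simp [repLin_single, mul_comm d c]
        · simp [h, Ne.symm h]

/-- The homomorphism of Lie algebras `E_ab ↦ M b a` defined by a matrix that satisfies the
commutation relations of the transposed matrix of generators of `gl_m`. -/
noncomputable def IsGL.rep {m : ℕ} {A : Type*} [Ring A] [Algebra ℂ A]
    {M : Matrix (Fin m) (Fin m) A} (hM : IsGL M) : gl m →ₗ⁅ℂ⁆ A :=
  { repLin M with map_lie' := fun {X Y} => hM.repLin_lie X Y }

theorem IsGL.rep_E {m : ℕ} {A : Type*} [Ring A] [Algebra ℂ A]
    {M : Matrix (Fin m) (Fin m) A} (hM : IsGL M) (a b : Fin m) : hM.rep (E a b) = M b a :=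
  (repLin_single M a b 1).trans (one_smul _ _)

/-- The highest weight vector `1_μ` of `M_μ`. -/
noncomputable def vac (m : ℕ) (μ : Fin m → ℂ) : Verma m μ :=
  Submodule.Quotient.mk (p := vermaIdeal m μ) 1

theorem smul_vac (m : ℕ) (μ : Fin m → ℂ) (u : Ugl m) :
    u • vac m μ = Submodule.Quotient.mk (p := vermaIdeal m μ) u := by
  show u • Submodule.Quotient.mk (p := vermaIdeal m μ) (1 : Ugl m) = _
  rw [← Submodule.Quotient.mk_smul, smul_eq_mul, mul_one]

theorem lie_vac {m : ℕ} (μ : Fin m → ℂ) {a b : Fin m} (hab : a < b) :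
    ⁅(E a b : gl m), vac m μ⁆ = 0 := by
  show UE a b • vac m μ = 0
  rw [smul_vac]
  exact (Submodule.Quotient.mk_eq_zero _).2 (Submodule.subset_span (Or.inl ⟨a, b, hab, rfl⟩))

theorem lie_vac_self {m : ℕ} (μ : Fin m → ℂ) (a : Fin m) :
    ⁅(E a a : gl m), vac m μ⁆ = μ a • vac m μ := by
  show UE a a • vac m μ = μ a • vac m μ
  rw [← sub_eq_zero, ← algebraMap_smul (Ugl m) (μ a), ← sub_smul, smul_vac]
  exact (Submodule.Quotient.mk_eq_zero _).2 (Submodule.subset_span (Or.inr ⟨a, rfl⟩))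

/-- The smallest subspace of `M_μ` that contains the highest weight vector and is stable under the
lowering operators `E_ba`, `a < b`. -/
inductive LowerSpan (m : ℕ) (μ : Fin m → ℂ) : Verma m μ → Prop
  | vac : LowerSpan m μ (vac m μ)
  | add {v w} : LowerSpan m μ v → LowerSpan m μ w → LowerSpan m μ (v + w)
  | smul (c : ℂ) {v} : LowerSpan m μ v → LowerSpan m μ (c • v)
  | lower {a b : Fin m} (hab : a < b) {v} : LowerSpan m μ v → LowerSpan m μ ⁅(E b a : gl m), v⁆

theorem LowerSpan.zero {m : ℕ} {μ : Fin m → ℂ} : LowerSpan m μ 0 := by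
  have := LowerSpan.smul 0 (LowerSpan.vac (μ := μ))
  rwa [zero_smul] at this

/-- The span of the vectors obtained by lowering operators is stable under `gl_m`: on a vector
`E_dc v` with `c < d`, commute `E_ab` past `E_dc` and use the induction hypothesis for the
commutator, whose terms lie in `gl_m` and act on `v`. -/
theorem LowerSpan.lie_E {m : ℕ} {μ : Fin m → ℂ} {v : Verma m μ} (hv : LowerSpan m μ v)
    (a b : Fin m) : LowerSpan m μ ⁅(E a b : gl m), v⁆ := by
  induction hv generalizing a b with
  | vac =>
    rcases lt_trichotomy a b with h | h | h
    · rw [lie_vac μ h]; exact .zero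
    · subst h
      rw [lie_vac_self]; exact .smul _ .vac
    · exact .lower h .vac
  | add _ _ h1 h2 => rw [lie_add]; exact (h1 a b).add (h2 a b)
  | smul c _ h => rw [lie_smul]; exact (h a b).smul c
  | @lower c d hcd v _ h =>
    rw [leibniz_lie, E_lie]
    refine .add ?_ (.lower hcd (h a b))
    rw [sub_lie]
    have hn : ∀ {x : Verma m μ}, LowerSpan m μ x → LowerSpan m μ (-x) := by
      intro x hx
      have := hx.smul (-1)
      rwa [neg_one_smul] at this
    rw [sub_eq_add_neg]
    refine .add ?_ (hn ?_)
    · split_ifs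
      · exact h _ _
      · rw [zero_lie]; exact .zero
    · split_ifs
      · exact h _ _
      · rw [zero_lie]; exact .zero

theorem lowerSpan {m : ℕ} {μ : Fin m → ℂ} (v : Verma m μ) : LowerSpan m μ v := by
  have h : ∀ (u : Ugl m) (v : Verma m μ), LowerSpan m μ v → LowerSpan m μ (u • v) := by
    intro u
    induction u using Ugl_induction with
    | scalar c =>
      intro v hv
      rw [algebraMap_smul]
      exact hv.smul c
    | gen X =>
      intro v hv
      show LowerSpan m μ ⁅X, v⁆
      induction X using Matrix.induction_on' with
      | h_zero => rw [zero_lie]; exact .zero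
      | h_add X Y hX hY => rw [add_lie]; exact hX.add hY
      | h_std_basis a b c =>
        rw [show Matrix.single a b c = c • E a b by simp, smul_lie]
        exact (hv.lie_E a b).smul c
    | add x y hx hy => intro v hv; rw [add_smul]; exact (hx v hv).add (hy v hv)
    | mul x y hx hy => intro v hv; rw [mul_smul]; exact hx _ (hy v hv)
  obtain ⟨u, rfl⟩ := Submodule.Quotient.mk_surjective (vermaIdeal m μ) v
  have := h u _ LowerSpan.vac
  rwa [smul_vac] at this

/-- The universal property of the Verma module: a highest weight vector of weight `μ` in a
`gl_m`-module is the image of `1_μ` under a homomorphism. -/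
theorem exists_verma_map {m : ℕ} {μ : Fin m → ℂ} {W : Type*} [AddCommGroup W] [Module ℂ W]
    {M : Matrix (Fin m) (Fin m) (Module.End ℂ W)} (hM : IsGL M) {w : W}
    (hraise : ∀ a b, b < a → M a b w = 0) (hwt : ∀ a, M a a w = μ a • w) :
    ∃ φ : Verma m μ →ₗ[ℂ] W, φ (vac m μ) = w ∧
      ∀ a b v, φ ⁅(E b a : gl m), v⁆ = M a b (φ v) := by
  let ρ := UniversalEnvelopingAlgebra.lift ℂ hM.rep
  let f : Ugl m →ₗ[ℂ] W := (LinearMap.applyₗ w).comp ρ.toLinearMap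
  have hf : ∀ u, f u = ρ u w := fun u => rfl
  have hUE : ∀ a b, ρ (UE a b) = M b a := by
    intro a b
    rw [UniversalEnvelopingAlgebra.lift_ι_apply, hM.rep_E]
  have hker : (vermaIdeal m μ).restrictScalars ℂ ≤ LinearMap.ker f := by
    intro u hu
    rw [Submodule.restrictScalars_mem] at hu
    rw [LinearMap.mem_ker]
    induction hu using Submodule.span_induction with
    | mem x hx =>
      rcases hx with ⟨a, b, hab, rfl⟩ | ⟨a, rfl⟩
      · rw [hf, hUE, hraise b a hab]
      · rw [hf, map_sub, hUE, AlgHom.commutes, LinearMap.sub_apply, hwt,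
          Module.algebraMap_end_apply, sub_self]
    | zero => exact map_zero f
    | add x y _ _ hx hy => rw [map_add, hx, hy, add_zero]
    | smul u x _ hx =>
      rw [hf, smul_eq_mul, map_mul, Module.End.mul_apply, ← hf x, hx, map_zero]
  let φ : Verma m μ →ₗ[ℂ] W := (((vermaIdeal m μ).restrictScalars ℂ).liftQ f hker).comp
    (Submodule.Quotient.restrictScalarsEquiv ℂ (vermaIdeal m μ)).symm.toLinearMap
  have hφ : ∀ u : Ugl m, φ (Submodule.Quotient.mk (p := vermaIdeal m μ) u) = ρ u w := fun u => rfl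
  refine ⟨φ, ?_, fun a b v => ?_⟩
  · rw [vac, hφ, map_one, Module.End.one_apply]
  · obtain ⟨u, rfl⟩ := Submodule.Quotient.mk_surjective (vermaIdeal m μ) v
    show φ (UE b a • Submodule.Quotient.mk (p := vermaIdeal m μ) u) = _
    rw [← Submodule.Quotient.mk_smul, hφ, hφ, smul_eq_mul, map_mul, hUE, Module.End.mul_apply]

end VermaMaps

/-! ### Coinvariants and the highest weight vector -/

section CoinvariantsOfVerma

/-- The matrix with `ab`-entry the operator `∑_k x_bk ∂_ak` of `E_ba` on `Λ(ℂ^m ⊗ ℂ^n)`. -/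
noncomputable def fockMat (m n : ℕ) : Matrix (Fin m) (Fin m) (Module.End ℂ (Gr (Fin m × Fin n))) :=
  Matrix.of fun a b => ∑ k, mulX (b, k) * del (a, k)

theorem fockMat_isGL (m n : ℕ) : IsGL (fockMat m n) := by
  intro a b c d
  have h : fockMat m n a b * fockMat m n c d - fockMat m n c d * fockMat m n a b
      = ∑ k, ∑ l, ((if (a, k) = (d, l) then mulX (b, k) * del (c, l) else 0)
        - (if (c, l) = (b, k) then mulX (d, l) * del (a, k) else 0)) := by
    simp only [fockMat, Matrix.of_apply, Finset.sum_mul_sum, ← mulX_del_comm,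
      Finset.sum_sub_distrib]
    rw [Finset.sum_comm (f := fun i j => mulX (d, i) * del (c, i) * (mulX (b, j) * del (a, j)))]
  rw [h]
  simp only [Prod.mk.injEq, ite_and, Finset.sum_sub_distrib, fockMat, Matrix.of_apply]
  congr 1
  · by_cases h1 : a = d
    · simp [h1]
    · simp [h1, Ne.symm h1]
  · by_cases h1 : c = b
    · simp [h1]
    · simp [h1, Ne.symm h1]

theorem glAct_tmul {m n : ℕ} (V : Type*) [AddCommGroup V] [Module ℂ V]
    [LieRingModule (gl m) V] [LieModule ℂ (gl m) V] (a b : Fin m) (v : V)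
    (f : Gr (Fin m × Fin n)) :
    glAct m n V (E b a) (v ⊗ₜ f) = ⁅(E b a : gl m), v⁆ ⊗ₜ f + v ⊗ₜ fockMat m n a b f := by
  rw [glAct_E, LinearMap.add_apply, LinearMap.sum_apply, fockMat, Matrix.of_apply,
    LinearMap.sum_apply, TensorProduct.tmul_sum]
  rfl

/-- The map `f ↦ [1_μ ⊗ f]` from `Λ(ℂ^m ⊗ ℂ^n)` to `E_m(M_μ)_𝔫`. -/
noncomputable def vacCoinv (m n : ℕ) (μ : Fin m → ℂ) :
    Gr (Fin m × Fin n) →ₗ[ℂ] Coinv m n (Verma m μ) :=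
  (nSub m n (Verma m μ)).mkQ.comp (TensorProduct.mk ℂ _ _ (vac m μ))

theorem mkQ_glAct {m n : ℕ} (V : Type*) [AddCommGroup V] [Module ℂ V]
    [LieRingModule (gl m) V] [LieModule ℂ (gl m) V] {a b : Fin m} (hab : a < b)
    (x : EMod m n V) : (nSub m n V).mkQ (glAct m n V (E b a) x) = 0 :=
  (Submodule.Quotient.mk_eq_zero _).2 (Submodule.subset_span ⟨a, b, hab, x, rfl⟩)

/-- Lowering operators can be moved from `M_μ` to the Grassmann algebra, up to sign. -/
theorem vacCoinv_surjective (m n : ℕ) (μ : Fin m → ℂ) :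
    Function.Surjective (vacCoinv m n μ) := by
  have h : ∀ (v : Verma m μ) (f : Gr (Fin m × Fin n)),
      (nSub m n (Verma m μ)).mkQ (v ⊗ₜ f) ∈ LinearMap.range (vacCoinv m n μ) := by
    intro v
    induction lowerSpan v with
    | vac => exact fun f => ⟨f, rfl⟩
    | add _ _ h1 h2 =>
      intro f
      rw [TensorProduct.add_tmul, map_add]
      exact add_mem (h1 f) (h2 f)
    | smul c _ h =>
      intro f
      rw [← TensorProduct.smul_tmul', map_smul]
      exact Submodule.smul_mem _ c (h f)
    | @lower a b hab v _ h =>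
      intro f
      have e := mkQ_glAct (n := n) (Verma m μ) hab (v ⊗ₜ f)
      rw [glAct_tmul, map_add] at e
      rw [eq_neg_of_add_eq_zero_left e]
      exact neg_mem (h _)
  intro x
  obtain ⟨x, rfl⟩ := Submodule.mkQ_surjective _ x
  rw [← LinearMap.mem_range]
  induction x using TensorProduct.induction_on with
  | zero => rw [map_zero]; exact zero_mem _
  | tmul v f => exact h v f
  | add x y hx hy => rw [map_add]; exact add_mem hx hy

/-- The left inverse sends `[v ⊗ f]` to `ψ(v) f`, where `ψ : M_μ → End Λ(ℂ^m ⊗ ℂ^n)` comes from the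
universal property in `exists_verma_realization`. -/
theorem vacCoinv_injective (m n : ℕ) (μ : Fin m → ℂ) :
    Function.Injective (vacCoinv m n μ) := by
  obtain ⟨W, _, _, M, w, hM, hraise, hwt, huniv⟩ := exists_verma_realization m μ
  obtain ⟨ψ, hψ1, hψ⟩ := huniv (Module.End ℂ (Gr (Fin m × Fin n))) (fockMat m n) (fockMat_isGL m n)
  obtain ⟨φ, hφ1, hφ⟩ := exists_verma_map (μ := μ) hM hraise hwt
  let Ψ : EMod m n (Verma m μ) →ₗ[ℂ] Gr (Fin m × Fin n) := TensorProduct.lift (ψ.comp φ)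
  have hΨ : ∀ v f, Ψ (v ⊗ₜ f) = ψ (φ v) f := fun v f => rfl
  have hker : nSub m n (Verma m μ) ≤ LinearMap.ker Ψ := by
    refine Submodule.span_le.2 ?_
    rintro _ ⟨a, b, hab, x, rfl⟩
    rw [SetLike.mem_coe, LinearMap.mem_ker]
    induction x using TensorProduct.induction_on with
    | zero => simp only [map_zero]
    | add x y hx hy => rw [map_add, map_add, hx, hy, add_zero]
    | tmul v f =>
      rw [glAct_tmul, map_add, hΨ, hΨ, hφ, hψ a b hab, LinearMap.neg_apply,
        Module.End.mul_apply, neg_add_cancel]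
  refine Function.LeftInverse.injective (g := (nSub m n (Verma m μ)).liftQ Ψ hker) fun f => ?_
  show Ψ (vac m μ ⊗ₜ f) = f
  rw [hΨ, hφ1, hψ1, Module.End.one_apply]

theorem vacCoinv_bijective (m n : ℕ) (μ : Fin m → ℂ) : Function.Bijective (vacCoinv m n μ) :=
  ⟨vacCoinv_injective m n μ, vacCoinv_surjective m n μ⟩

theorem coinvH_vacCoinv (m n : ℕ) (μ d : Fin m → ℂ) (f : Gr (Fin m × Fin n)) :
    coinvH m n (Verma m μ) d (vacCoinv m n μ f)
      = vacCoinv m n μ (∑ a, d a • (μ a • f + ∑ k, mulX (a, k) (del (a, k) f))) := by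
  have h : Matrix.diagonal d = ∑ a, d a • (E a a : gl m) := by
    rw [← Matrix.sum_single_eq_diagonal]
    simp
  show (nSub m n (Verma m μ)).mkQ (glAct m n (Verma m μ) (Matrix.diagonal d) (vac m μ ⊗ₜ f))
    = (nSub m n (Verma m μ)).mkQ (vac m μ ⊗ₜ _)
  congr 1
  rw [h, map_sum, LinearMap.sum_apply, TensorProduct.tmul_sum]
  refine Finset.sum_congr rfl fun a _ => ?_
  rw [map_smul, LinearMap.smul_apply, glAct_tmul, lie_vac_self, TensorProduct.tmul_smul,
    TensorProduct.tmul_add, TensorProduct.tmul_smul, TensorProduct.smul_tmul']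
  simp [fockMat]

/-- The map `f ↦ [(M^s)_ab 1_μ ⊗ f]`, where `M` is the matrix with `ab`-entry `E_ba`. -/
noncomputable def powEntry (m n : ℕ) (μ : Fin m → ℂ) (s : ℕ) (a b : Fin m) :
    Gr (Fin m × Fin n) →ₗ[ℂ] Coinv m n (Verma m μ) :=
  (nSub m n (Verma m μ)).mkQ.comp
    (((Emat m n (Verma m μ) ^ s) a b).comp (TensorProduct.mk ℂ _ _ (vac m μ)))

theorem powEntry_zero (m n : ℕ) (μ : Fin m → ℂ) (a b : Fin m) :
    powEntry m n μ 0 a b = if a = b then vacCoinv m n μ else 0 := by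
  refine LinearMap.ext fun f => ?_
  simp only [powEntry, pow_zero, Matrix.one_apply]
  split_ifs <;> simp [vacCoinv]

/-- The recursion that results from `M^{s+1} = M^s M` by evaluating the last factor `M_cb = E_bc`: it
kills `1_μ` for `b < c`, acts as `μ_b` for `c = b`, and lies in `𝔫` for `c < b`, in which case it is
moved to the left of `(M^s)_ac` and then to the Grassmann algebra. The shift of `μ_b` by the number
of indices `c < b` comes from the commutators. -/
theorem powEntry_succ (m n : ℕ) (μ : Fin m → ℂ) (s : ℕ) (a b : Fin m)
    (f : Gr (Fin m × Fin n)) :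
    powEntry m n μ (s + 1) a b f
      = (μ b - ((b : ℕ) : ℂ)) • powEntry m n μ s a b f
        + ∑ c ∈ Finset.Iio b, ((if a = b then powEntry m n μ s c c f else 0)
          - powEntry m n μ s a c (fockMat m n c b f)) := by
  set V := Verma m μ
  set M := Emat m n V with hMdef
  have hM : IsGL M := Emat_isGL m n V
  set x : EMod m n V := vac m μ ⊗ₜ f with hx
  have hg : ∀ s a b, powEntry m n μ s a b f = (nSub m n V).mkQ ((M ^ s) a b x) := fun _ _ _ => rfl
  have hup : ∀ c, b < c → M c b x = 0 := by
    intro c hc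
    show ⁅(E b c : gl m), vac m μ⁆ ⊗ₜ[ℂ] f = 0
    rw [lie_vac μ hc, TensorProduct.zero_tmul]
  have hself : M b b x = μ b • x := by
    show ⁅(E b b : gl m), vac m μ⁆ ⊗ₜ[ℂ] f = _
    rw [lie_vac_self, TensorProduct.smul_tmul']
  have hlow : ∀ c, c < b → (nSub m n V).mkQ ((M ^ s) a c (M c b x))
      = (if a = b then powEntry m n μ s c c f else 0) - powEntry m n μ s a b f
        - powEntry m n μ s a c (fockMat m n c b f) := by
    intro c hc
    have h1 := LinearMap.congr_fun (hM.pow_comm s c b a c) x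
    rw [if_pos rfl] at h1
    have h2 := mkQ_glAct (n := n) V hc ((M ^ s) a c x)
    rw [glAct_E, LinearMap.add_apply, map_add] at h2
    have h3 : (∑ k, xOp V (b, k) * dOp V (c, k)) ((M ^ s) a c x)
        = (M ^ s) a c (vac m μ ⊗ₜ fockMat m n c b f) := by
      have hc : Commute ((M ^ s) a c) (∑ k, xOp V (b, k) * dOp V (c, k)) :=
        Commute.sum_right _ _ _ fun k _ =>
          (commute_pow_entry (fun _ _ => commute_rTensor_lTensor _ _) s a c).mul_right
            (commute_pow_entry (fun _ _ => commute_rTensor_lTensor _ _) s a c)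
      rw [← Module.End.mul_apply, ← hc.eq, Module.End.mul_apply]
      congr 1
      rw [fockMat, Matrix.of_apply, LinearMap.sum_apply, LinearMap.sum_apply,
        TensorProduct.tmul_sum]
      rfl
    have h4 : (nSub m n V).mkQ ((M ^ s) a c (vac m μ ⊗ₜ fockMat m n c b f))
      = powEntry m n μ s a c (fockMat m n c b f) := rfl
    rw [h3, h4] at h2
    have h5 := congrArg (nSub m n V).mkQ h1
    rw [LinearMap.sub_apply, LinearMap.sub_apply, map_sub, map_sub, Module.End.mul_apply,
      Module.End.mul_apply] at h5
    have h6 : (nSub m n V).mkQ ((if b = a then (M ^ s) c c else 0) x)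
        = if a = b then powEntry m n μ s c c f else 0 := by
      rw [hg, if_congr (eq_comm (a := a)) rfl rfl]
      split_ifs <;> simp
    rw [h6, ← hg] at h5
    rw [sub_eq_iff_eq_add] at h5
    rw [h5] at h2
    refine sub_eq_zero.1 (Eq.trans ?_ h2)
    abel
  rw [hg, pow_succ, Matrix.mul_apply, LinearMap.sum_apply, map_sum]
  have hF : ∀ c, (nSub m n V).mkQ (((M ^ s) a c * M c b) x)
      = (if c < b then ((if a = b then powEntry m n μ s c c f else 0)
          - powEntry m n μ s a c (fockMat m n c b f)) - powEntry m n μ s a b f else 0)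
        + if c = b then μ b • powEntry m n μ s a b f else 0 := by
    intro c
    rw [Module.End.mul_apply]
    rcases lt_trichotomy c b with h | h | h
    · rw [if_pos h, if_neg h.ne, hlow c h]
      abel
    · subst h
      rw [hself, if_neg (lt_irrefl _), if_pos rfl, map_smul, map_smul, zero_add, hg]
    · rw [if_neg h.not_gt, if_neg h.ne', hup c h, map_zero, map_zero, add_zero]
  rw [Finset.sum_congr rfl fun c _ => hF c, Finset.sum_add_distrib, Finset.sum_ite_eq',
    if_pos (Finset.mem_univ _), ← Finset.sum_filter, Finset.sum_sub_distrib, Finset.sum_const,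
    show Finset.univ.filter (· < b) = Finset.Iio b by ext; simp, Fin.card_Iio,
    ← Nat.cast_smul_eq_nsmul ℂ, sub_smul]
  abel

end CoinvariantsOfVerma

/-! ### Products of evaluation matrices -/

section Fusion

/-- The matrices `Y_b^s` with `Y_b^0 = L_b` and `Y_b^{s+1} = ρ_b Y_b^s + ∑_{c < b} Y_c^s L_b`. By
`coeff_prod_eq_sum_fusion`, they are the coefficients of the product of the matrices
`1 + L_b / (u - ρ_b)`. -/
noncomputable def fusion {m n : ℕ} {A : Type*} [Ring A] [Algebra ℂ A] (ρ : Fin m → ℂ)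
    (L : Fin m → Matrix (Fin n) (Fin n) A) : ℕ → Fin m → Matrix (Fin n) (Fin n) A
  | 0, b => L b
  | s + 1, b => ρ b • fusion ρ L s b + ∑ c ∈ Finset.Iio b, fusion ρ L s c * L b

theorem fusion_castSucc {m n : ℕ} {A : Type*} [Ring A] [Algebra ℂ A] (ρ : Fin (m + 1) → ℂ)
    (L : Fin (m + 1) → Matrix (Fin n) (Fin n) A) (s : ℕ) (b : Fin m) :
    fusion ρ L s b.castSucc = fusion (fun a => ρ a.castSucc) (fun a => L a.castSucc) s b := by
  induction s generalizing b with
  | zero => rfl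
  | succ s ih =>
    rw [fusion, fusion, ih]
    congr 1
    rw [← Fin.map_castSuccEmb_Iio, Finset.sum_map]
    exact Finset.sum_congr rfl fun c _ => by rw [Fin.coe_castSuccEmb, ih]

/-- A map that intertwines the entries of the `L_b` intertwines those of the `Y_b^s`. -/
theorem fusion_intertwine {m n : ℕ} {M N : Type*} [AddCommGroup M] [Module ℂ M]
    [AddCommGroup N] [Module ℂ N] (Φ : M →ₗ[ℂ] N) (ρ : Fin m → ℂ)
    {L : Fin m → Matrix (Fin n) (Fin n) (Module.End ℂ M)}
    {L' : Fin m → Matrix (Fin n) (Fin n) (Module.End ℂ N)}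
    (h : ∀ b i j f, Φ (L b i j f) = L' b i j (Φ f)) (s : ℕ) (b : Fin m) (i j : Fin n) (f : M) :
    Φ (fusion ρ L s b i j f) = fusion ρ L' s b i j (Φ f) := by
  induction s generalizing b i j f with
  | zero => exact h b i j f
  | succ s ih =>
    simp only [fusion, Matrix.add_apply, Matrix.smul_apply, Matrix.sum_apply, Matrix.mul_apply,
      LinearMap.add_apply, LinearMap.smul_apply, LinearMap.sum_apply, Module.End.mul_apply,
      map_add, map_smul, map_sum, ih, h]

/-- If `S_b` is the expansion of `1 + L_b / (u - ρ_b)` in powers of `u⁻¹`, then the coefficient of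
`S_1 S_2 ⋯ S_m` at `u^{-s-1}` is `∑_b Y_b^s`. -/
theorem coeff_prod_eq_sum_fusion {m n : ℕ} {A : Type*} [Ring A] [Algebra ℂ A] (ρ : Fin m → ℂ)
    (L : Fin m → Matrix (Fin n) (Fin n) A)
    (S : Fin m → Matrix (Fin n) (Fin n) (PowerSeries A))
    (h0 : ∀ b i j, PowerSeries.coeff 0 (S b i j) = if i = j then 1 else 0)
    (hS : ∀ b s i j, PowerSeries.coeff (s + 1) (S b i j) = ρ b ^ s • L b i j) (i j : Fin n) :
    PowerSeries.coeff 0 ((List.ofFn S).prod i j) = (if i = j then 1 else 0) ∧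
    ∀ s, PowerSeries.coeff (s + 1) ((List.ofFn S).prod i j) = ∑ b, fusion ρ L s b i j := by
  induction m generalizing i j with
  | zero =>
    rw [List.ofFn_zero, List.prod_nil, Matrix.one_apply]
    refine ⟨by split_ifs <;> simp, fun s => ?_⟩
    split_ifs <;> simp [PowerSeries.coeff_one]
  | succ m ih =>
    set P := (List.ofFn fun a : Fin m => S a.castSucc).prod with hP
    have ih0 := fun i j => (ih (fun a => ρ a.castSucc) (fun a => L a.castSucc)
      (fun a => S a.castSucc) (fun b => h0 _) (fun b => hS _) i j).1
    have ih1 := fun i j => (ih (fun a => ρ a.castSucc) (fun a => L a.castSucc)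
      (fun a => S a.castSucc) (fun b => h0 _) (fun b => hS _) i j).2
    rw [← hP] at ih0 ih1
    have e : (List.ofFn S).prod = P * S (Fin.last m) := by
      rw [List.ofFn_succ', List.concat_eq_append, List.prod_append, List.prod_singleton]
    let r := ρ (Fin.last m)
    -- the coefficient at `u^{-s-1}` of `P(u) L / (u - r)`
    let R : ℕ → Fin n → Fin n → A := fun s i j =>
      ∑ k, (∑ p ∈ Finset.HasAntidiagonal.antidiagonal s, r ^ p.2 • PowerSeries.coeff p.1 (P i k)) *
        L (Fin.last m) k j
    have hcoeff : ∀ s i j, PowerSeries.coeff (s + 1) ((P * S (Fin.last m)) i j)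
        = PowerSeries.coeff (s + 1) (P i j) + R s i j := by
      intro s i j
      have h1 : ∀ k, PowerSeries.coeff (s + 1) (P i k * S (Fin.last m) k j)
          = (if k = j then PowerSeries.coeff (s + 1) (P i k) else 0)
            + (∑ p ∈ Finset.HasAntidiagonal.antidiagonal s, r ^ p.2 • PowerSeries.coeff p.1 (P i k)) *
              L (Fin.last m) k j := by
        intro k
        rw [PowerSeries.coeff_mul, Finset.Nat.sum_antidiagonal_succ', h0, mul_ite, mul_one,
          mul_zero, Finset.sum_mul]
        congr 1
        refine Finset.sum_congr rfl fun p _ => ?_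
        rw [hS, mul_smul_comm, smul_mul_assoc]
      rw [Matrix.mul_apply, map_sum, Finset.sum_congr rfl fun k _ => h1 k, Finset.sum_add_distrib,
        Finset.sum_ite_eq', if_pos (Finset.mem_univ _)]
    have hR : ∀ s i j, R s i j = fusion ρ L s (Fin.last m) i j := by
      intro s
      induction s with
      | zero =>
        intro i j
        simp only [R, Finset.Nat.antidiagonal_zero, Finset.sum_singleton, pow_zero, one_smul, ih0,
          ite_mul, one_mul, zero_mul, Finset.sum_ite_eq, Finset.mem_univ, if_true, fusion]
      | succ s ihs =>
        intro i j
        have h2 : R (s + 1) i j = r • R s i j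
            + ∑ k, PowerSeries.coeff (s + 1) (P i k) * L (Fin.last m) k j := by
          simp only [R, Finset.smul_sum, ← Finset.sum_add_distrib]
          refine Finset.sum_congr rfl fun k _ => ?_
          rw [Finset.Nat.sum_antidiagonal_succ', pow_zero, one_smul, add_mul, ← smul_mul_assoc,
            add_comm, Finset.smul_sum]
          simp only [pow_succ', mul_smul]
        rw [h2, ihs]
        simp only [fusion, Matrix.add_apply, Matrix.smul_apply, Matrix.sum_apply, Matrix.mul_apply,
          ih1, Finset.sum_mul]
        congr 1
        rw [Finset.sum_comm]
        have : Finset.Iio (Fin.last m) = Finset.univ.map Fin.castSuccEmb := by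
          ext c
          induction c using Fin.lastCases with
          | last => simp
          | cast c => simp
        rw [this, Finset.sum_map]
        exact Finset.sum_congr rfl fun c _ => Finset.sum_congr rfl fun k _ => by
          rw [Fin.coe_castSuccEmb, fusion_castSucc]
    rw [e]
    refine ⟨?_, fun s => ?_⟩
    · have hm : ∀ f g : PowerSeries A, PowerSeries.coeff 0 (f * g)
          = PowerSeries.coeff 0 f * PowerSeries.coeff 0 g := by
        intro f g; simp [PowerSeries.coeff_zero_eq_constantCoeff]
      rw [Matrix.mul_apply, map_sum]
      simp only [hm, h0, ih0]
      simp
    · rw [hcoeff, hR, ih1, Fin.sum_univ_castSucc]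
      congr 1
      exact Finset.sum_congr rfl fun c _ => by rw [fusion_castSucc]

end Fusion

/-! ### The action of the Yangian on the coinvariants -/

section YangianOnCoinvariants

/-- The vector `∑_a [(M^s)_ab 1_μ ⊗ x_ai ∂_bj f]`, the contribution of the `b`-th column of `M^s` to
the action of `T_ij^{(s+1)}` on `[1_μ ⊗ f]`. -/
noncomputable def powColumn (m n : ℕ) (μ : Fin m → ℂ) (s : ℕ) (b : Fin m) (i j : Fin n)
    (f : Gr (Fin m × Fin n)) : Coinv m n (Verma m μ) :=
  ∑ a, powEntry m n μ s a b (mulX (a, i) (del (b, j) f))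

/-- The matrix `L_b` with entries `x_bi ∂_bj`. -/
noncomputable def rowOp (m n : ℕ) (b : Fin m) :
    Matrix (Fin n) (Fin n) (Module.End ℂ (Gr (Fin m × Fin n))) :=
  Matrix.of fun i j => mulX (b, i) * del (b, j)

/-- The first term on the right-hand side cancels the trace terms `(M^s)_cc` in `powEntry_succ`. -/
theorem fockMat_mulX_del {m n : ℕ} {a b c : Fin m} (hcb : c ≠ b) (i j : Fin n)
    (f : Gr (Fin m × Fin n)) :
    fockMat m n c b (mulX (a, i) (del (b, j) f))
      = (if a = c then mulX (b, i) (del (b, j) f) else 0)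
        - ∑ k, mulX (a, i) (del (c, k) (mulX (b, k) (del (b, j) f))) := by
  have h1 : ∀ k, (mulX (b, k) * del (c, k)) * (mulX (a, i) * del (b, j))
      = (if (c, k) = (a, i) then mulX (b, k) * del (b, j) else 0)
        - mulX (a, i) * (del (c, k) * (mulX (b, k) * del (b, j))) := by
    intro k
    have h2 := del_mulX (c, k) (a, i)
    have h3 := mulX_mulX (b, k) (a, i)
    have h4 := del_mulX (c, k) (b, k)
    have h5 : (if (c, k) = (a, i) then mulX (b, k) * del (b, j) else 0)
        = mulX (b, k) * (if (c, k) = (a, i) then 1 else 0) * del (b, j) := by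
      split_ifs <;> simp
    rw [if_neg (fun h => hcb (congrArg Prod.fst h))] at h4
    rw [h5]
    linear_combination (norm := noncomm_ring) mulX (b, k) * h2 * del (b, j)
      - h3 * del (c, k) * del (b, j) + mulX (a, i) * h4 * del (b, j)
  have h6 := LinearMap.congr_fun (Finset.sum_congr rfl fun k (_ : k ∈ Finset.univ) => h1 k) f
  simp only [Prod.mk.injEq, ite_and, Finset.sum_sub_distrib, LinearMap.sub_apply,
    LinearMap.sum_apply, Module.End.mul_apply] at h6
  rw [fockMat, Matrix.of_apply, LinearMap.sum_apply]
  simp only [Module.End.mul_apply]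
  rw [h6]
  congr 1
  by_cases h : a = c
  · subst h
    rw [if_pos rfl, Finset.sum_eq_single i]
    · simp
    · intro k _ hk; simp [hk]
    · simp
  · simp [h, Ne.symm h]

theorem powColumn_eq (m n : ℕ) (μ : Fin m → ℂ) (s : ℕ) (b : Fin m) (i j : Fin n)
    (f : Gr (Fin m × Fin n)) :
    powColumn m n μ s b i j f
      = vacCoinv m n μ (fusion (fun a => μ a - ((a : ℕ) : ℂ)) (rowOp m n) s b i j f) := by
  induction s generalizing b i j f with
  | zero =>
    simp only [powColumn, powEntry_zero, fusion]
    rw [Finset.sum_eq_single b]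
    · rw [if_pos rfl]; rfl
    · intro a _ ha; rw [if_neg ha]; rfl
    · simp
  | succ s ih =>
    have h : powColumn m n μ (s + 1) b i j f = (μ b - ((b : ℕ) : ℂ)) • powColumn m n μ s b i j f
        + ∑ c ∈ Finset.Iio b, ∑ k, powColumn m n μ s c i k (mulX (b, k) (del (b, j) f)) := by
      simp only [powColumn, powEntry_succ, Finset.sum_add_distrib, Finset.smul_sum]
      congr 1
      rw [Finset.sum_comm]
      refine Finset.sum_congr rfl fun c hc => ?_
      have hcb : c ≠ b := (Finset.mem_Iio.1 hc).ne
      simp only [fockMat_mulX_del hcb, map_sub, map_sum, Finset.sum_sub_distrib]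
      rw [Finset.sum_comm (f := fun k a => powEntry m n μ s a c _)]
      rw [Finset.sum_ite_eq' , if_pos (Finset.mem_univ _), Finset.sum_eq_single c]
      · simp
      · intro a _ ha; rw [if_neg ha, map_zero]
      · simp
    rw [h, ih]
    simp only [ih, fusion, Matrix.add_apply, Matrix.smul_apply, Matrix.sum_apply,
      Matrix.mul_apply, LinearMap.add_apply, LinearMap.smul_apply, LinearMap.sum_apply,
      Module.End.mul_apply, map_add, map_smul, map_sum]
    rfl

theorem coinvY_vacCoinv (m n : ℕ) (μ : Fin m → ℂ) (s : ℕ) (i j : Fin n)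
    (f : Gr (Fin m × Fin n)) :
    coinvY m n (Verma m μ) (T n (s + 1) i j) (vacCoinv m n μ f)
      = vacCoinv m n μ (∑ b, fusion (fun a => μ a - ((a : ℕ) : ℂ)) (rowOp m n) s b i j f) := by
  rw [map_sum]
  simp only [← powColumn_eq]
  show (nSub m n (Verma m μ)).mkQ (yAct m n (Verma m μ) (T n (s + 1) i j) (vac m μ ⊗ₜ f)) = _
  rw [yAct, Yangian.lift_T]
  simp only [howeT, LinearMap.sum_apply, map_sum, powColumn]
  rw [Finset.sum_comm]
  rfl

end YangianOnCoinvariants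

/-! ### The exterior algebra as a tensor product -/

section Factorization

/-- The operator `x_p ∂_q` is a derivation. -/
theorem mulX_del_leibniz {ι : Type} [DecidableEq ι] (p q : ι) (f g : Gr ι) :
    mulX p (del q (f * g)) = mulX p (del q f) * g + f * mulX p (del q g) := by
  induction f using ExteriorAlgebra.induction generalizing g with
  | algebraMap r =>
    have h : del q (algebraMap ℂ (Gr ι) r) = 0 :=
      CliffordAlgebra.contractLeft_algebraMap (Q := (0 : QuadraticForm ℂ (ι → ℂ))) _ r
    rw [h, map_zero, zero_mul, zero_add, ← Algebra.smul_def, map_smul, map_smul, Algebra.smul_def]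
  | ι v =>
    have h : ∀ g : Gr ι, del q (ExteriorAlgebra.ι ℂ v * g)
        = v q • g - ExteriorAlgebra.ι ℂ v * del q g := fun g =>
      CliffordAlgebra.contractLeft_ι_mul (Q := (0 : QuadraticForm ℂ (ι → ℂ))) _ v g
    have h1 : del q (1 : Gr ι) = 0 :=
      CliffordAlgebra.contractLeft_one (Q := (0 : QuadraticForm ℂ (ι → ℂ))) _
    have h' := h 1
    rw [h1, mul_zero, sub_zero, mul_one] at h'
    have hx := ExteriorAlgebra.ι_add_mul_swap (R := ℂ) (Pi.single p (1 : ℂ)) v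
    rw [h, h']
    simp only [mulX, LinearMap.mulLeft_apply, mul_sub, mul_smul_comm, smul_mul_assoc, mul_one,
      ← mul_assoc, eq_neg_of_add_eq_zero_left hx, neg_mul, sub_neg_eq_add]
  | mul a b ha hb => rw [mul_assoc, ha, hb, ha]; noncomm_ring
  | add a b ha hb => rw [add_mul, map_add, map_add, ha, hb, map_add, map_add]; noncomm_ring

theorem mulX_del_one {ι : Type} [DecidableEq ι] (p q : ι) : mulX p (del q (1 : Gr ι)) = 0 := by
  have h1 : del q (1 : Gr ι) = 0 :=
    CliffordAlgebra.contractLeft_one (Q := (0 : QuadraticForm ℂ (ι → ℂ))) _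
  rw [h1, map_zero]

theorem mulX_del_ι {ι : Type} [DecidableEq ι] (p q : ι) (v : ι → ℂ) :
    mulX p (del q (ExteriorAlgebra.ι ℂ v))
      = v q • ExteriorAlgebra.ι ℂ (Pi.single p (1 : ℂ)) := by
  have h : del q (ExteriorAlgebra.ι ℂ v) = algebraMap ℂ (Gr ι) (v q) :=
    CliffordAlgebra.contractLeft_ι (Q := (0 : QuadraticForm ℂ (ι → ℂ))) _ v
  rw [h, mulX, LinearMap.mulLeft_apply, ← Algebra.commutes, Algebra.smul_def]

theorem leibniz_prod_ofFn_eq_zero {A : Type*} [Ring A] (D : A → A)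
    (hD : ∀ f g, D (f * g) = D f * g + f * D g) (hD1 : D 1 = 0) {m : ℕ} (g : Fin m → A)
    (hg : ∀ b, D (g b) = 0) : D (List.ofFn g).prod = 0 := by
  induction m with
  | zero => rw [List.ofFn_zero, List.prod_nil, hD1]
  | succ m ih =>
    rw [List.ofFn_succ, List.prod_cons, hD, hg, ih _ fun b => hg _, zero_mul, mul_zero, add_zero]

/-- A derivation that kills all factors of a product but one acts on that factor only. -/
theorem leibniz_prod_ofFn {A : Type*} [Ring A] (D : A → A)
    (hD : ∀ f g, D (f * g) = D f * g + f * D g) (hD1 : D 1 = 0) {m : ℕ} (g : Fin m → A)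
    (a : Fin m) (hg : ∀ b, b ≠ a → D (g b) = 0) :
    D (List.ofFn g).prod = (List.ofFn (Function.update g a (D (g a)))).prod := by
  induction m with
  | zero => exact a.elim0
  | succ m ih =>
    rw [List.ofFn_succ, List.ofFn_succ, List.prod_cons, List.prod_cons, hD]
    induction a using Fin.cases with
    | zero =>
      rw [leibniz_prod_ofFn_eq_zero D hD hD1 _ fun b => hg _ (Fin.succ_ne_zero b), mul_zero,
        add_zero, Function.update_self]
      simp only [Function.update_of_ne (Fin.succ_ne_zero _)]
    | succ a =>
      rw [hg 0 (Fin.succ_ne_zero a).symm, zero_mul, zero_add,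
        Function.update_of_ne (Fin.succ_ne_zero a).symm,
        ih (fun b => g b.succ) a fun b hb => hg _ fun h => hb (Fin.succ_injective _ h)]
      congr 4
      exact (Function.update_comp_eq_of_injective g (Fin.succ_injective _) a _).symm

/-- An element that commutes with the factors up to a twist is moved to the `a`-th place. -/
theorem mul_prod_ofFn {A : Type*} [Ring A] {m : ℕ} (z : A) (g g' : Fin m → A)
    (h : ∀ b, z * g b = g' b * z) (a : Fin m) :
    z * (List.ofFn g).prod
      = (List.ofFn fun b => if b < a then g' b else if b = a then z * g b else g b).prod := by
  induction m with
  | zero => exact a.elim0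
  | succ m ih =>
    rw [List.ofFn_succ, List.ofFn_succ, List.prod_cons, List.prod_cons]
    induction a using Fin.cases with
    | zero => simp [mul_assoc, Fin.succ_ne_zero]
    | succ a =>
      rw [← mul_assoc, h, mul_assoc, ih (fun b => g b.succ) (fun b => g' b.succ) (fun b => h _) a]
      simp [Fin.succ_pos]

/-- The embedding of `ℂ^n` as the `a`-th row of `ℂ^m ⊗ ℂ^n`. -/
def rowIncl (m n : ℕ) (a : Fin m) : (Fin n → ℂ) →ₗ[ℂ] (Fin m × Fin n → ℂ) where
  toFun v p := if p.1 = a then v p.2 else 0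
  map_add' v w := by ext p; simp only [Pi.add_apply]; split_ifs <;> simp
  map_smul' c v := by ext p; simp

theorem rowIncl_single (m n : ℕ) (a : Fin m) (i : Fin n) :
    rowIncl m n a (Pi.single i 1) = Pi.single (a, i) 1 := by
  ext ⟨b, j⟩
  simp only [rowIncl, LinearMap.coe_mk, AddHom.coe_mk, Pi.single_apply, Prod.mk.injEq, ite_and]

/-- The embedding of `Λ(ℂ^n)` into `Λ(ℂ^m ⊗ ℂ^n)` with `x_i ↦ x_ai`. -/
noncomputable def grIncl (m n : ℕ) (a : Fin m) : Gr (Fin n) →ₐ[ℂ] Gr (Fin m × Fin n) :=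
  ExteriorAlgebra.map (rowIncl m n a)

theorem mulX_del_grIncl (m n : ℕ) (a : Fin m) (i j : Fin n) (f : Gr (Fin n)) :
    mulX (a, i) (del (a, j) (grIncl m n a f)) = grIncl m n a (mulX i (del j f)) := by
  induction f using ExteriorAlgebra.induction with
  | algebraMap r =>
    rw [AlgHom.commutes]
    simp only [Algebra.algebraMap_eq_smul_one, map_smul, mulX_del_one, smul_zero, map_zero]
  | ι v =>
    rw [grIncl, ExteriorAlgebra.map_apply_ι, mulX_del_ι, mulX_del_ι, map_smul,
      ExteriorAlgebra.map_apply_ι, rowIncl_single]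
    simp [rowIncl]
  | mul f g hf hg =>
    rw [map_mul, mulX_del_leibniz, hf, hg, mulX_del_leibniz, map_add, map_mul, map_mul]
  | add f g hf hg => simp only [map_add, hf, hg]

theorem mulX_del_grIncl_of_ne {m n : ℕ} {a b : Fin m} (hab : b ≠ a) (i j : Fin n)
    (f : Gr (Fin n)) : mulX (a, i) (del (a, j) (grIncl m n b f)) = 0 := by
  induction f using ExteriorAlgebra.induction with
  | algebraMap r =>
    rw [AlgHom.commutes]
    simp only [Algebra.algebraMap_eq_smul_one, map_smul, mulX_del_one, smul_zero]
  | ι v =>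
    rw [grIncl, ExteriorAlgebra.map_apply_ι, mulX_del_ι]
    simp [rowIncl, hab.symm]
  | mul f g hf hg => rw [map_mul, mulX_del_leibniz, hf, hg, zero_mul, mul_zero, add_zero]
  | add f g hf hg => simp only [map_add, hf, hg, add_zero]

theorem ι_mul_grIncl {m n : ℕ} (b : Fin m) (v : Fin m × Fin n → ℂ) (f : Gr (Fin n)) :
    ExteriorAlgebra.ι ℂ v * grIncl m n b f
      = grIncl m n b (CliffordAlgebra.involute f) * ExteriorAlgebra.ι ℂ v := by
  induction f using ExteriorAlgebra.induction with
  | algebraMap r =>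
    rw [AlgHom.commutes, AlgHom.commutes, AlgHom.commutes, Algebra.commutes]
  | ι w =>
    have h : CliffordAlgebra.involute (ExteriorAlgebra.ι ℂ w) = -ExteriorAlgebra.ι ℂ w :=
      CliffordAlgebra.involute_ι w
    rw [h, map_neg, grIncl, ExteriorAlgebra.map_apply_ι, neg_mul]
    exact eq_neg_of_add_eq_zero_left (ExteriorAlgebra.ι_add_mul_swap _ _)
  | mul f g hf hg => rw [map_mul, ← mul_assoc, hf, mul_assoc, hg, map_mul, map_mul, mul_assoc]
  | add f g hf hg => simp only [map_add, mul_add, add_mul, hf, hg]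

/-- The map `f_1 ⊗ ⋯ ⊗ f_m ↦ f_1 ⋯ f_m`, where `f_a` is regarded as an element of
`Λ(ℂ^m ⊗ ℂ^n)` in the variables of the `a`-th row. -/
noncomputable def tensorToGr (m n : ℕ) :
    (⨂[ℂ] _ : Fin m, Gr (Fin n)) →ₗ[ℂ] Gr (Fin m × Fin n) :=
  PiTensorProduct.lift ((MultilinearMap.mkPiAlgebraFin ℂ m (Gr (Fin m × Fin n))).compLinearMap
    fun a => (grIncl m n a).toLinearMap)

theorem tensorToGr_tprod (m n : ℕ) (f : Fin m → Gr (Fin n)) :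
    tensorToGr m n (PiTensorProduct.tprod ℂ f)
      = (List.ofFn fun a => grIncl m n a (f a)).prod := by
  rw [tensorToGr, PiTensorProduct.lift.tprod]
  rfl

theorem slot_tprod {m : ℕ} {X : Fin m → Type*} [∀ a, AddCommGroup (X a)]
    [∀ a, Module ℂ (X a)] (a : Fin m) (f : Module.End ℂ (X a)) (v : ∀ a, X a) :
    slot a f (PiTensorProduct.tprod ℂ v)
      = PiTensorProduct.tprod ℂ (Function.update v a (f (v a))) := by
  rw [slot, PiTensorProduct.map_tprod]
  congr 1
  funext b
  by_cases h : b = a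
  · subst h; simp
  · simp [h]

theorem tensorToGr_slot (m n : ℕ) (a : Fin m) (i j : Fin n) (t : ⨂[ℂ] _ : Fin m, Gr (Fin n)) :
    tensorToGr m n (slot a (mulX i * del j) t) = mulX (a, i) (del (a, j) (tensorToGr m n t)) := by
  induction t using PiTensorProduct.induction_on with
  | smul_tprod r f =>
    rw [map_smul, map_smul, map_smul, map_smul, map_smul, slot_tprod, tensorToGr_tprod,
      tensorToGr_tprod,
      leibniz_prod_ofFn (fun x => mulX (a, i) (del (a, j) x)) (mulX_del_leibniz _ _)
        (mulX_del_one _ _) _ a fun b hb => mulX_del_grIncl_of_ne hb i j _]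
    congr 4
    funext b
    by_cases h : b = a
    · subst h
      rw [Function.update_self, Function.update_self, mulX_del_grIncl]
      rfl
    · rw [Function.update_of_ne h, Function.update_of_ne h]
  | add x y hx hy => simp only [map_add, hx, hy]

/-- The image contains `1` and is stable under multiplication by every `x_ai`: this variable is moved
to the `a`-th factor, at the cost of the parity automorphism on the factors before it. -/
theorem tensorToGr_surjective (m n : ℕ) : Function.Surjective (tensorToGr m n) := by
  have hx : ∀ (p : Fin m × Fin n) (t : ⨂[ℂ] _ : Fin m, Gr (Fin n)),
      ExteriorAlgebra.ι ℂ (Pi.single p (1 : ℂ)) * tensorToGr m n t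
        ∈ LinearMap.range (tensorToGr m n) := by
    rintro ⟨a, i⟩ t
    induction t using PiTensorProduct.induction_on with
    | smul_tprod r f =>
      rw [map_smul, mul_smul_comm, tensorToGr_tprod,
        mul_prod_ofFn _ _ (fun b => grIncl m n b (CliffordAlgebra.involute (f b)))
          (fun b => ι_mul_grIncl b _ _) a]
      refine Submodule.smul_mem _ _ ⟨PiTensorProduct.tprod ℂ fun b =>
        if b < a then CliffordAlgebra.involute (f b) else if b = a then mulX i (f b) else f b, ?_⟩
      rw [tensorToGr_tprod]
      congr 2
      funext b
      split_ifs with h1 h2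
      · rfl
      · subst h2
        rw [mulX, LinearMap.mulLeft_apply, map_mul]
        congr 1
        rw [grIncl, ExteriorAlgebra.map_apply_ι, rowIncl_single]
      · rfl
    | add x y hx hy => rw [map_add, mul_add]; exact add_mem hx hy
  intro f
  rw [← LinearMap.mem_range]
  induction f using CliffordAlgebra.left_induction with
  | algebraMap r =>
    rw [Algebra.algebraMap_eq_smul_one]
    refine Submodule.smul_mem _ _ ⟨PiTensorProduct.tprod ℂ fun _ => 1, ?_⟩
    rw [tensorToGr_tprod]
    simp
  | add x y hx hy => exact add_mem hx hy
  | ι_mul x v h =>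
    obtain ⟨t, rfl⟩ := h
    have e : v = ∑ p, v p • Pi.single p (1 : ℂ) := by
      rw [← pi_eq_sum_univ' v]
    rw [e, map_sum, Finset.sum_mul]
    refine Submodule.sum_mem _ fun p _ => ?_
    rw [map_smul, smul_mul_assoc]
    exact Submodule.smul_mem _ _ (hx p t)

/-- Both sides have dimension `2^{mn}`. -/
theorem tensorToGr_bijective (m n : ℕ) : Function.Bijective (tensorToGr m n) := by
  have b1 := Basis.piTensorProduct fun _ : Fin m => (Pi.basisFun ℂ (Fin n)).ExteriorAlgebra
  have b2 := ((Pi.basisFun ℂ (Fin m × Fin n)).reindex finProdFinEquiv).ExteriorAlgebra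
  have : FiniteDimensional ℂ (⨂[ℂ] _ : Fin m, Gr (Fin n)) := b1.finiteDimensional_of_finite
  have : FiniteDimensional ℂ (Gr (Fin m × Fin n)) := b2.finiteDimensional_of_finite
  refine ⟨?_, tensorToGr_surjective m n⟩
  rw [LinearMap.injective_iff_surjective_of_finrank_eq_finrank]
  · exact tensorToGr_surjective m n
  · rw [Module.finrank_eq_card_basis b1, Module.finrank_eq_card_basis b2]
    simp [pow_mul, mul_comm m n]

end Factorization

/-! ### Isomorphisms of bimodules -/

section Intertwiners

theorem Equivalent.symm {n : ℕ} {H M N : Type*} [AddCommGroup M] [Module ℂ M] [AddCommGroup N]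
    [Module ℂ N] {hM : H → Module.End ℂ M} {yM : Yangian n →ₐ[ℂ] Module.End ℂ M}
    {hN : H → Module.End ℂ N} {yN : Yangian n →ₐ[ℂ] Module.End ℂ N}
    (e : Equivalent hM yM hN yN) : Equivalent hN yN hM yM := by
  obtain ⟨Φ, h, y⟩ := e
  refine ⟨Φ.symm, fun x v => ?_, fun x v => ?_⟩
  · rw [LinearEquiv.symm_apply_eq, h, LinearEquiv.apply_symm_apply]
  · rw [LinearEquiv.symm_apply_eq, y, LinearEquiv.apply_symm_apply]

theorem Equivalent.trans {n : ℕ} {H M N P : Type*} [AddCommGroup M] [Module ℂ M] [AddCommGroup N]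
    [Module ℂ N] [AddCommGroup P] [Module ℂ P]
    {hM : H → Module.End ℂ M} {yM : Yangian n →ₐ[ℂ] Module.End ℂ M}
    {hN : H → Module.End ℂ N} {yN : Yangian n →ₐ[ℂ] Module.End ℂ N}
    {hP : H → Module.End ℂ P} {yP : Yangian n →ₐ[ℂ] Module.End ℂ P}
    (e : Equivalent hM yM hN yN) (e' : Equivalent hN yN hP yP) : Equivalent hM yM hP yP := by
  obtain ⟨Φ, h, y⟩ := e
  obtain ⟨Φ', h', y'⟩ := e'
  refine ⟨Φ.trans Φ', fun x v => ?_, fun x v => ?_⟩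
  · rw [LinearEquiv.trans_apply, LinearEquiv.trans_apply, h, h']
  · rw [LinearEquiv.trans_apply, LinearEquiv.trans_apply, y, y']

/-- A linear map that intertwines the actions of the generators `T_ij^{(s+1)}` intertwines the
actions of the Yangian. -/
theorem intertwine_of_generators {n : ℕ} {M N : Type*} [AddCommGroup M] [Module ℂ M]
    [AddCommGroup N] [Module ℂ N] {yM : Yangian n →ₐ[ℂ] Module.End ℂ M}
    {yN : Yangian n →ₐ[ℂ] Module.End ℂ N} (Φ : M →ₗ[ℂ] N)
    (h : ∀ s i j v, Φ (yM (T n (s + 1) i j) v) = yN (T n (s + 1) i j) (Φ v)) (y : Yangian n)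
    (v : M) : Φ (yM y v) = yN y (Φ v) := by
  induction y using Yangian.induction generalizing v with
  | scalar c =>
    rw [AlgHom.commutes, AlgHom.commutes, Module.algebraMap_end_apply,
      Module.algebraMap_end_apply, map_smul]
  | gen s i j => exact h s i j v
  | add x y hx hy => simp only [map_add, LinearMap.add_apply, hx, hy]
  | mul x y hx hy => simp only [map_mul, Module.End.mul_apply, hx, hy]

theorem slot_intertwine {m : ℕ} {X Z : Fin m → Type*} [∀ a, AddCommGroup (X a)]
    [∀ a, Module ℂ (X a)] [∀ a, AddCommGroup (Z a)] [∀ a, Module ℂ (Z a)]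
    (φ : ∀ a, X a ≃ₗ[ℂ] Z a) (a : Fin m) {f : Module.End ℂ (X a)} {g : Module.End ℂ (Z a)}
    (h : ∀ v, φ a (f v) = g (φ a v)) (t : ⨂[ℂ] a, X a) :
    PiTensorProduct.congr φ (slot a f t) = slot a g (PiTensorProduct.congr φ t) := by
  induction t using PiTensorProduct.induction_on with
  | smul_tprod r v =>
    simp only [map_smul]
    rw [slot_tprod, PiTensorProduct.congr_tprod, PiTensorProduct.congr_tprod, slot_tprod]
    congr 2
    funext b
    by_cases hb : b = a
    · subst hb; simp [h]
    · simp [hb]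
  | add x y hx hy => simp only [map_add, hx, hy]

/-- Isomorphisms between the factors give an isomorphism between the tensor products. -/
theorem equivalent_tensor {m n : ℕ} {X Z : Fin m → Type*} [∀ a, AddCommGroup (X a)]
    [∀ a, Module ℂ (X a)] [∀ a, AddCommGroup (Z a)] [∀ a, Module ℂ (Z a)]
    {e : ∀ a, Module.End ℂ (X a)} {e' : ∀ a, Module.End ℂ (Z a)}
    {ρ : ∀ a, Yangian n →ₐ[ℂ] Module.End ℂ (X a)} {ρ' : ∀ a, Yangian n →ₐ[ℂ] Module.End ℂ (Z a)}
    (φ : ∀ a, X a ≃ₗ[ℂ] Z a) (he : ∀ a v, φ a (e a v) = e' a (φ a v))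
    (hρ : ∀ a y v, φ a (ρ a y v) = ρ' a y (φ a v)) :
    Equivalent (hTensor e) (yTensor ρ) (hTensor e') (yTensor ρ') := by
  refine ⟨PiTensorProduct.congr φ, fun d t => ?_, fun y t => ?_⟩
  · simp only [hTensor, Fintype.linearCombination_apply, LinearMap.sum_apply, LinearMap.smul_apply,
      map_sum, map_smul, slot_intertwine φ _ (he _)]
  · refine intertwine_of_generators (PiTensorProduct.congr φ).toLinearMap (fun s i j t => ?_) y t
    let C := LinearEquiv.conjAlgEquiv ℂ (PiTensorProduct.congr φ)
    have hC : ∀ f u, C f (PiTensorProduct.congr φ u) = PiTensorProduct.congr φ (f u) := by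
      intro f u
      simp [C]
    let F := (PowerSeries.map (C : Module.End ℂ (⨂[ℂ] a, X a) →+* Module.End ℂ (⨂[ℂ] a, Z a)))
    have h1 : ∀ a, F.mapMatrix (slotSeries ρ a) = slotSeries ρ' a := by
      intro a
      refine Matrix.ext fun i j => PowerSeries.ext fun r => ?_
      simp only [F, slotSeries, RingHom.mapMatrix_apply, Matrix.map_apply, Matrix.of_apply,
        PowerSeries.coeff_map, PowerSeries.coeff_mk]
      refine LinearMap.ext fun u => ?_
      obtain ⟨u, rfl⟩ := (PiTensorProduct.congr φ).surjective u
      refine (hC _ u).trans ?_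
      exact slot_intertwine φ a (hρ a _) u
    have h2 : F.mapMatrix (tensorSeries ρ) = tensorSeries ρ' := by
      rw [tensorSeries, tensorSeries, map_list_prod, List.map_ofFn]
      congr 2
      exact funext h1
    rw [yTensor, yTensor, Yangian.lift_T, Yangian.lift_T, ← h2]
    simp only [RingHom.mapMatrix_apply, Matrix.map_apply, F, PowerSeries.coeff_map]
    exact (hC _ t).symm

end Intertwiners

/-! ### Evaluation modules -/

section EvaluationModules

/-- The term `k = 0` of the definition of the shifted series has coefficient zero. -/
theorem map_tau_T {n : ℕ} {A : Type*} [Ring A] [Algebra ℂ A] (χ : Yangian n →ₐ[ℂ] A) (z : ℂ)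
    (s : ℕ) (i j : Fin n) : χ (tau z (T n (s + 1) i j))
      = ∑ k ∈ Finset.range (s + 1), ((s.choose k : ℂ) * z ^ (s - k)) • χ (T n (k + 1) i j) := by
  rw [tau, Yangian.lift_T, shiftT, Finset.sum_range_succ', map_add, map_sum]
  simp [shiftCoeff]

theorem evalAct_T (n : ℕ) (w : ℂ) (s : ℕ) (i j : Fin n) :
    evalAct n w (T n (s + 1) i j) = w ^ s • (mulX i * del j) := by
  have h : ∀ k, (UniversalEnvelopingAlgebra.lift ℂ (fock (Fin n))).comp (evalHom n)
      (T n (k + 1) i j) = if k = 0 then mulX i * del j else 0 := by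
    intro k
    rw [AlgHom.comp_apply, evalHom, Yangian.lift_T]
    cases k with
    | zero =>
      rw [if_pos rfl, evalT, UniversalEnvelopingAlgebra.lift_ι_apply]
      exact (fockLin_single i j 1).trans (one_smul _ _)
    | succ k => rw [if_neg k.succ_ne_zero, evalT, map_zero]
  rw [evalAct, AlgHom.comp_apply, map_tau_T]
  simp [h]

theorem evalAct_tau (n : ℕ) (t z : ℂ) (y : Yangian n) :
    evalAct n t (tau z y) = evalAct n (t + z) y := by
  refine LinearMap.ext fun v => intertwine_of_generators (yM := (evalAct n t).comp (tau z))
    LinearMap.id (fun s i j v => ?_) y v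
  rw [AlgHom.comp_apply, map_tau_T]
  simp only [evalAct_T, smul_smul, ← Finset.sum_smul, add_pow]
  rw [LinearMap.id_apply, LinearMap.id_apply]
  congr 2
  exact Finset.sum_congr rfl fun k _ => by ring

theorem mulX_del_mem_exteriorPower {ι : Type} [DecidableEq ι] (p q : ι) (N : ℕ) {x : Gr ι}
    (hx : x ∈ ⋀[ℂ]^N (ι → ℂ)) : mulX p (del q x) ∈ ⋀[ℂ]^N (ι → ℂ) := by
  induction hx using Submodule.pow_induction_on_left' with
  | algebraMap r =>
    rw [Algebra.algebraMap_eq_smul_one, map_smul, map_smul, mulX_del_one, smul_zero]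
    exact zero_mem _
  | add x y i hx hy h1 h2 => rw [map_add, map_add]; exact add_mem h1 h2
  | mem_mul v hv i x hx h =>
    obtain ⟨v, rfl⟩ := hv
    have e : ⋀[ℂ]^(i + 1) (ι → ℂ)
      = LinearMap.range (ExteriorAlgebra.ι ℂ (M := ι → ℂ)) * ⋀[ℂ]^i (ι → ℂ) := pow_succ' _ _
    rw [mulX_del_leibniz, mulX_del_ι, Nat.succ_eq_add_one, e]
    exact add_mem (Submodule.mul_mem_mul (Submodule.smul_mem _ _ ⟨_, rfl⟩) hx)
      (Submodule.mul_mem_mul ⟨_, rfl⟩ h)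

theorem euler_of_mem_exteriorPower (n N : ℕ) {x : Gr (Fin n)}
    (hx : x ∈ ⋀[ℂ]^N (Fin n → ℂ)) : euler n x = (N : ℂ) • x := by
  have hL : ∀ f g, euler n (f * g) = euler n f * g + f * euler n g := by
    intro f g
    simp only [euler, LinearMap.sum_apply, Module.End.mul_apply, mulX_del_leibniz,
      Finset.sum_add_distrib, Finset.sum_mul, Finset.mul_sum]
  induction hx using Submodule.pow_induction_on_left' with
  | algebraMap r =>
    simp [euler, Algebra.algebraMap_eq_smul_one, mulX_del_one]
  | add x y i hx hy h1 h2 => rw [map_add, h1, h2, smul_add]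
  | mem_mul v hv i x hx h =>
    obtain ⟨v, rfl⟩ := hv
    have e : euler n (ExteriorAlgebra.ι ℂ v) = ExteriorAlgebra.ι ℂ v := by
      rw [euler, LinearMap.sum_apply]
      simp only [Module.End.mul_apply, mulX_del_ι, ← map_smul]
      rw [← map_sum, ← pi_eq_sum_univ' v]
    rw [hL, e, h, mul_smul_comm, Nat.cast_succ, add_smul, one_smul, add_comm]

theorem evalAct_mem_exteriorPower (n : ℕ) (w : ℂ) (N : ℕ) (y : Yangian n) {x : Gr (Fin n)}
    (hx : x ∈ ⋀[ℂ]^N (Fin n → ℂ)) : evalAct n w y x ∈ ⋀[ℂ]^N (Fin n → ℂ) := by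
  induction y using Yangian.induction generalizing x with
  | scalar c =>
    rw [AlgHom.commutes, Module.algebraMap_end_apply]
    exact Submodule.smul_mem _ _ hx
  | gen s i j =>
    rw [evalAct_T]
    exact Submodule.smul_mem _ _ (mulX_del_mem_exteriorPower i j N hx)
  | add x y h1 h2 => rw [map_add]; exact add_mem (h1 hx) (h2 hx)
  | mul x y h1 h2 => rw [map_mul]; exact h1 (h2 hx)

/-- The map `f ↦ 1_t ⊗ f` from `Λ(ℂ^n)` to `E_1(M_t)`. -/
noncomputable def vacTensor (n : ℕ) (t : ℂ) :
    Gr (Fin n) →ₗ[ℂ] EMod 1 n (Verma 1 fun _ => t) :=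
  (TensorProduct.mk ℂ _ _ (vac 1 fun _ => t)).comp (grIncl 1 n 0).toLinearMap

theorem vacTensor_bijective (n : ℕ) (t : ℂ) : Function.Bijective (vacTensor n t) := by
  have hbot : nSub 1 n (Verma 1 fun _ => t) = ⊥ := by
    rw [nSub, Submodule.span_eq_bot]
    rintro _ ⟨a, b, hab, _⟩
    exact absurd hab (by rw [Subsingleton.elim a b]; exact lt_irrefl _)
  have hQ : Function.Bijective (nSub 1 n (Verma 1 fun _ => t)).mkQ := by
    refine ⟨?_, Submodule.mkQ_surjective _⟩
    rw [← LinearMap.ker_eq_bot, Submodule.ker_mkQ, hbot]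
  have h1 : Function.Bijective ((nSub 1 n (Verma 1 fun _ => t)).mkQ ∘ vacTensor n t) := by
    have h2 : (nSub 1 n (Verma 1 fun _ => t)).mkQ ∘ vacTensor n t
        = vacCoinv 1 n (fun _ => t) ∘ tensorToGr 1 n ∘
          (PiTensorProduct.subsingletonEquiv (R := ℂ) (s := fun _ : Fin 1 => Gr (Fin n)) 0).symm := by
      funext f
      simp only [Function.comp_apply]
      rw [PiTensorProduct.subsingletonEquiv_symm_apply, tensorToGr_tprod]
      simp [vacTensor, vacCoinv]
    rw [h2]
    exact (vacCoinv_bijective _ _ _).comp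
      ((tensorToGr_bijective 1 n).comp (LinearEquiv.bijective _))
  exact (Function.Bijective.of_comp_iff' hQ _).1 h1

theorem yAct_vacTensor (n : ℕ) (t : ℂ) (y : Yangian n) (f : Gr (Fin n)) :
    vacTensor n t (evalAct n t y f) = yAct 1 n (Verma 1 fun _ => t) y (vacTensor n t f) := by
  refine intertwine_of_generators (vacTensor n t) (fun s i j f => ?_) y f
  have hpow : ∀ g : Gr (Fin 1 × Fin n), (Emat 1 n (Verma 1 fun _ => t) ^ s) 0 0
      (vac 1 (fun _ => t) ⊗ₜ g) = t ^ s • (vac 1 (fun _ => t) ⊗ₜ g) := by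
    intro g
    induction s with
    | zero => simp
    | succ s ih =>
      have h : Emat 1 n (Verma 1 fun _ => t) 0 0 (vac 1 (fun _ => t) ⊗ₜ g)
          = t • (vac 1 (fun _ => t) ⊗ₜ g) := by
        show ⁅(E 0 0 : gl 1), vac 1 fun _ => t⁆ ⊗ₜ[ℂ] g = _
        rw [lie_vac_self, TensorProduct.smul_tmul']
      rw [pow_succ, Matrix.mul_apply, Fin.sum_univ_one, Module.End.mul_apply, h, map_smul, ih,
        smul_smul, pow_succ']
  rw [evalAct_T, yAct, Yangian.lift_T, LinearMap.smul_apply, map_smul]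
  simp only [howeT, Finset.univ_unique, Finset.sum_singleton, Module.End.mul_apply]
  refine Eq.trans ?_ (hpow (mulX (0, i) (del (0, j) (grIncl 1 n 0 f)))).symm
  rw [mulX_del_grIncl]
  rfl

theorem glAct_vacTensor (n : ℕ) (t : ℂ) (X : gl 1) (f : Gr (Fin n)) :
    vacTensor n t ((X 0 0 • (t • (1 : Module.End ℂ (Gr (Fin n))) + euler n)) f)
      = glAct 1 n (Verma 1 fun _ => t) X (vacTensor n t f) := by
  have hX : X = X 0 0 • (E 0 0 : gl 1) := by
    ext a b
    rw [Subsingleton.elim a 0, Subsingleton.elim b 0]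
    simp
  have h : glAct 1 n (Verma 1 fun _ => t) (E 0 0) (vacTensor n t f)
      = vacTensor n t ((t • (1 : Module.End ℂ (Gr (Fin n))) + euler n) f) := by
    refine (glAct_tmul _ 0 0 (vac 1 fun _ => t) (grIncl 1 n 0 f)).trans ?_
    rw [lie_vac_self, fockMat, Matrix.of_apply, LinearMap.sum_apply]
    simp only [Module.End.mul_apply, mulX_del_grIncl, ← map_sum]
    rw [TensorProduct.smul_tmul, ← map_smul, ← TensorProduct.tmul_add, ← map_add]
    simp [vacTensor, euler]
  conv_rhs => rw [hX, map_smul, LinearMap.smul_apply, h]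
  rw [LinearMap.smul_apply, map_smul]

/-- The bimodule `E_1^z(M_t)` is the exterior algebra with the evaluation action shifted by `t - z`.
Here `M` has the single entry `E_11`, which acts on `1_t` as `t`. -/
theorem equivalent_evalAct (n : ℕ) (t z : ℂ) :
    ∃ Φ : Gr (Fin n) ≃ₗ[ℂ] EMod 1 n (Verma 1 fun _ => t),
      (∀ (X : gl 1) f, Φ ((X 0 0 • (t • (1 : Module.End ℂ (Gr (Fin n))) + euler n)) f)
        = glAct 1 n (Verma 1 fun _ => t) X (Φ f)) ∧
      ∀ y f, Φ (evalAct n (t - z) y f) = yActShift 1 n (Verma 1 fun _ => t) z y (Φ f) := by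
  refine ⟨LinearEquiv.ofBijective _ (vacTensor_bijective n t), fun X f => glAct_vacTensor n t X f,
    fun y f => ?_⟩
  rw [sub_eq_add_neg, ← evalAct_tau]
  exact yAct_vacTensor n t _ f

end EvaluationModules

/-! ### The bimodule of coinvariants -/

section CoinvariantBimodule

theorem slot_add_euler (m n : ℕ) (a : Fin m) (c : ℂ) (t : ⨂[ℂ] _ : Fin m, Gr (Fin n)) :
    tensorToGr m n (slot a (c • (1 : Module.End ℂ (Gr (Fin n))) + euler n) t)
      = c • tensorToGr m n t + ∑ k, mulX (a, k) (del (a, k) (tensorToGr m n t)) := by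
  have h : slot (X := fun _ : Fin m => Gr (Fin n)) a
      (c • (1 : Module.End ℂ (Gr (Fin n))) + euler n)
      = c • 1 + ∑ k, slot (X := fun _ : Fin m => Gr (Fin n)) a (mulX k * del k) := by
    have h1 := map_add (slotHom (X := fun _ : Fin m => Gr (Fin n)) a) (c • 1) (euler n)
    rw [map_smul, map_one, euler, map_sum] at h1
    exact h1
  rw [h]
  simp only [LinearMap.add_apply, LinearMap.smul_apply, LinearMap.sum_apply, map_add, map_smul,
    map_sum, tensorToGr_slot, Module.End.one_apply]

theorem yTensor_evalAct_T (m n : ℕ) (w : Fin m → ℂ) (s : ℕ) (i j : Fin n) :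
    yTensor (fun a : Fin m => evalAct n (w a)) (T n (s + 1) i j)
      = ∑ b, fusion w (fun a => Matrix.of fun i j =>
          slot (X := fun _ : Fin m => Gr (Fin n)) a (mulX i * del j)) s b i j := by
  rw [yTensor, Yangian.lift_T, tensorSeries]
  refine (coeff_prod_eq_sum_fusion w _ _ (fun b i j => ?_) (fun b s i j => ?_) i j).2 s
  · rw [slotSeries, Matrix.of_apply, PowerSeries.coeff_mk, (T_isRTT n).zero]
    split_ifs
    · rw [map_one]; exact slot_one b
    · rw [map_zero]; exact map_zero (slotHom b)
  · rw [slotSeries, Matrix.of_apply, PowerSeries.coeff_mk, evalAct_T]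
    exact map_smul (slotHom b) _ _

/-- The coinvariants of `E_m(M_μ)` as a tensor product of shifted evaluation modules. -/
theorem equivalent_coinv (m n : ℕ) (μ : Fin m → ℂ) :
    Equivalent (hTensor fun a : Fin m => μ a • (1 : Module.End ℂ (Gr (Fin n))) + euler n)
      (yTensor fun a : Fin m => evalAct n (μ a - ((a : ℕ) : ℂ)))
      (coinvH m n (Verma m μ)) (coinvY m n (Verma m μ)) := by
  have hb : Function.Bijective ((vacCoinv m n μ).comp (tensorToGr m n)) :=
    (vacCoinv_bijective m n μ).comp (tensorToGr_bijective m n)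
  refine ⟨LinearEquiv.ofBijective _ hb, fun d t => ?_, fun y t =>
    intertwine_of_generators ((vacCoinv m n μ).comp (tensorToGr m n)) (fun s i j t => ?_) y t⟩
  · rw [LinearEquiv.ofBijective_apply, LinearEquiv.ofBijective_apply, LinearMap.comp_apply,
      LinearMap.comp_apply, coinvH_vacCoinv]
    congr 1
    simp only [hTensor, Fintype.linearCombination_apply, LinearMap.sum_apply,
      LinearMap.smul_apply, map_sum, map_smul, slot_add_euler]
  · rw [LinearMap.comp_apply, LinearMap.comp_apply, coinvY_vacCoinv, yTensor_evalAct_T]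
    congr 1
    rw [LinearMap.sum_apply, map_sum]
    exact Finset.sum_congr rfl fun b _ => fusion_intertwine (tensorToGr m n) _
      (fun b i j f => tensorToGr_slot m n b i j f) s b i j t

end CoinvariantBimodule

end KN

theorem corollary2p4 (m n : ℕ) (μ : Fin m → ℂ) :
    -- `E_m(M_μ)_𝔫 ≅ E_1(M_{μ_1}) ⊗ E_1^1(M_{μ_2}) ⊗ ⋯ ⊗ E_1^{m-1}(M_{μ_m})`
    KN.Equivalent
      (KN.coinvH m n (KN.Verma m μ))
      (KN.coinvY m n (KN.Verma m μ))
      (KN.hTensor fun a : Fin m => KN.glAct 1 n (KN.Verma 1 fun _ => μ a) (KN.E 0 0))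
      (KN.yTensor fun a : Fin m => KN.yActShift 1 n (KN.Verma 1 fun _ => μ a) ((a : ℕ) : ℂ)) ∧
    -- each factor `E_1^z(M_t)` is the exterior algebra with the evaluation action shifted by `t - z`
    (∀ t z : ℂ, KN.Equivalent
      (KN.glAct 1 n (KN.Verma 1 fun _ => t))
      (KN.yActShift 1 n (KN.Verma 1 fun _ => t) z)
      (fun X : KN.gl 1 => X 0 0 • (t • (1 : Module.End ℂ (KN.Gr (Fin n))) + KN.euler n))
      (KN.evalAct n (t - z))) ∧
    -- this is the direct sum of the evaluation modules on the exterior powers of `ℂ^n`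
    (∀ (N : ℕ) (x : KN.Gr (Fin n)), x ∈ ⋀[ℂ]^N (Fin n → ℂ) →
      (∀ (w : ℂ) (y : KN.Yangian n), KN.evalAct n w y x ∈ ⋀[ℂ]^N (Fin n → ℂ)) ∧
        KN.euler n x = (N : ℂ) • x) ∧
    -- hence `E_m(M_μ)_𝔫` is a tensor product of shifted evaluation modules
    KN.Equivalent
      (KN.coinvH m n (KN.Verma m μ))
      (KN.coinvY m n (KN.Verma m μ))
      (KN.hTensor fun a : Fin m => μ a • (1 : Module.End ℂ (KN.Gr (Fin n))) + KN.euler n)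
      (KN.yTensor fun a : Fin m => KN.evalAct n (μ a - ((a : ℕ) : ℂ))) := by

  have hc := (KN.equivalent_coinv m n μ).symm
  refine ⟨hc.trans ?_, fun t z => ?_, fun N x hx => ⟨fun w y =>
    KN.evalAct_mem_exteriorPower n w N y hx, KN.euler_of_mem_exteriorPower n N hx⟩, hc⟩
  · choose Φ h1 h2 using fun a : Fin m => KN.equivalent_evalAct n (μ a) ((a : ℕ) : ℂ)
    refine KN.equivalent_tensor Φ (fun a v => ?_) h2
    have := h1 a (KN.E 0 0) v
    rwa [show (KN.E 0 0 : KN.gl 1) 0 0 = 1 by simp, one_smul] at this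
  · obtain ⟨Φ, h1, h2⟩ := KN.equivalent_evalAct n t z
    exact KN.Equivalent.symm ⟨Φ, h1, h2⟩
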